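/- Let $(X,\mu)$ be a standard probability space and let $\mathcal R\subset X\times X$ be an equivalence relation that is measurable as a subset of $X\times X$, has countable classes, and is nonsingular (the $\mathcal R$-saturation of every $\mu$-null set is $\mu$-null). The full group $[\mathcal R]$ consists of the nonsingular automorphisms $\theta$ of $(X,\mu)$ with $(x,\theta(x))\in\mathcal R$ for a.e. $x$; for a function $f$ on $X$ put $\theta(f)=f\circ\theta^{-1}$; and $\theta$ is called $\mu$-bounded if $\log\frac{\mathrm d(\mu\circ\theta)}{\mathrm d\mu}$ is essentially bounded. A $\sigma$-finite measure $\nu$ equivalent to $\mu$ is $\mathcal R$-invariant ($\mathcal R$ preserves $\nu$) if $\int_X \#\{y : (x,y)\in W\}\,\mathrm d\nu(x)=\int_X \#\{x : (x,y)\in W\}\,\mathrm d\nu(y)$ for all measurable $W\subset\mathcal R$. Call $\mathcal R$ ergodic if every $f\in L^\infty(X,\mu)$ with $f(x)=f(y)$ for a.e. $(x,y)\in\mathcal R$ (i.e. for a.e. $x$ and all $y$ with $(x,y)\in\mathcal R$) is a.e. constant. An ergodic $\mathcal R$ is of type $\mathrm{III}$ if no single class of $\mathcal R$ has full measure and there is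 no $\mathcal R$-invariant $\sigma$-finite measure, of total mass $1$ or $\infty$, equivalent to $\mu$. Finally, $\mathcal R$ is strongly ergodic if, for every sequence of measurable sets $A_n\subset X$ with $\lim_n\mu(A_n\triangle g(A_n))=0$ for all $g\in[\mathcal R]$, one has $\lim_n\mu(A_n)(1-\mu(A_n))=0$. Theorem. Let $\mathcal R$ be such an equivalence relation on $(X,\mu)$. Assume that $\mathcal R$ is ergodic and that it either preserves $\mu$ or is of type $\mathrm{III}$. Then the following are equivalent: (i) $\mathcal R$ is strongly ergodic. (ii) There exist a constant $\kappa>0$ and a finite family $\theta_1,\dots,\theta_n$ of $\mu$-bounded elements of $[\mathcal R]$ such that, for all $f\in L^2(X,\mu)$ (complex-valued), with $\mu(f)=\int_X f\,\mathrm d\mu$, $$\|f-\mu(f)\|_2^2\le\kappa\sum_{k=1}^n\|\theta_k(f)-f\|_2^2 .$$ -/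

import Mathlib

open MeasureTheory Filter Topology
open scoped NNReal ENNReal symmDiff

namespace EqRel

section

variable {X : Type*} [MeasurableSpace X]

/-- Standing assumptions on an equivalence relation on a measure space: measurable as a subset of
`X × X`, with countable classes, and such that the saturation of a null set is a null set. -/
structure IsCountableNonsingular (R : Setoid X) (μ : Measure X) : Prop where
  measurableSet : MeasurableSet {p : X × X | R p.1 p.2}
  countable_class : ∀ x, {y | R x y}.Countable
  nonsingular : ∀ N : Set X, μ N = 0 → μ {y | ∃ x ∈ N, R x y} = 0

/-- A nonsingular automorphism: both `θ` and `θ⁻¹` send null sets to null sets. -/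
def IsNonsingularAut (μ : Measure X) (θ : X ≃ᵐ X) : Prop :=
  Measure.QuasiMeasurePreserving θ μ μ ∧ Measure.QuasiMeasurePreserving θ.symm μ μ

/-- The full group `[R]`: the nonsingular automorphisms `θ` with `(x, θ x) ∈ R` for a.e. `x`.
(Elements are represented by everywhere defined automorphisms, not identified when they agree
almost everywhere.) -/
def fullGroup (R : Setoid X) (μ : Measure X) : Set (X ≃ᵐ X) :=
  {θ | IsNonsingularAut μ θ ∧ ∀ᵐ x ∂μ, R x (θ x)}

/-- `θ` is `μ`-bounded: `log (d(μ ∘ θ)/dμ)` is (essentially) bounded. Here `μ ∘ θ` is the measure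
`A ↦ μ (θ(A))`, that is `μ.comap θ`. -/
def IsBoundedAut (μ : Measure X) (θ : X ≃ᵐ X) : Prop :=
  IsNonsingularAut μ θ ∧
    ∃ C : ℝ, ∀ᵐ x ∂μ, |Real.log ((μ.comap θ).rnDeriv μ x).toReal| ≤ C

/-- `R` is ergodic: every invariant function in `L^∞(X, μ)` is a.e. constant. A subset of `R` is
null when its projection to `X` is null, so that `f x = f y` for a.e. `(x, y) ∈ R` means that for
a.e. `x` it holds for all `y` in the class of `x`. -/
def IsErgodic (R : Setoid X) (μ : Measure X) : Prop :=
  ∀ f : X → ℂ, MemLp f ∞ μ → (∀ᵐ x ∂μ, ∀ y, R x y → f x = f y) → ∃ c : ℂ, f =ᵐ[μ] fun _ => c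

/-- `R` is strongly ergodic: every almost invariant sequence of measurable sets is trivial. -/
def IsStronglyErgodic (R : Setoid X) (μ : Measure X) : Prop :=
  ∀ A : ℕ → Set X, (∀ n, MeasurableSet (A n)) →
    (∀ g ∈ fullGroup R μ, Tendsto (fun n => μ (A n ∆ (g '' A n))) atTop (𝓝 0)) →
    Tendsto (fun n => μ (A n) * (1 - μ (A n))) atTop (𝓝 0)

/-- The left counting measure `ν_ℓ(W) = ∫ #{y | (x, y) ∈ W} dν(x)`, for `W ⊆ R`. -/
noncomputable def leftCount (ν : Measure X) (W : Set (X × X)) : ℝ≥0∞ :=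
  ∫⁻ x, (({y | (x, y) ∈ W}.encard : ℕ∞) : ℝ≥0∞) ∂ν

/-- The right counting measure `ν_r(W) = ∫ #{x | (x, y) ∈ W} dν(y)`, for `W ⊆ R`. -/
noncomputable def rightCount (ν : Measure X) (W : Set (X × X)) : ℝ≥0∞ :=
  ∫⁻ y, (({x | (x, y) ∈ W}.encard : ℕ∞) : ℝ≥0∞) ∂ν

/-- `ν` is `R`-invariant (equivalently, `R` preserves `ν`): the left and right counting measures
on `R` coincide. -/
def IsInvariant (R : Setoid X) (ν : Measure X) : Prop :=
  ∀ W : Set (X × X), MeasurableSet W → (∀ p ∈ W, R p.1 p.2) → leftCount ν W = rightCount ν W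

/-- `𝓜(X)`: the `σ`-finite measures in the measure class of `μ`. -/
def measureClass (μ : Measure X) : Set (Measure X) :=
  {ν | SigmaFinite ν ∧ ν ≪ μ ∧ μ ≪ ν}

/-- Type I: only one equivalence class up to measure zero. -/
def IsTypeI (R : Setoid X) (μ : Measure X) : Prop :=
  IsErgodic R μ ∧ ∃ x, ∀ᵐ y ∂μ, R x y

/-- Type II₁: not of type I, with an invariant probability measure in the measure class. -/
def IsTypeIIOne (R : Setoid X) (μ : Measure X) : Prop :=
  IsErgodic R μ ∧ ¬ IsTypeI R μ ∧
    ∃ ν ∈ measureClass μ, IsProbabilityMeasure ν ∧ IsInvariant R ν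

/-- Type II_∞: not of type I, with an infinite invariant measure in the measure class. -/
def IsTypeIIInfty (R : Setoid X) (μ : Measure X) : Prop :=
  IsErgodic R μ ∧ ¬ IsTypeI R μ ∧
    ∃ ν ∈ measureClass μ, ν Set.univ = ∞ ∧ IsInvariant R ν

/-- Type III: ergodic and of none of the types I, II₁, II_∞. -/
def IsTypeIII (R : Setoid X) (μ : Measure X) : Prop :=
  IsErgodic R μ ∧ ¬ IsTypeI R μ ∧ ¬ IsTypeIIOne R μ ∧ ¬ IsTypeIIInfty R μ

end

end EqRel

/-! The implication from the spectral gap to strong ergodicity is the inequality for indicators: for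
`f = 1_A` the left side is `μ(A)(1 - μ(A))` and the summands are `μ(A ∆ θ_k(A))`.

For the converse, Cheeger's inequality (`spectralGap_of_expansion`) reduces the gap to expansion:
finitely many bounded automorphisms and `ε > 0` such that every `B` with `0 < μ(B) ≤ 1/2` is
displaced by one of them by more than `ε μ(B)`. Strong ergodicity directly gives only an absolute
bound (`exists_finset_of_isStronglyErgodic`): sets of intermediate measure are displaced by more
than a constant. To pass to a relative bound, suppose expansion fails and let `A` be maximal among
sets of measure at most `1/8` with relative displacement at most `ε₀`. Failure provides a non-null
`B` of tiny relative displacement. If `B` is nearly independent of `A` and of the parts of `X`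
displaced by `A`, then `A ∪ B` contradicts maximality (`exists_expansion`).

Near independence (`exists_equidistribution`) comes from a limit. Along sets `B` of vanishing
relative displacement, the normalized restrictions `μ(· ∩ B)/μ(B)` have an ultralimit `φ`, a
finitely additive mean which bounded automorphisms distort no more than they distort `μ`. A
countably additive such `φ` is `μ`, because ergodicity makes its density constant. Countable
additivity holds since a set `C` of small measure has `N` almost disjoint copies of distortion at
most `e^K`, with `K` independent of `N`; hence `N φ(C) ≤ e^K`.

The copies exist if, for some `η` and `K`, almost every orbit reaches every `Y` with `μ(Yᶜ) ≤ η` at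
logarithmic derivative at most `K` in absolute value. For invariant `μ` this is ergodicity, with `K
= 0`. In type III it is `exists_ae_mem_nb`: view the Radon–Nikodym cocycle as a height on each orbit
and cut the orbits at the points farther than `K` from `Y`. For large `K` a given finite set of
group elements rarely crosses a cut, so by strong ergodicity the cut relation has an ergodic
component of nearly full measure. A bound on the height gap across a cut is an invariant condition,
so some bound holds on the whole component, and the cut points themselves are at bounded distance
from `Y`. Type III enters as recurrence to arbitrarily large and small heights. -/

namespace EqRel

/-! ### Exhaustion. -/

section Exhaustion

variable {X : Type*} [MeasurableSpace X]

/-- A property of sets that is stable under increasing countable unions has an almost everywhere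
maximal representative. -/
theorem exists_ae_maximal (μ : Measure X) [IsFiniteMeasure μ] (P : Set X → Prop) {A₀ : Set X}
    (h₀ : P A₀)
    (hU : ∀ A : ℕ → Set X, Monotone A → (∀ n, P (A n)) → P (⋃ n, A n)) :
    ∃ A, P A ∧ ∀ B, P B → A ⊆ B → μ B ≤ μ A := by
  -- The largest measure still attainable above `A`. Each step of the chain comes within `1/(n+1)`
  -- of it, so nothing above the union can have larger measure.
  let s : Set X → ℝ≥0∞ := fun A => ⨆ B : {B : Set X // P B ∧ A ⊆ B}, μ B
  have step : ∀ (n : ℕ) (A : {A : Set X // P A}),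
      ∃ B : {B : Set X // P B}, A.1 ⊆ B.1 ∧ s A.1 ≤ μ B.1 + ((n : ℝ≥0∞) + 1)⁻¹ := by
    intro n A
    have hne : ((n : ℝ≥0∞) + 1)⁻¹ ≠ 0 := by simp
    have hfin : s A.1 ≠ ∞ := by
      refine ne_top_of_le_ne_top (measure_ne_top μ Set.univ) (iSup_le fun B => ?_)
      exact measure_mono (Set.subset_univ _)
    by_contra! hcon
    have : s A.1 + ((n : ℝ≥0∞) + 1)⁻¹ ≤ s A.1 := by
      have hh : s A.1 + ((n : ℝ≥0∞) + 1)⁻¹ =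
          ⨆ B : {B : Set X // P B ∧ A.1 ⊆ B}, (μ B + ((n : ℝ≥0∞) + 1)⁻¹) := by
        have : Nonempty {B : Set X // P B ∧ A.1 ⊆ B} := ⟨⟨A.1, A.2, subset_rfl⟩⟩
        exact ENNReal.iSup_add fun B : {B : Set X // P B ∧ A.1 ⊆ B} => μ B
      rw [hh]
      exact iSup_le fun B => (hcon ⟨B.1, B.2.1⟩ B.2.2).le
    exact absurd this (not_le.2 (ENNReal.lt_add_right hfin hne))
  choose nxt hsub hnxt using step
  let A : ℕ → {A : Set X // P A} := fun n => Nat.rec ⟨A₀, h₀⟩ (fun n B => nxt n B) n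
  have hA : ∀ n, A (n + 1) = nxt n (A n) := fun n => rfl
  have hmono : Monotone fun n => (A n).1 := monotone_nat_of_le_succ fun n => by
    rw [hA]; exact hsub n (A n)
  refine ⟨⋃ n, (A n).1, hU _ hmono fun n => (A n).2, fun B hB hAB => ?_⟩
  have key : ∀ n : ℕ, μ B ≤ μ (⋃ n, (A n).1) + ((n : ℝ≥0∞) + 1)⁻¹ := by
    intro n
    calc μ B ≤ s (A n).1 :=
          le_iSup (fun B : {B : Set X // P B ∧ (A n).1 ⊆ B} => μ B)
            ⟨B, hB, (Set.subset_iUnion (fun n => (A n).1) n).trans hAB⟩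
      _ ≤ μ (A (n + 1)).1 + ((n : ℝ≥0∞) + 1)⁻¹ := hnxt n (A n)
      _ ≤ _ := by
          gcongr
          exact Set.subset_iUnion (fun n => (A n).1) (n + 1)
  have hlim : Tendsto (fun n : ℕ => μ (⋃ n, (A n).1) + ((n : ℝ≥0∞) + 1)⁻¹) atTop
      (𝓝 (μ (⋃ n, (A n).1) + 0)) := by
    refine tendsto_const_nhds.add ?_
    have := (tendsto_add_atTop_iff_nat 1).2 ENNReal.tendsto_inv_nat_nhds_zero
    simpa using this
  rw [add_zero] at hlim
  exact ge_of_tendsto' hlim key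

end Exhaustion

/-! ### An almost everywhere Lusin–Novikov theorem. -/

section Uniformization

variable {X Z : Type*} [MeasurableSpace X] [MeasurableSpace Z]

/-- `W` is covered, over almost every point, by countably many graphs of measurable functions. -/
def AECovered (μ : Measure X) (W : Set (X × Z)) : Prop :=
  ∃ F : Set (X → Z), F.Countable ∧ (∀ f ∈ F, Measurable f) ∧
    ∀ᵐ x ∂μ, ∀ z, (x, z) ∈ W → ∃ f ∈ F, f x = z

theorem AECovered.mono {μ : Measure X} {W W' : Set (X × Z)} (h : AECovered μ W') (hs : W ⊆ W') :
    AECovered μ W := by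
  obtain ⟨F, hF, hm, hc⟩ := h
  exact ⟨F, hF, hm, hc.mono fun x hx z hz => hx z (hs hz)⟩

theorem AECovered.iUnion {ι : Type*} [Countable ι] {μ : Measure X} {W : ι → Set (X × Z)}
    (h : ∀ i, AECovered μ (W i)) : AECovered μ (⋃ i, W i) := by
  choose F hF hm hc using h
  refine ⟨⋃ i, F i, Set.countable_iUnion hF, ?_, ?_⟩
  · intro f hf
    obtain ⟨i, hi⟩ := Set.mem_iUnion.1 hf
    exact hm i f hi
  · filter_upwards [ae_all_iff.2 hc] with x hx z hz
    obtain ⟨i, hi⟩ := Set.mem_iUnion.1 hz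
    obtain ⟨f, hf, hfx⟩ := hx i z hi
    exact ⟨f, Set.mem_iUnion.2 ⟨i, hf⟩, hfx⟩

theorem AECovered.union {μ : Measure X} {W W' : Set (X × Z)}
    (h : AECovered μ W) (h' : AECovered μ W') : AECovered μ (W ∪ W') := by
  rw [Set.union_eq_iUnion]
  exact AECovered.iUnion fun b => by cases b <;> assumption

theorem aecovered_of_ae_null {μ : Measure X} {W : Set (X × Z)}
    (h : ∀ᵐ x ∂μ, ∀ z, (x, z) ∉ W) : AECovered μ W :=
  ⟨∅, Set.countable_empty, by simp, h.mono fun x hx z hz => absurd hz (hx z)⟩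

/-- The part over `E` of the graph of `p : Z → X`, restricted to `V`. -/
def graphPart (p : Z → X) (V : Set Z) (E : Set X) : Set (X × Z) :=
  {w | w.1 ∈ E ∧ w.2 ∈ V ∧ p w.2 = w.1}

/-- Exhaustion yields a measurable hull of the set of points whose fibre in `V` resists covering by
countably many graphs, without any measurability of projections. -/
theorem exists_maximal_aecovered (μ : Measure X) [IsFiniteMeasure μ] (p : Z → X) (V : Set Z) :
    ∃ S : Set X, MeasurableSet S ∧ AECovered μ (graphPart p V Sᶜ) ∧
      ∀ E, MeasurableSet E → AECovered μ (graphPart p V E) → μ (S ∩ E) = 0 := by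
  obtain ⟨A, ⟨hA, hAc⟩, hmax⟩ := exists_ae_maximal μ
    (fun E => MeasurableSet E ∧ AECovered μ (graphPart p V E)) (A₀ := ∅)
    ⟨.empty, aecovered_of_ae_null (by simp [graphPart])⟩
    (fun A _ h => ⟨.iUnion fun n => (h n).1,
      (AECovered.iUnion fun n => (h n).2).mono fun w hw => by
        obtain ⟨n, hn⟩ := Set.mem_iUnion.1 hw.1
        exact Set.mem_iUnion.2 ⟨n, hn, hw.2⟩⟩)
  refine ⟨Aᶜ, hA.compl, by rwa [compl_compl], fun E hE hEc => ?_⟩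
  have h1 := hmax (A ∪ E) ⟨hA.union hE, (hAc.union hEc).mono fun w hw =>
    hw.1.elim (fun h => Or.inl ⟨h, hw.2⟩) (fun h => Or.inr ⟨h, hw.2⟩)⟩ Set.subset_union_left
  have h2 : μ (A ∪ E) = μ A + μ (Aᶜ ∩ E) := by
    rw [← measure_inter_add_sdiff (A ∪ E) hA]
    congr 2
    · ext x; simp +contextual
    · ext x; simp only [Set.mem_sdiff, Set.mem_union, Set.mem_inter_iff, Set.mem_compl_iff]; tauto
  rw [h2] at h1
  have := ENNReal.le_of_add_le_add_left (measure_ne_top μ A) (c := 0) (by simpa using h1)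
  simpa using this

/-- A measurable set on which the first projection is injective is the graph of a partial
function. -/
theorem aecovered_of_injOn_fst [StandardBorelSpace X] [StandardBorelSpace Z] {μ : Measure X}
    {W : Set (X × Z)} (hW : MeasurableSet W) (hinj : Set.InjOn Prod.fst W) : AECovered μ W := by
  classical
  rcases W.eq_empty_or_nonempty with rfl | ⟨w₀, hw₀⟩
  · exact aecovered_of_ae_null (by simp)
  have hD : MeasurableSet (Prod.fst '' W) :=
    hW.image_of_measurable_injOn measurable_fst hinj
  let f : X → Z := fun x => if h : ∃ z, (x, z) ∈ W then h.choose else w₀.2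
  have hf : ∀ x z, (x, z) ∈ W → f x = z := by
    intro x z hz
    have h : ∃ z, (x, z) ∈ W := ⟨z, hz⟩
    have h1 : f x = h.choose := dif_pos h
    rw [h1]
    exact congrArg Prod.snd (hinj h.choose_spec hz rfl)
  have hf' : ∀ x, x ∉ Prod.fst '' W → f x = w₀.2 := by
    intro x hx
    exact dif_neg fun ⟨z, hz⟩ => hx ⟨(x, z), hz, rfl⟩
  refine ⟨{f}, Set.countable_singleton f, ?_, ae_of_all _ fun x z hz => ⟨f, rfl, hf x z hz⟩⟩
  rintro _ rfl
  intro Q hQ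
  -- Lusin–Souslin: injective measurable images of Borel sets are Borel.
  have h1 : MeasurableSet (Prod.fst '' (W ∩ Prod.snd ⁻¹' Q)) :=
    (hW.inter (measurable_snd hQ)).image_of_measurable_injOn measurable_fst
      (hinj.mono Set.inter_subset_left)
  have h2 : f ⁻¹' Q = Prod.fst '' (W ∩ Prod.snd ⁻¹' Q) ∪
      ((Prod.fst '' W)ᶜ ∩ {_x | w₀.2 ∈ Q}) := by
    ext x
    by_cases hx : x ∈ Prod.fst '' W
    · obtain ⟨⟨x, z⟩, hz, rfl⟩ := hx
      constructor
      · intro h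
        refine Or.inl ⟨(x, z), ⟨hz, ?_⟩, rfl⟩
        have : f x ∈ Q := h
        rwa [hf x z hz] at this
      · rintro (⟨⟨x', z'⟩, ⟨hz', hq⟩, hx'⟩ | ⟨h, -⟩)
        · have : x' = x := hx'
          subst this
          change f x' ∈ Q
          rw [hf x' z' hz']; exact hq
        · exact absurd ⟨(x, z), hz, rfl⟩ h
    · have : x ∉ Prod.fst '' (W ∩ Prod.snd ⁻¹' Q) :=
        fun h => hx (Set.image_mono Set.inter_subset_left h)
      simp only [Set.mem_preimage, hf' x hx, Set.mem_union, this, false_or, Set.mem_inter_iff,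
        Set.mem_compl_iff, hx, not_false_eq_true, true_and, Set.mem_ofPred_eq]
  rw [h2]
  exact h1.union (hD.compl.inter (MeasurableSet.const _))

/-- The almost everywhere uniformization theorem for a continuous map with countable fibres. -/
theorem ae_uniformization_of_continuous [TopologicalSpace Z] [PolishSpace Z] [BorelSpace Z]
    [TopologicalSpace X] [PolishSpace X] [BorelSpace X] (μ : Measure X) [IsFiniteMeasure μ]
    {p : Z → X} (hp : Continuous p) (hfib : ∀ x, (p ⁻¹' {x}).Countable) :
    AECovered μ {w : X × Z | p w.2 = w.1} := by
  let := TopologicalSpace.upgradeIsCompletelyMetrizable Z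
  obtain ⟨B, hBc, -, hB⟩ := TopologicalSpace.exists_countable_basis Z
  have : Countable B := hBc.to_subtype
  -- The goal is that every `S V` is null. For almost every `x`, the basic sets `V` with `x ∈ S V`
  -- are closed under enlargement, have `x` in the closure of `p '' V`, contain small members of the
  -- same kind, and contain two disjoint ones. If there were any such `V`, the points all of whose
  -- basic neighbourhoods are of this kind would form a nonempty perfect subset of the countable
  -- fibre over `x`.
  choose S hSm hSc hSmax using fun V : B => exists_maximal_aecovered μ p (V : Set Z)
  have hnull : ∀ (V : B) (E : Set X), MeasurableSet E → AECovered μ (graphPart p V E) →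
      ∀ᵐ x ∂μ, x ∈ S V → x ∉ E := by
    intro V E hE hc
    have := measure_eq_zero_iff_ae_notMem.1 (hSmax V E hE hc)
    filter_upwards [this] with x hx h1 h2 using hx ⟨h1, h2⟩
  have hmono : ∀ᵐ x ∂μ, ∀ V U : B, (V : Set Z) ⊆ U → x ∈ S V → x ∈ S U := by
    simp only [ae_all_iff]
    intro V U hVU
    filter_upwards [hnull V (S U)ᶜ (hSm U).compl
      ((hSc U).mono fun w hw => ⟨hw.1, hVU hw.2.1, hw.2.2⟩)] with x hx h
    simpa using hx h
  have hclos : ∀ᵐ x ∂μ, ∀ V : B, x ∈ S V → x ∈ closure (p '' V) := by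
    rw [ae_all_iff]
    intro V
    filter_upwards [hnull V (closure (p '' V))ᶜ isClosed_closure.measurableSet.compl
      (aecovered_of_ae_null (ae_of_all _ fun x z hz => hz.1 (subset_closure
        ⟨z, hz.2.1, hz.2.2⟩)))] with x hx h
    simpa using hx h
  have hrefine : ∀ᵐ x ∂μ, ∀ (n : ℕ) (V : B), x ∈ S V → ∃ U : B, closure (U : Set Z) ⊆ V ∧
      (∀ a ∈ (U : Set Z), ∀ b ∈ (U : Set Z), dist a b ≤ 1 / ((n : ℝ) + 1)) ∧ x ∈ S U := by
    simp only [ae_all_iff]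
    intro n V
    let I := {U : B // closure (U : Set Z) ⊆ V ∧
      ∀ a ∈ (U : Set Z), ∀ b ∈ (U : Set Z), dist a b ≤ 1 / ((n : ℝ) + 1)}
    -- Every point of `V` has a small basic neighbourhood with closure in `V`; covering over all of
    -- these would cover over `V`.
    have hcov : AECovered μ (graphPart p V (⋂ U : I, (S U.1)ᶜ)) := by
      refine (AECovered.iUnion fun U : I => hSc U.1).mono ?_
      rintro ⟨x, z⟩ ⟨hx, hz, hpz⟩
      have hnh : (V : Set Z) ∩ Metric.ball z (1 / (2 * ((n : ℝ) + 1))) ∈ 𝓝 z :=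
        inter_mem ((hB.isOpen V.2).mem_nhds hz) (Metric.ball_mem_nhds _ (by positivity))
      obtain ⟨N, ⟨hN, hNcl⟩, hNs⟩ := (closed_nhds_basis z).mem_iff.1 hnh
      obtain ⟨U, hU, hzU, hUN⟩ := hB.mem_nhds_iff.1 hN
      have hUs : closure U ⊆ N := closure_minimal hUN hNcl
      let U' : I := ⟨⟨U, hU⟩, fun a ha => (hNs (hUs ha)).1, fun a ha b hb => by
        have h1 := Metric.mem_ball.1 (hNs (hUN ha)).2
        have h2 := Metric.mem_ball.1 (hNs (hUN hb)).2
        have h3 := dist_triangle_right a b z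
        have h4 : 1 / (2 * ((n : ℝ) + 1)) + 1 / (2 * ((n : ℝ) + 1)) = 1 / ((n : ℝ) + 1) := by
          field_simp; norm_num
        linarith⟩
      exact Set.mem_iUnion.2 ⟨U', Set.mem_iInter.1 hx U', hzU, hpz⟩
    filter_upwards [hnull V _ (.iInter fun U => (hSm _).compl) hcov] with x hx h
    have := hx h
    simp only [Set.mem_iInter, Set.mem_compl_iff, not_forall, not_not] at this
    obtain ⟨U, hU⟩ := this
    exact ⟨U.1, U.2.1, U.2.2, hU⟩
  have hsplit : ∀ᵐ x ∂μ, ∀ V : B, x ∈ S V → ∃ U U' : B, (U : Set Z) ⊆ V ∧ (U' : Set Z) ⊆ V ∧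
      Disjoint (U : Set Z) U' ∧ x ∈ S U ∧ x ∈ S U' := by
    rw [ae_all_iff]
    intro V
    let I := {U : B × B // (U.1 : Set Z) ⊆ V ∧ (U.2 : Set Z) ⊆ V ∧ Disjoint (U.1 : Set Z) U.2}
    let E : Set X := ⋂ U : I, (S U.1.1 ∩ S U.1.2)ᶜ
    have hE : MeasurableSet E := .iInter fun U => ((hSm _).inter (hSm _)).compl
    -- Over `E` no two disjoint basic subsets of `V` are both uncovered, so the pairs whose
    -- neighbourhoods are all uncovered form a graph. The remaining pairs lie in parts already
    -- covered.
    let T : Set (X × Z) := {w | w.1 ∈ E ∧ w.2 ∈ (V : Set Z)} ∩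
      ⋂ U : B, {w : X × Z | w.2 ∈ (U : Set Z) → w.1 ∈ S U}
    have hVm : ∀ U : B, MeasurableSet (U : Set Z) := fun U => (hB.isOpen U.2).measurableSet
    have hT : MeasurableSet T := by
      refine ((measurable_fst hE).inter (measurable_snd (hVm V))).inter (.iInter fun U => ?_)
      have : {w : X × Z | w.2 ∈ (U : Set Z) → w.1 ∈ S U} =
          (Prod.snd ⁻¹' (U : Set Z))ᶜ ∪ Prod.fst ⁻¹' (S U) := by
        ext w; simp [imp_iff_not_or]
      rw [this]
      exact (measurable_snd (hVm U)).compl.union (measurable_fst (hSm U))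
    have hinj : Set.InjOn Prod.fst T := by
      rintro ⟨x, z⟩ hz ⟨x', z'⟩ hz' (rfl : x = x')
      by_contra hne
      have hne' : z ≠ z' := fun h => hne (by rw [h])
      obtain ⟨O, O', hO, hO', hzO, hzO', hd⟩ := t2_separation hne'
      obtain ⟨U, hU, hzU, hUs⟩ := hB.mem_nhds_iff.1
        (inter_mem ((hB.isOpen V.2).mem_nhds hz.1.2) (hO.mem_nhds hzO))
      obtain ⟨U', hU', hzU', hUs'⟩ := hB.mem_nhds_iff.1
        (inter_mem ((hB.isOpen V.2).mem_nhds hz'.1.2) (hO'.mem_nhds hzO'))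
      have hE1 := Set.mem_iInter.1 hz.1.1 (⟨(⟨U, hU⟩, ⟨U', hU'⟩),
        fun a ha => (hUs ha).1, fun a ha => (hUs' ha).1,
        hd.mono (fun a ha => (hUs ha).2) fun a ha => (hUs' ha).2⟩ : I)
      exact hE1 ⟨Set.mem_iInter.1 hz.2 ⟨U, hU⟩ hzU, Set.mem_iInter.1 hz'.2 ⟨U', hU'⟩ hzU'⟩
    have hcov : AECovered μ (graphPart p V E) := by
      refine ((aecovered_of_injOn_fst hT hinj).union (AECovered.iUnion hSc)).mono ?_
      rintro ⟨x, z⟩ ⟨hx, hz, hpz⟩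
      by_cases h : ∀ U : B, z ∈ (U : Set Z) → x ∈ S U
      · exact Or.inl ⟨⟨hx, hz⟩, Set.mem_iInter.2 h⟩
      · push Not at h
        obtain ⟨U, hzU, hxU⟩ := h
        exact Or.inr (Set.mem_iUnion.2 ⟨U, hxU, hzU, hpz⟩)
    filter_upwards [hnull V E hE hcov] with x hx h
    have := hx h
    simp only [E, Set.mem_iInter, Set.mem_compl_iff, not_forall, not_not] at this
    obtain ⟨U, hU⟩ := this
    exact ⟨U.1.1, U.1.2, U.2.1, U.2.2.1, U.2.2.2, hU.1, hU.2⟩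
  have hS0 : ∀ᵐ x ∂μ, ∀ V : B, x ∉ S V := by
    filter_upwards [hmono, hclos, hrefine, hsplit] with x h1 h2 h3 h4 V hV
    let T : Set Z := {z | ∀ U : B, z ∈ (U : Set Z) → x ∈ S U}
    have hmeet : ∀ V : B, x ∈ S V → (T ∩ V).Nonempty := by
      intro V hV
      choose! nxt hn1 hn2 hn3 using h3
      -- Cantor's intersection argument: nested closures of shrinking diameter meet in a point of
      -- `T` inside `V`.
      let W : ℕ → B := fun n => Nat.rec (nxt 0 V) (fun n U => nxt (n + 1) U) n
      have hW : ∀ n, x ∈ S (W n) := fun n => by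
        induction n with
        | zero => exact hn3 0 V hV
        | succ n ih => exact hn3 (n + 1) _ ih
      have hd : ∀ n : ℕ, ∀ a ∈ (W n).1, ∀ b ∈ (W n).1, dist a b ≤ 1 / ((n : ℝ) + 1) := by
        intro n
        cases n with
        | zero => exact hn2 0 V hV
        | succ n => exact hn2 (n + 1) _ (hW n)
      have hcl : ∀ n : ℕ, closure (W (n + 1)).1 ⊆ (W n).1 := fun n => hn1 (n + 1) _ (hW n)
      have hanti : Antitone fun n : ℕ => (W n).1 :=
        antitone_nat_of_succ_le fun n => subset_closure.trans (hcl n)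
      have hne : ∀ n : ℕ, (W n).1.Nonempty := fun n => by
        have := h2 _ (hW n)
        by_contra h
        rw [Set.not_nonempty_iff_eq_empty] at h
        rw [h] at this
        simp at this
      choose z hz using hne
      have hcau : CauchySeq z := by
        refine cauchySeq_of_le_tendsto_0 (fun n : ℕ => 1 / ((n : ℝ) + 1)) (fun n m N hn hm => ?_)
          tendsto_one_div_add_atTop_nhds_zero_nat
        exact hd N _ (hanti hn (hz n)) _ (hanti hm (hz m))
      obtain ⟨a, ha⟩ := cauchySeq_tendsto_of_complete hcau
      have haW : ∀ n : ℕ, a ∈ (W n).1 := fun n => hcl n <|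
        mem_closure_of_tendsto ha (eventually_atTop.2 ⟨n + 1, fun m hm => hanti hm (hz m)⟩)
      refine ⟨a, fun U hU => ?_, ?_⟩
      · obtain ⟨ε, hε, hεU⟩ := Metric.isOpen_iff.1 (hB.isOpen U.2) a hU
        obtain ⟨n, hn⟩ := exists_nat_one_div_lt hε
        refine h1 (W n) U (fun b hb => hεU ?_) (hW n)
        exact Metric.mem_ball.2 ((hd n b hb a (haW n)).trans_lt hn)
      · exact hn1 0 V hV (subset_closure (haW 0))
    have hTp : T ⊆ p ⁻¹' {x} := by
      intro z hz
      by_contra hne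
      have hne' : p z ≠ x := hne
      obtain ⟨N, ⟨hN, hNcl⟩, hNs⟩ := (closed_nhds_basis (p z)).mem_iff.1
        (isOpen_compl_singleton.mem_nhds (by simpa using hne') : ({x}ᶜ : Set X) ∈ 𝓝 (p z))
      obtain ⟨U, hU, hzU, hUs⟩ := hB.mem_nhds_iff.1 (hp.continuousAt.preimage_mem_nhds hN)
      have := h2 ⟨U, hU⟩ (hz ⟨U, hU⟩ hzU)
      have h5 : closure (p '' U) ⊆ N := closure_minimal (Set.image_subset_iff.2 hUs) hNcl
      exact hNs (h5 this) rfl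
    have hTcl : IsClosed T := by
      rw [← isOpen_compl_iff, isOpen_iff_mem_nhds]
      intro z hz
      have : ∃ U : B, z ∈ (U : Set Z) ∧ x ∉ S U := by
        by_contra! h
        exact hz h
      obtain ⟨U, hzU, hxU⟩ := this
      filter_upwards [(hB.isOpen U.2).mem_nhds hzU] with y hy hyT using hxU (hyT U hy)
    have hperf : Perfect T := by
      refine ⟨hTcl, fun z hz => accPt_iff_nhds.2 fun N hN => ?_⟩
      obtain ⟨U, hU, hzU, hUs⟩ := hB.mem_nhds_iff.1 hN
      obtain ⟨U₁, U₂, hs1, hs2, hdisj, hx1, hx2⟩ := h4 ⟨U, hU⟩ (hz ⟨U, hU⟩ hzU)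
      obtain ⟨a, haT, ha⟩ := hmeet U₁ hx1
      obtain ⟨b, hbT, hb⟩ := hmeet U₂ hx2
      by_cases haz : a = z
      · refine ⟨b, ⟨hUs (hs2 hb), hbT⟩, fun hbz => ?_⟩
        exact Set.disjoint_left.1 hdisj ha (by rw [haz, ← hbz]; exact hb)
      · exact ⟨a, ⟨hUs (hs1 ha), haT⟩, haz⟩
    obtain ⟨f, hfT, -, hfi⟩ := hperf.exists_nat_bool_injection
      ((hmeet V hV).mono Set.inter_subset_left)
    have hc : (Set.range f).Countable := (hfib x).mono (hfT.trans hTp)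
    have : Countable (ℕ → Bool) := by
      have := hc.to_subtype
      exact (Set.rangeFactorization_injective.2 hfi).countable
    obtain ⟨e, he⟩ := exists_surjective_nat (ℕ → Bool)
    obtain ⟨n, hn⟩ := he fun n => !(e n n)
    have := congrFun hn n
    simp at this
  refine ((AECovered.iUnion hSc).union (W' := {w : X × Z | ∃ V : B, w.1 ∈ S V})
    (aecovered_of_ae_null (hS0.mono fun x hx z hz => ?_))).mono ?_
  · obtain ⟨V, hV⟩ := hz
    exact hx V hV
  · rintro ⟨x, z⟩ hz
    obtain ⟨U, hU, hzU, -⟩ := hB.mem_nhds_iff.1 (univ_mem : Set.univ ∈ 𝓝 z)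
    by_cases h : x ∈ S ⟨U, hU⟩
    · exact Or.inr ⟨_, h⟩
    · exact Or.inl (Set.mem_iUnion.2 ⟨⟨U, hU⟩, h, hzU, hz⟩)

/-- The fibres of a measurable map with countable fibres are, over almost every point, enumerated
by countably many measurable functions. -/
theorem ae_uniformization [StandardBorelSpace X] [StandardBorelSpace Z] (μ : Measure X)
    [IsFiniteMeasure μ] {p : Z → X} (hp : Measurable p) (hfib : ∀ x, (p ⁻¹' {x}).Countable) :
    AECovered μ {w : X × Z | p w.2 = w.1} := by
  let := upgradeStandardBorel X
  let uZ := upgradeStandardBorel Z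
  -- A finer Polish topology with the same Borel sets makes `p` continuous.
  obtain ⟨t', ht', hc, hpol⟩ := hp.exists_continuous
  have hb : @BorelSpace Z t' _ := by
    refine @BorelSpace.mk Z t' _ ?_
    rw [eq_borel_upgradeStandardBorel Z, @borel_eq_borel_of_le Z t' uZ.toTopologicalSpace hpol uZ.toPolishSpace ht']
  exact @ae_uniformization_of_continuous X Z _ _ t' hpol hb _ _ _ μ _ p hc hfib

end Uniformization

/-! ### Bounded distortion and involutions. -/

section Distortion

variable {X : Type*} [MeasurableSpace X]

/-- Taking preimages under `T` multiplies measures by at most `K`. -/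
def DistortionLE (μ : Measure X) (K : ℝ≥0∞) (T : X → X) : Prop :=
  ∀ E, MeasurableSet E → μ (T ⁻¹' E) ≤ K * μ E

theorem DistortionLE.comp {μ : Measure X} {K L : ℝ≥0∞} {S T : X → X} (hS : DistortionLE μ K S)
    (hT : DistortionLE μ L T) (hSm : Measurable S) : DistortionLE μ (L * K) (S ∘ T) := by
  intro E hE
  calc μ (T ⁻¹' (S ⁻¹' E)) ≤ L * μ (S ⁻¹' E) := hT _ (hSm hE)
    _ ≤ L * (K * μ E) := by gcongr; exact hS E hE
    _ = L * K * μ E := by rw [mul_assoc]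

theorem isNonsingularAut_of_distortionLE {μ : Measure X} {K L : ℝ≥0∞} {θ : X ≃ᵐ X}
    (h : DistortionLE μ K θ) (h' : DistortionLE μ L θ.symm) : IsNonsingularAut μ θ := by
  refine ⟨⟨θ.measurable, ?_⟩, ⟨θ.symm.measurable, ?_⟩⟩
  · refine Measure.AbsolutelyContinuous.mk fun E hE h0 => ?_
    rw [θ.map_apply]
    simpa [h0] using h E hE
  · refine Measure.AbsolutelyContinuous.mk fun E hE h0 => ?_
    rw [θ.symm.map_apply]
    simpa [h0] using h' E hE

/-- The bound for the inverse keeps the density of `μ ∘ θ` below `L`; the bound for `θ` keeps it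
above `1/K`. -/
theorem isBoundedAut_of_distortionLE {μ : Measure X} [IsFiniteMeasure μ] {K L : ℝ≥0∞}
    {θ : X ≃ᵐ X} (hK : K ≠ ∞) (hL : L ≠ ∞) (h : DistortionLE μ K θ)
    (h' : DistortionLE μ L θ.symm) : IsBoundedAut μ θ := by
  refine ⟨isNonsingularAut_of_distortionLE h h', ?_⟩
  rw [← θ.map_symm]
  set ρ := μ.map θ.symm with hρ
  have hρE : ∀ E, ρ E = μ (θ.symm ⁻¹' E) := fun E => θ.symm.map_apply E
  have hac : ρ ≪ μ := (isNonsingularAut_of_distortionLE h h').2.absolutelyContinuous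
  have hE : ∀ E, MeasurableSet E → ∫⁻ x in E, ρ.rnDeriv μ x ∂μ = ρ E := fun E _ =>
    Measure.setLIntegral_rnDeriv hac E
  have hup : ∀ᵐ x ∂μ, ρ.rnDeriv μ x ≤ L := by
    refine ae_le_of_forall_setLIntegral_le_of_sigmaFinite (Measure.measurable_rnDeriv _ _)
      fun E hEm _ => ?_
    rw [hE E hEm, hρE, setLIntegral_const]
    exact h' E hEm
  have hlow : ∀ᵐ x ∂μ, 1 ≤ K * ρ.rnDeriv μ x := by
    refine ae_le_of_forall_setLIntegral_le_of_sigmaFinite measurable_const fun E hEm _ => ?_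
    rw [lintegral_const_mul _ (Measure.measurable_rnDeriv _ _), hE E hEm, hρE, setLIntegral_const,
      one_mul]
    have := h _ (θ.symm.measurable hEm)
    rwa [← Set.preimage_comp, MeasurableEquiv.symm_comp_self, Set.preimage_id] at this
  refine ⟨max (Real.log L.toReal) (Real.log K.toReal), ?_⟩
  filter_upwards [hup, hlow] with x h1 h2
  have hfin : ρ.rnDeriv μ x ≠ ∞ := ne_top_of_le_ne_top hL h1
  have h2' : 1 ≤ K.toReal * (ρ.rnDeriv μ x).toReal := by
    have := ENNReal.toReal_mono (ENNReal.mul_ne_top hK hfin) h2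
    simpa using this
  have h1' : (ρ.rnDeriv μ x).toReal ≤ L.toReal := ENNReal.toReal_mono hL h1
  have hpos : 0 < (ρ.rnDeriv μ x).toReal := by
    rcases (ENNReal.toReal_nonneg (a := ρ.rnDeriv μ x)).eq_or_lt with h0 | h0
    · rw [← h0] at h2'; norm_num at h2'
    · exact h0
  have hKpos : 0 < K.toReal := by
    by_contra hc
    have : K.toReal = 0 := le_antisymm (not_lt.1 hc) ENNReal.toReal_nonneg
    rw [this] at h2'; norm_num at h2'
  rw [abs_le]
  constructor
  · have h3 : 0 ≤ Real.log (K.toReal * (ρ.rnDeriv μ x).toReal) := Real.log_nonneg h2'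
    rw [Real.log_mul hKpos.ne' hpos.ne'] at h3
    have := le_max_right (Real.log L.toReal) (Real.log K.toReal)
    linarith
  · exact (Real.log_le_log hpos h1').trans (le_max_left _ _)

theorem measurableEq_of_standardBorel [StandardBorelSpace X] : MeasurableEq X := by
  let := upgradeStandardBorel X
  exact ⟨isClosed_diagonal.measurableSet⟩

/-- A partial injection whose domain and image are disjoint extends to an involution. -/
theorem exists_involution [StandardBorelSpace X] {f : X → X} (hf : Measurable f) {A : Set X}
    (hA : MeasurableSet A) (hinj : Set.InjOn f A) (hdisj : ∀ x ∈ A, f x ∉ A) :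
    ∃ θ : X ≃ᵐ X, (∀ x, θ (θ x) = x) ∧ (∀ x ∈ A, θ x = f x) ∧
      ∀ x, θ x = x ∨ (x ∈ A ∧ θ x = f x) ∨ (θ x ∈ A ∧ f (θ x) = x) := by
  classical
  rcases isEmpty_or_nonempty X with hX | hX
  · exact ⟨MeasurableEquiv.refl X, fun x => rfl, fun x => isEmptyElim x, fun x => Or.inl rfl⟩
  have himg : ∀ Q, MeasurableSet Q → MeasurableSet (f '' (A ∩ Q)) := fun Q hQ =>
    (hA.inter hQ).image_of_measurable_injOn hf (hinj.mono Set.inter_subset_left)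
  let g : X → X := Function.invFunOn f A
  have hg : ∀ x ∈ A, g (f x) = x := fun x hx => hinj.leftInvOn_invFunOn hx
  let t : X → X := fun x => if x ∈ A then f x else if x ∈ f '' A then g x else x
  have t1 : ∀ x ∈ A, t x = f x := fun x hx => if_pos hx
  have t2 : ∀ x ∈ A, t (f x) = x := fun x hx => by
    simp only [t, if_neg (hdisj x hx), if_pos (Set.mem_image_of_mem f hx), hg x hx]
  have t3 : ∀ x, x ∉ A → x ∉ f '' A → t x = x := fun x h1 h2 => by
    simp only [t, if_neg h1, if_neg h2]
  have hinv : Function.Involutive t := by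
    intro x
    by_cases h1 : x ∈ A
    · rw [t1 x h1, t2 x h1]
    · by_cases h2 : x ∈ f '' A
      · obtain ⟨y, hy, rfl⟩ := h2
        rw [t2 y hy, t1 y hy]
      · rw [t3 x h1 h2, t3 x h1 h2]
  have hmeas : Measurable t := by
    intro Q hQ
    have : t ⁻¹' Q = (A ∩ f ⁻¹' Q) ∪ f '' (A ∩ Q) ∪ ((A ∪ f '' A)ᶜ ∩ Q) := by
      ext x
      by_cases h1 : x ∈ A
      · have h3 : x ∉ f '' (A ∩ Q) := by
          rintro ⟨y, hy, rfl⟩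
          exact hdisj y hy.1 h1
        simp [t1 x h1, h1, h3]
      · by_cases h2 : x ∈ f '' A
        · obtain ⟨y, hy, rfl⟩ := h2
          have h4 : f y ∈ f '' (A ∩ Q) ↔ y ∈ Q := by
            constructor
            · rintro ⟨z, hz, hzy⟩
              rw [← hinj hz.1 hy hzy]; exact hz.2
            · exact fun h => ⟨y, ⟨hy, h⟩, rfl⟩
          have h5 : f y ∈ f '' A := ⟨y, hy, rfl⟩
          rw [Set.mem_preimage, t2 y hy, Set.mem_union, Set.mem_union, h4]
          simp [h1, h5]
        · have h6 : x ∉ f '' (A ∩ Q) := fun h => h2 (Set.image_mono Set.inter_subset_left h)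
          rw [Set.mem_preimage, t3 x h1 h2, Set.mem_union, Set.mem_union]
          simp only [h1, h6, Set.mem_inter_iff, false_and, or_self, false_or, Set.mem_compl_iff,
            Set.mem_union, h2, not_false_eq_true, true_and]
    rw [this]
    have hfA : MeasurableSet (f '' A) := by simpa using himg Set.univ .univ
    exact ((hA.inter (hf hQ)).union (himg Q hQ)).union ((hA.union hfA).compl.inter hQ)
  refine ⟨MeasurableEquiv.ofInvolutive t hinv hmeas, hinv, t1, fun x => ?_⟩
  change t x = x ∨ (x ∈ A ∧ t x = f x) ∨ (t x ∈ A ∧ f (t x) = x)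
  by_cases h1 : x ∈ A
  · exact Or.inr (Or.inl ⟨h1, t1 x h1⟩)
  · by_cases h2 : x ∈ f '' A
    · obtain ⟨y, hy, rfl⟩ := h2
      rw [t2 y hy]
      exact Or.inr (Or.inr ⟨hy, rfl⟩)
    · exact Or.inl (t3 x h1 h2)

/-- A nonsingular involution agrees, on larger and larger sets, with involutions of bounded
distortion. -/
theorem exists_bounded_involutions {μ : Measure X} [IsFiniteMeasure μ] {θ : X ≃ᵐ X}
    (hθ : ∀ x, θ (θ x) = x) (hns : Measure.QuasiMeasurePreserving θ μ μ) :
    ∃ τ : ℕ → X ≃ᵐ X, (∀ k x, τ k (τ k x) = x) ∧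
      (∀ k, ∃ K : ℝ≥0∞, K ≠ ∞ ∧ DistortionLE μ K (τ k)) ∧
      (∀ k x, τ k x = x ∨ τ k x = θ x) ∧ ∀ᵐ x ∂μ, ∃ k, τ k x = θ x := by
  classical
  let D := (μ.map θ).rnDeriv μ
  have hD : Measurable D := Measure.measurable_rnDeriv _ _
  -- Bounding the density at both `x` and `θ x` makes `Q k` invariant under `θ`, so replacing `θ` by
  -- the identity outside it leaves an involution.
  let Q : ℕ → Set X := fun k => {x | D x ≤ k ∧ D (θ x) ≤ k}
  have hQ : ∀ k, MeasurableSet (Q k) := fun k =>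
    (measurableSet_le hD measurable_const).inter
      (measurableSet_le (hD.comp θ.measurable) measurable_const)
  have hQθ : ∀ k x, x ∈ Q k → θ x ∈ Q k := fun k x hx => ⟨hx.2, by
    rw [hθ]; exact hx.1⟩
  have hQθ' : ∀ k x, x ∉ Q k → θ x ∉ Q k := fun k x hx h => hx (by
    have := hQθ k _ h
    rwa [hθ] at this)
  let t : ℕ → X → X := fun k => (Q k).piecewise θ id
  have ht1 : ∀ k x, x ∈ Q k → t k x = θ x := fun k x hx => Set.piecewise_eq_of_mem _ _ _ hx
  have ht2 : ∀ k x, x ∉ Q k → t k x = x := fun k x hx => Set.piecewise_eq_of_notMem _ _ _ hx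
  have hinv : ∀ k, Function.Involutive (t k) := fun k x => by
    by_cases h : x ∈ Q k
    · rw [ht1 k x h, ht1 k _ (hQθ k x h), hθ]
    · rw [ht2 k x h, ht2 k x h]
  have hm : ∀ k, Measurable (t k) := fun k => θ.measurable.piecewise (hQ k) measurable_id
  refine ⟨fun k => MeasurableEquiv.ofInvolutive (t k) (hinv k) (hm k), hinv, fun k => ?_,
    fun k x => ?_, ?_⟩
  -- `k` accounts for the part where `θ` acts and `1` for the part left fixed.
  · refine ⟨(k : ℝ≥0∞) + 1, by finiteness, fun E hE => ?_⟩
    change μ (t k ⁻¹' E) ≤ _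
    have hsub : t k ⁻¹' E ⊆ θ ⁻¹' (E ∩ Q k) ∪ (E \ Q k) := by
      intro x hx
      by_cases h : x ∈ Q k
      · refine Or.inl ⟨?_, hQθ k x h⟩
        have : t k x ∈ E := hx
        rwa [ht1 k x h] at this
      · refine Or.inr ⟨?_, h⟩
        have : t k x ∈ E := hx
        rwa [ht2 k x h] at this
    calc μ (t k ⁻¹' E) ≤ μ (θ ⁻¹' (E ∩ Q k)) + μ (E \ Q k) :=
          (measure_mono hsub).trans (measure_union_le _ _)
      _ ≤ k * μ E + 1 * μ E := by
          gcongr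
          · rw [← θ.map_apply, ← Measure.setLIntegral_rnDeriv hns.absolutelyContinuous]
            calc ∫⁻ x in E ∩ Q k, D x ∂μ ≤ ∫⁻ x in E ∩ Q k, (k : ℝ≥0∞) ∂μ :=
                  setLIntegral_mono measurable_const fun x hx => hx.2.1
              _ = k * μ (E ∩ Q k) := setLIntegral_const _ _
              _ ≤ k * μ E := by gcongr; exact Set.inter_subset_left
          · rw [one_mul]; exact measure_mono Set.sdiff_subset
      _ = _ := by rw [add_mul]
  · by_cases h : x ∈ Q k
    · exact Or.inr (ht1 k x h)
    · exact Or.inl (ht2 k x h)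
  · have h1 : ∀ᵐ x ∂μ, D x < ∞ := Measure.rnDeriv_lt_top _ _
    filter_upwards [h1, hns.ae h1] with x h1 h2
    obtain ⟨k, hk⟩ := ENNReal.exists_nat_gt h1.ne
    obtain ⟨l, hl⟩ := ENNReal.exists_nat_gt h2.ne
    refine ⟨max k l, ht1 _ x ⟨hk.le.trans ?_, hl.le.trans ?_⟩⟩
    · exact_mod_cast le_max_left k l
    · exact_mod_cast le_max_right k l

end Distortion

/-! ### A Feldman–Moore theorem with bounded generators. -/

section FeldmanMoore

variable {X : Type*} [MeasurableSpace X]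

/-- An action with bounded distortion whose orbits are almost all the classes of `R`. -/
structure IsGeneratingAction (R : Setoid X) (μ : Measure X) (G : Type*) [Group G]
    [MulAction G X] : Prop where
  rel : ∀ (g : G) (x : X), R x (g • x)
  bounded : ∀ g : G, ∃ K : ℝ≥0∞, K ≠ ∞ ∧ DistortionLE μ K (g • · : X → X)
  exhausts : ∀ᵐ x ∂μ, ∀ y, R x y → ∃ g : G, g • x = y

theorem IsCountableNonsingular.ae_forall_rel {R : Setoid X} {μ : Measure X}
    (hR : IsCountableNonsingular R μ) {P : X → Prop} (h : ∀ᵐ x ∂μ, P x) :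
    ∀ᵐ x ∂μ, ∀ y, R x y → P y := by
  have h0 := hR.nonsingular {x | ¬ P x} h
  refine measure_mono_null ?_ h0
  intro x hx
  have hx' : ¬ ∀ y, R x y → P y := hx
  push Not at hx'
  obtain ⟨y, hxy, hy⟩ := hx'
  exact ⟨y, hy, R.symm hxy⟩

theorem IsCountableNonsingular.quasiMeasurePreserving {R : Setoid X} {μ : Measure X}
    (hR : IsCountableNonsingular R μ) {T : X → X} (hT : Measurable T) (hRT : ∀ x, R x (T x)) :
    Measure.QuasiMeasurePreserving T μ μ := by
  refine ⟨hT, Measure.AbsolutelyContinuous.mk fun E hE h0 => ?_⟩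
  rw [Measure.map_apply hT hE]
  refine measure_mono_null ?_ (hR.nonsingular E h0)
  intro x hx
  exact ⟨T x, hx, R.symm (hRT x)⟩

/-- A countable nonsingular equivalence relation is generated, up to a null set, by countably many
involutions of bounded distortion. -/
theorem exists_generating_involutions [StandardBorelSpace X] {R : Setoid X} {μ : Measure X}
    [IsFiniteMeasure μ] (hR : IsCountableNonsingular R μ) :
    ∃ (ι : Type) (_ : Countable ι) (θ : ι → X ≃ᵐ X), (∀ i x, θ i (θ i x) = x) ∧
      (∀ i x, R x (θ i x)) ∧ (∀ i, ∃ K : ℝ≥0∞, K ≠ ∞ ∧ DistortionLE μ K (θ i)) ∧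
      ∀ᵐ x ∂μ, ∀ y, R x y → y = x ∨ ∃ i, θ i x = y := by
  have : MeasurableEq X := measurableEq_of_standardBorel
  let Z := {w : X × X // R w.1 w.2}
  have : StandardBorelSpace Z := hR.measurableSet.standardBorel
  have hfib : ∀ x, ((fun z : Z => z.1.1) ⁻¹' {x}).Countable := by
    intro x
    refine Set.Countable.mono (s₂ := {z : Z | z.1 ∈ (fun y => (x, y)) '' {y | R x y}}) ?_ ?_
    · rintro ⟨⟨a, b⟩, h⟩ (rfl : a = x)
      exact ⟨b, h, rfl⟩
    · exact ((hR.countable_class x).image _).preimage Subtype.val_injective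
  obtain ⟨F, hFc, hFm, hF⟩ := ae_uniformization μ
    (measurable_fst.comp measurable_subtype_coe : Measurable fun z : Z => z.1.1) hfib
  have hcover : ∃ f : ℕ → X → X, (∀ n, Measurable (f n)) ∧
      ∀ᵐ x ∂μ, ∀ y, R x y → ∃ n, f n x = y := by
    rcases F.eq_empty_or_nonempty with rfl | hne
    · refine ⟨fun _ => id, fun _ => measurable_id, hF.mono fun x hx y hxy => ?_⟩
      obtain ⟨f, hf, -⟩ := hx ⟨(x, y), hxy⟩ rfl
      exact absurd hf (Set.notMem_empty f)
    · obtain ⟨e, he⟩ := hFc.exists_eq_range hne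
      refine ⟨fun n x => (e n x).1.2, fun n => ?_, hF.mono fun x hx y hxy => ?_⟩
      · exact (measurable_snd.comp measurable_subtype_coe).comp
          (hFm (e n) (he ▸ Set.mem_range_self n))
      · obtain ⟨f, hf, hfx⟩ := hx ⟨(x, y), hxy⟩ rfl
        rw [he] at hf
        obtain ⟨n, rfl⟩ := hf
        exact ⟨n, congrArg (fun z : Z => z.1.2) hfx⟩
  obtain ⟨f, hfm, hf⟩ := hcover
  obtain ⟨S, hSm, hS⟩ := exists_seq_separating X (p := MeasurableSet) MeasurableSet.empty Set.univ
  -- On such a set `f n` has the left inverse `f m`, hence is injective, and the separating set `S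
  -- k` makes its image disjoint from its domain: the situation of `exists_involution`.
  let A : ℕ × ℕ × ℕ → Set X := fun i =>
    {x | R x (f i.1 x) ∧ f i.2.1 (f i.1 x) = x ∧ x ∈ S i.2.2 ∧ f i.1 x ∉ S i.2.2}
  have hA : ∀ i, MeasurableSet (A i) := fun i =>
    ((measurable_id.prodMk (hfm i.1)) hR.measurableSet).inter
      ((measurableSet_eq_fun ((hfm i.2.1).comp (hfm i.1)) measurable_id).inter
        ((hSm i.2.2).inter ((hfm i.1) (hSm i.2.2).compl)))
  have hinj : ∀ i, Set.InjOn (f i.1) (A i) := fun i x hx y hy hxy => by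
    rw [← hx.2.1, ← hy.2.1, hxy]
  choose θ hθ1 hθ2 hθ3 using fun i => exists_involution (hfm i.1) (hA i) (hinj i)
    fun x hx h => hx.2.2.2 h.2.2.1
  have hRθ : ∀ i x, R x (θ i x) := by
    intro i x
    rcases hθ3 i x with h | ⟨hx, h⟩ | ⟨hx, h⟩
    · rw [h]
    · rw [h]; exact hx.1
    · have := hx.1
      rw [h] at this
      exact R.symm this
  choose τ hτ1 hτ2 hτ3 hτ4 using fun i => exists_bounded_involutions (hθ1 i)
    (hR.quasiMeasurePreserving (θ i).measurable (hRθ i))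
  refine ⟨(ℕ × ℕ × ℕ) × ℕ, inferInstance, fun i => τ i.1 i.2, fun i => hτ1 i.1 i.2,
    fun i x => ?_, fun i => hτ2 i.1 i.2, ?_⟩
  · rcases hτ3 i.1 i.2 x with h | h
    · rw [h]
    · rw [h]; exact hRθ i.1 x
  · filter_upwards [hf, hR.ae_forall_rel hf, ae_all_iff.2 hτ4] with x h1 h2 h3 y hxy
    by_cases hne : y = x
    · exact Or.inl hne
    refine Or.inr ?_
    suffices h : ∃ i, θ i x = y by
      obtain ⟨i, hi⟩ := h
      obtain ⟨k, hk⟩ := h3 i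
      exact ⟨(i, k), hk.trans hi⟩
    obtain ⟨n, hn⟩ := h1 y hxy
    obtain ⟨m, hm⟩ := h2 y hxy x (R.symm hxy)
    have : ∃ k, ¬ (x ∈ S k ↔ y ∈ S k) := by
      by_contra! h
      exact hne (hS x trivial y trivial h).symm
    obtain ⟨k, hk⟩ := this
    by_cases hx : x ∈ S k
    · have hy : y ∉ S k := fun hy => hk ⟨fun _ => hy, fun _ => hx⟩
      refine ⟨(n, m, k), ?_⟩
      rw [hθ2 (n, m, k) x ⟨by rw [hn]; exact hxy, by rw [hn, hm], hx, by rwa [hn]⟩, hn]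
    · have hy : y ∈ S k := by
        by_contra hy
        exact hk ⟨fun h => absurd h hx, fun h => absurd h hy⟩
      refine ⟨(m, n, k), ?_⟩
      have := hθ2 (m, n, k) y
        ⟨by rw [hm]; exact R.symm hxy, by rw [hm, hn], hy, by rwa [hm]⟩
      rw [← hm, ← this, hθ1]

/-- A countable nonsingular equivalence relation is, up to a null set, the orbit relation of an
action of a countable group by automorphisms of bounded distortion. -/
theorem exists_generating_action [StandardBorelSpace X] {R : Setoid X} {μ : Measure X}
    [IsFiniteMeasure μ] (hR : IsCountableNonsingular R μ) :
    ∃ (G : Type) (_ : Group G) (_ : Countable G) (_ : MulAction G X)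
      (_ : MeasurableConstSMul G X), IsGeneratingAction R μ G := by
  obtain ⟨ι, hι, θ, h1, h2, h3, h4⟩ := exists_generating_involutions hR
  let φ : FreeGroup ι →* Equiv.Perm X := FreeGroup.lift fun i => (θ i).toEquiv
  let act : MulAction (FreeGroup ι) X := MulAction.compHom X φ
  have hsm : ∀ (g : FreeGroup ι) (x : X), g • x = φ g x := fun g x => rfl
  have hof : ∀ (i : ι) (x : X), (FreeGroup.of i : FreeGroup ι) • x = θ i x := fun i x => by
    rw [hsm]; simp [φ]
  have hofi : ∀ (i : ι) (x : X), (FreeGroup.of i : FreeGroup ι)⁻¹ • x = θ i x := fun i x => by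
    rw [inv_smul_eq_iff, hof, h1]
  have key : ∀ g : FreeGroup ι, Measurable (g • · : X → X) ∧ (∀ x : X, R x (g • x)) ∧
      ∃ K : ℝ≥0∞, K ≠ ∞ ∧ DistortionLE μ K (g • · : X → X) := by
    intro g
    induction g using FreeGroup.induction_on with
    | C1 =>
      refine ⟨by simpa using measurable_id', fun x => by rw [one_smul], 1, by simp,
        fun E _ => ?_⟩
      simp
    | of i =>
      refine ⟨by simpa only [hof] using (θ i).measurable, fun x => by rw [hof]; exact h2 i x, ?_⟩
      simpa only [hof] using h3 i
    | inv_of i _ =>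
      refine ⟨by simpa only [hofi] using (θ i).measurable,
        fun x => by rw [hofi]; exact h2 i x, ?_⟩
      simpa only [hofi] using h3 i
    | mul g h hg hh =>
      obtain ⟨g1, g2, K, hK, g3⟩ := hg
      obtain ⟨k1, k2, L, hL, k3⟩ := hh
      refine ⟨by simpa only [mul_smul, Function.comp_def] using g1.comp k1, fun x => ?_, L * K,
        ENNReal.mul_ne_top hL hK, ?_⟩
      · rw [mul_smul]; exact R.trans (k2 x) (g2 _)
      · have := g3.comp k3 g1
        simpa only [mul_smul, Function.comp_def] using this
  refine ⟨FreeGroup ι, inferInstance, inferInstance, act, ⟨fun g => (key g).1⟩,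
    fun g => (key g).2.1, fun g => (key g).2.2, ?_⟩
  filter_upwards [h4] with x hx y hxy
  rcases hx y hxy with rfl | ⟨i, hi⟩
  · exact ⟨1, one_smul _ _⟩
  · exact ⟨FreeGroup.of i, by rw [hof, hi]⟩

end FeldmanMoore

/-! ### Displacement of a set. -/

section Moved

variable {X : Type*}

/-- The points that `T` moves into or out of `B`. -/
def moved (T : X → X) (B : Set X) : Set X := {x | ¬ (T x ∈ B ↔ x ∈ B)}

theorem moved_eq_symmDiff (T : X → X) (B : Set X) : moved T B = (T ⁻¹' B) ∆ B := by
  ext x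
  simp only [moved, Set.mem_ofPred_eq, Set.mem_symmDiff, Set.mem_preimage]
  tauto

theorem measurableSet_moved [MeasurableSpace X] {T : X → X} (hT : Measurable T) {B : Set X} (hB : MeasurableSet B) :
    MeasurableSet (moved T B) := by
  rw [moved_eq_symmDiff]
  exact (hT hB).symmDiff hB

end Moved

/-! ### The Radon–Nikodym cocycle. -/

section Cocycle

variable {X : Type*} [MeasurableSpace X] {G : Type*} [Group G] [MulAction G X]

/-- `c` is a measurable cocycle that represents the logarithm of the Radon–Nikodym derivatives of
the action. -/
structure IsLogDeriv (μ : Measure X) (c : G → X → ℝ) : Prop where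
  measurable : ∀ g, Measurable (c g)
  mul : ∀ g h x, c (h * g) x = c h (g • x) + c g x
  lintegral : ∀ (g : G) (f : X → ℝ≥0∞), Measurable f →
    ∫⁻ x, f (g • x) * ENNReal.ofReal (Real.exp (c g x)) ∂μ = ∫⁻ x, f x ∂μ

namespace IsLogDeriv

variable {μ : Measure X} {c : G → X → ℝ}

theorem one (hc : IsLogDeriv μ c) (x : X) : c 1 x = 0 := by
  have := hc.mul 1 1 x
  rw [one_smul, mul_one] at this
  linarith

theorem inv (hc : IsLogDeriv μ c) (g : G) (x : X) : c g⁻¹ (g • x) = - c g x := by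
  have := hc.mul g g⁻¹ x
  rw [inv_mul_cancel, hc.one] at this
  linarith

/-- The position of `h • x` seen from `g • x`. -/
theorem mul_inv (hc : IsLogDeriv μ c) (g h : G) (x : X) :
    c (h * g⁻¹) (g • x) = c h x - c g x := by
  have := hc.mul g (h * g⁻¹) x
  rw [inv_mul_cancel_right] at this
  linarith

theorem measure_preimage_inv_le [MeasurableConstSMul G X] (hc : IsLogDeriv μ c) {g : G} {E : Set X}
    (hE : MeasurableSet E) {K : ℝ} (hK : ∀ x ∈ E, c g x ≤ K) :
    μ ((g⁻¹ • · : X → X) ⁻¹' E) ≤ ENNReal.ofReal (Real.exp K) * μ E := by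
  have hE' : MeasurableSet ((g⁻¹ • · : X → X) ⁻¹' E) := measurable_const_smul g⁻¹ hE
  have h := hc.lintegral g (((g⁻¹ • · : X → X) ⁻¹' E).indicator 1) (measurable_one.indicator hE')
  rw [lintegral_indicator_one hE'] at h
  rw [← h, ← setLIntegral_const, ← lintegral_indicator hE]
  refine lintegral_mono fun x => ?_
  by_cases hx : x ∈ E
  · have : g • x ∈ (g⁻¹ • · : X → X) ⁻¹' E := by simpa using hx
    rw [Set.indicator_of_mem this, Set.indicator_of_mem hx, Pi.one_apply, one_mul]
    exact ENNReal.ofReal_le_ofReal (Real.exp_le_exp.2 (hK x hx))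
  · have : g • x ∉ (g⁻¹ • · : X → X) ⁻¹' E := by simpa using hx
    rw [Set.indicator_of_notMem this, zero_mul]
    exact zero_le

theorem measure_preimage_le [MeasurableConstSMul G X] (hc : IsLogDeriv μ c) {g : G} {E : Set X}
    (hE : MeasurableSet E) {K : ℝ} (hK : ∀ x, g • x ∈ E → - c g x ≤ K) :
    μ ((g • · : X → X) ⁻¹' E) ≤ ENNReal.ofReal (Real.exp K) * μ E := by
  have := hc.measure_preimage_inv_le (g := g⁻¹) hE (K := K) fun x hx => by
    have h1 := hc.inv g (g⁻¹ • x)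
    rw [smul_inv_smul] at h1
    rw [h1]
    exact hK _ (by rwa [smul_inv_smul])
  rwa [inv_inv] at this

end IsLogDeriv

/-- The Radon–Nikodym cocycle of a nonsingular action of a countable group. -/
theorem exists_isLogDeriv [Countable G] [MeasurableConstSMul G X] (μ : Measure X)
    [IsFiniteMeasure μ] (hns : ∀ g : G, Measure.QuasiMeasurePreserving (g • · : X → X) μ μ) :
    ∃ c : G → X → ℝ, IsLogDeriv μ c := by
  classical
  let ρ : G → Measure X := fun g => μ.map (g⁻¹ • · : X → X)
  have hsm : ∀ g : G, Measurable (g • · : X → X) := fun g => measurable_const_smul g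
  have hρ : ∀ g, ρ g ≪ μ := fun g => (hns g⁻¹).absolutelyContinuous
  have hρ' : ∀ g, μ ≪ ρ g := fun g => by
    refine Measure.AbsolutelyContinuous.mk fun E hE h0 => ?_
    rw [Measure.map_apply (hsm _) hE] at h0
    have := (hns g).preimage_null h0
    rwa [← Set.preimage_comp, show ((g⁻¹ • · : X → X) ∘ (g • · : X → X)) = id by
      ext x; simp, Set.preimage_id] at this
  let D : G → X → ℝ≥0∞ := fun g => (ρ g).rnDeriv μ
  have hD : ∀ g, Measurable (D g) := fun g => Measure.measurable_rnDeriv _ _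
  have hDtop : ∀ g, ∀ᵐ x ∂μ, D g x < ∞ := fun g => Measure.rnDeriv_lt_top _ _
  have hDpos : ∀ g, ∀ᵐ x ∂μ, 0 < D g x := fun g => (hρ' g).ae_le (Measure.rnDeriv_pos (hρ g))
  have hint : ∀ (g : G) (f : X → ℝ≥0∞), Measurable f →
      ∫⁻ x, f (g • x) * D g x ∂μ = ∫⁻ x, f x ∂μ := by
    intro g f hf
    have h1 := lintegral_rnDeriv_mul (hρ g) (hf.comp (hsm g)).aemeasurable
    calc ∫⁻ x, f (g • x) * D g x ∂μ = ∫⁻ x, D g x * (f ∘ (g • · : X → X)) x ∂μ := by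
          simp only [mul_comm, Function.comp]
      _ = ∫⁻ x, (f ∘ (g • · : X → X)) x ∂(ρ g) := h1
      _ = ∫⁻ x, f x ∂μ := by
          rw [lintegral_map (hf.comp (hsm g)) (hsm _)]
          simp
  have hmul : ∀ g h, ∀ᵐ x ∂μ, D (h * g) x = D h (g • x) * D g x := by
    intro g h
    refine ae_eq_of_forall_setLIntegral_eq_of_sigmaFinite (hD _)
      (((hD h).comp (hsm g)).mul (hD g)) fun E hE _ => ?_
    have e1 : ∫⁻ x in E, D (h * g) x ∂μ =
        ∫⁻ x, E.indicator 1 (((h * g)⁻¹ • x : X)) ∂μ := by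
      rw [← hint (h * g) (fun x => E.indicator 1 ((h * g)⁻¹ • x))
        ((measurable_one.indicator hE).comp (hsm _)), ← lintegral_indicator hE]
      congr 1; ext x
      rw [inv_smul_smul]
      by_cases hx : x ∈ E <;> simp [hx]
    have e2 : ∫⁻ x in E, D h (g • x) * D g x ∂μ =
        ∫⁻ x, E.indicator 1 (g⁻¹ • x : X) * D h x ∂μ := by
      rw [← hint g (fun x => E.indicator 1 (g⁻¹ • x : X) * D h x)
        (((measurable_one.indicator hE).comp (hsm _)).mul (hD h)), ← lintegral_indicator hE]
      congr 1; ext x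
      rw [inv_smul_smul]
      by_cases hx : x ∈ E <;> simp [hx]
    have e3 : ∫⁻ x, E.indicator 1 (g⁻¹ • x : X) * D h x ∂μ =
        ∫⁻ x, E.indicator 1 (((h * g)⁻¹ • x : X)) ∂μ := by
      rw [← hint h (fun x => E.indicator 1 ((h * g)⁻¹ • x))
        ((measurable_one.indicator hE).comp (hsm _))]
      congr 1; ext x
      rw [mul_inv_rev, mul_smul, inv_smul_smul]
    rw [e1, e2, e3]
  let l : G → X → ℝ := fun g x => Real.log (D g x).toReal
  have hl : ∀ g, Measurable (l g) := fun g => Real.measurable_log.comp (hD g).ennreal_toReal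
  have hlexp : ∀ g, ∀ᵐ x ∂μ, ENNReal.ofReal (Real.exp (l g x)) = D g x := fun g => by
    filter_upwards [hDtop g, hDpos g] with x h1 h2
    rw [Real.exp_log (ENNReal.toReal_pos h2.ne' h1.ne), ENNReal.ofReal_toReal h1.ne]
  -- Countably many almost sure identities hold together on a conull set, which the identities
  -- themselves show to be invariant. Setting the cocycle to zero elsewhere makes it a strict
  -- cocycle everywhere.
  let X₀ : Set X := {x | ∀ g h, l (h * g) x = l h (g • x) + l g x}
  have hX₀m : MeasurableSet X₀ := by
    simp only [X₀, Set.ofPred_forall]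
    exact .iInter fun g => .iInter fun h =>
      measurableSet_eq_fun (hl _) (((hl h).comp (hsm g)).add (hl g))
  have hX₀ : ∀ᵐ x ∂μ, x ∈ X₀ := by
    simp only [X₀, Set.mem_ofPred_eq, ae_all_iff]
    intro g h
    filter_upwards [hmul g h, hDtop g, hDpos g, (hns g).ae (hDtop h), (hns g).ae (hDpos h)] with
      x h1 h2 h3 h4 h5
    simp only [l, h1, ENNReal.toReal_mul]
    exact Real.log_mul (ENNReal.toReal_pos h5.ne' h4.ne).ne' (ENNReal.toReal_pos h3.ne' h2.ne).ne'
  have hinv : ∀ (k : G) x, x ∈ X₀ → k • x ∈ X₀ := by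
    intro k x hx g h
    have h1 := hx k (h * g)
    have h2 := hx (g * k) h
    have h3 := hx k g
    rw [mul_assoc] at h1
    rw [mul_smul] at h2
    linarith
  have hinv' : ∀ (k : G) x, x ∉ X₀ → k • x ∉ X₀ := fun k x hx h => hx (by
    have := hinv k⁻¹ _ h
    rwa [inv_smul_smul] at this)
  let c : G → X → ℝ := fun g => X₀.indicator (l g)
  refine ⟨c, fun g => (hl g).indicator hX₀m, fun g h x => ?_, fun g f hf => ?_⟩
  · by_cases hx : x ∈ X₀
    · simp only [c, Set.indicator_of_mem hx, Set.indicator_of_mem (hinv g x hx)]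
      exact hx g h
    · simp only [c, Set.indicator_of_notMem hx, Set.indicator_of_notMem (hinv' g x hx), add_zero]
  · rw [← hint g f hf]
    refine lintegral_congr_ae ?_
    filter_upwards [hX₀, hlexp g] with x h1 h2
    simp only [c, Set.indicator_of_mem h1, h2]

end Cocycle

/-! ### Ergodicity and strong ergodicity in terms of the generating action. -/

section Ergodicity

variable {X : Type*} [MeasurableSpace X] {G : Type*} [Group G] [MulAction G X]
  {R : Setoid X} {μ : Measure X}

theorem IsGeneratingAction.quasiMeasurePreserving [MeasurableConstSMul G X]
    (hG : IsGeneratingAction R μ G) (g : G) :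
    Measure.QuasiMeasurePreserving (g • · : X → X) μ μ := by
  refine ⟨measurable_const_smul g, Measure.AbsolutelyContinuous.mk fun E hE h0 => ?_⟩
  rw [Measure.map_apply (measurable_const_smul g) hE]
  obtain ⟨K, -, hK⟩ := hG.bounded g
  simpa [h0] using hK E hE

theorem IsGeneratingAction.ae_forall_smul [Countable G] [MeasurableConstSMul G X]
    (hG : IsGeneratingAction R μ G) {P : X → Prop} (h : ∀ᵐ x ∂μ, P x) :
    ∀ᵐ x ∂μ, ∀ g : G, P (g • x) :=
  ae_all_iff.2 fun g => (hG.quasiMeasurePreserving g).ae h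

theorem IsGeneratingAction.null_or_conull (hG : IsGeneratingAction R μ G) (herg : IsErgodic R μ)
    {A : Set X} (hA : MeasurableSet A) (hinv : ∀ᵐ x ∂μ, ∀ g : G, g • x ∈ A ↔ x ∈ A) :
    (∀ᵐ x ∂μ, x ∉ A) ∨ ∀ᵐ x ∂μ, x ∈ A := by
  classical
  obtain ⟨a, ha⟩ := herg (A.indicator fun _ => 1)
    ((memLp_top_const (1 : ℂ)).indicator hA) (by
      filter_upwards [hinv, hG.exhausts] with x h1 h2 y hxy
      obtain ⟨g, rfl⟩ := h2 y hxy
      simp only [Set.indicator_apply, h1 g])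
  by_cases h1 : a = 1
  · refine Or.inr (ha.mono fun x hx => ?_)
    by_contra hxA
    rw [Set.indicator_of_notMem hxA, h1] at hx
    exact zero_ne_one hx
  · refine Or.inl (ha.mono fun x hx hxA => h1 ?_)
    rw [Set.indicator_of_mem hxA] at hx
    exact hx.symm

theorem IsGeneratingAction.ae_exists_smul_mem [Countable G] [MeasurableConstSMul G X]
    (hG : IsGeneratingAction R μ G) (herg : IsErgodic R μ) {A : Set X} (hA : MeasurableSet A)
    (h0 : μ A ≠ 0) : ∀ᵐ x ∂μ, ∃ g : G, g • x ∈ A := by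
  have hm : MeasurableSet {x | ∃ g : G, g • x ∈ A} := by
    rw [Set.ofPred_exists]
    exact .iUnion fun g => measurable_const_smul g hA
  refine (hG.null_or_conull herg hm (ae_of_all _ fun x g => ?_)).resolve_left fun h => h0 ?_
  · constructor
    · rintro ⟨k, hk⟩
      exact ⟨k * g, by rwa [mul_smul]⟩
    · rintro ⟨k, hk⟩
      exact ⟨k * g⁻¹, by rwa [mul_smul, inv_smul_smul]⟩
  · refine measure_mono_null (fun x hx => ?_) h
    exact not_not.2 ⟨1, by rwa [one_smul]⟩

theorem IsGeneratingAction.exists_smul_inter [Countable G] [MeasurableConstSMul G X]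
    (hG : IsGeneratingAction R μ G) (herg : IsErgodic R μ) {A B : Set X}
    (hB : MeasurableSet B) (hA0 : μ A ≠ 0) (hB0 : μ B ≠ 0) :
    ∃ g : G, μ {x | x ∈ A ∧ g • x ∈ B} ≠ 0 := by
  by_contra! h
  refine hA0 ?_
  have h1 := measure_iUnion_null h
  have h2 := hG.ae_exists_smul_mem herg hB hB0
  have h3 := measure_eq_zero_iff_ae_notMem.1 h1
  rw [measure_eq_zero_iff_ae_notMem]
  filter_upwards [h2, h3] with x ⟨g, hg⟩ hx hxA
  exact hx (Set.mem_iUnion.2 ⟨g, hxA, hg⟩)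

/-- Strong ergodicity is witnessed by finitely many elements of a generating group. -/
theorem IsGeneratingAction.exists_finset_of_isStronglyErgodic [Countable G]
    [MeasurableConstSMul G X] [StandardBorelSpace X] [IsProbabilityMeasure μ]
    (hG : IsGeneratingAction R μ G)
    (hSE : IsStronglyErgodic R μ) {δ : ℝ≥0∞} (hδ : 0 < δ) :
    ∃ (F : Finset G) (ε : ℝ≥0), 0 < ε ∧ ∀ B, MeasurableSet B →
      (∀ g ∈ F, μ (moved (g • · : X → X) B) ≤ ε) → μ B * (1 - μ B) < δ := by
  classical
  have : MeasurableEq X := measurableEq_of_standardBorel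
  obtain ⟨e, he⟩ := exists_surjective_nat G
  by_contra! hcon
  have hpos : ∀ n : ℕ, (0 : ℝ≥0) < ((n : ℝ≥0) + 1)⁻¹ := fun n => by positivity
  -- Counterexamples for the first `n` group elements with tolerance `1/(n+1)` form a sequence
  -- asymptotically invariant under every group element.
  choose B hBm hB hBδ using fun n : ℕ => hcon ((Finset.range n).image e) ((n : ℝ≥0) + 1)⁻¹ (hpos n)
  have hBg : ∀ g : G, Tendsto (fun n => μ (moved (g • · : X → X) (B n))) atTop (𝓝 0) := by
    intro g
    obtain ⟨i, rfl⟩ := he g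
    have hlim : Tendsto (fun n : ℕ => ((((n : ℝ≥0) + 1)⁻¹ : ℝ≥0) : ℝ≥0∞)) atTop (𝓝 0) := by
      have h1 := (tendsto_add_atTop_iff_nat 1).2 ENNReal.tendsto_inv_nat_nhds_zero
      refine h1.congr fun n => ?_
      rw [ENNReal.coe_inv (by positivity)]
      push_cast
      rfl
    refine tendsto_of_tendsto_of_tendsto_of_le_of_le' tendsto_const_nhds hlim
      (Eventually.of_forall fun _ => zero_le) ?_
    filter_upwards [eventually_gt_atTop i] with n hn
    exact hB n _ (Finset.mem_image_of_mem e (Finset.mem_range.2 hn))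
  have hconc := hSE B hBm fun θ hθ => ?_
  · have := ge_of_tendsto' hconc hBδ
    exact absurd hδ (not_lt.2 this)
  -- An arbitrary element of the full group agrees, off a set of small measure, pointwise with one
  -- of finitely many group elements, so asymptotic invariance passes to it.
  · let Y : ℕ → Set X := fun m => {x | ∀ i < m, e i • x ≠ θ x}
    have hY : ∀ m, MeasurableSet (Y m) := fun m => by
      simp only [Y, Set.ofPred_forall]
      exact .iInter fun i => .iInter fun _ =>
        (measurableSet_eq_fun (measurable_const_smul (e i)) θ.measurable).compl
    have hYanti : Antitone fun m => θ.symm ⁻¹' (Y m) := fun m n hmn x hx i hi =>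
      hx i (hi.trans_le hmn)
    have hY0 : μ (⋂ m, θ.symm ⁻¹' (Y m)) = 0 := by
      rw [← Set.preimage_iInter]
      refine hθ.1.2.preimage_null ?_
      rw [measure_eq_zero_iff_ae_notMem]
      filter_upwards [hθ.2, hG.exhausts] with x h1 h2 h3
      obtain ⟨g, hg⟩ := h2 _ h1
      obtain ⟨i, rfl⟩ := he g
      exact Set.mem_iInter.1 h3 (i + 1) i (Nat.lt_succ_self i) hg
    have hYlim : Tendsto (fun m => μ (θ.symm ⁻¹' (Y m))) atTop (𝓝 0) := by
      rw [← hY0]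
      exact tendsto_measure_iInter_atTop
        (fun m => (θ.symm.measurable (hY m)).nullMeasurableSet) hYanti
        ⟨0, measure_ne_top _ _⟩
    rw [ENNReal.tendsto_nhds_zero]
    intro ε hε
    obtain ⟨m, hm⟩ := ((ENNReal.tendsto_nhds_zero.1 hYlim) (ε / 2)
      (ENNReal.half_pos hε.ne')).exists
    have hsum : Tendsto (fun n => ∑ i ∈ Finset.range m,
        μ (moved ((e i)⁻¹ • · : X → X) (B n))) atTop (𝓝 0) := by
      have := tendsto_finsetSum (Finset.range m) fun i _ => hBg (e i)⁻¹
      simpa using this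
    filter_upwards [(ENNReal.tendsto_nhds_zero.1 hsum) (ε / 2) (ENNReal.half_pos hε.ne')] with n hn
    have hsub : B n ∆ (θ '' B n) ⊆ θ.symm ⁻¹' (Y m) ∪
        ⋃ i ∈ Finset.range m, (moved ((e i)⁻¹ • · : X → X) (B n)) := by
      intro y hy
      by_cases hyY : θ.symm y ∈ Y m
      · exact Or.inl hyY
      · right
        simp only [Y, Set.mem_ofPred_eq] at hyY
        push Not at hyY
        obtain ⟨i, hi, hiy⟩ := hyY
        rw [MeasurableEquiv.apply_symm_apply] at hiy
        have h1 : (e i)⁻¹ • y = θ.symm y := by rw [← hiy, inv_smul_smul, hiy]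
        have h2 : y ∈ θ '' B n ↔ θ.symm y ∈ B n := by
          rw [MeasurableEquiv.image_eq_preimage_symm]; rfl
        simp only [Set.mem_iUnion, Finset.mem_range]
        refine ⟨i, hi, ?_⟩
        change ¬ ((e i)⁻¹ • y ∈ B n ↔ y ∈ B n)
        rw [h1, ← h2]
        rw [Set.mem_symmDiff] at hy
        tauto
    calc μ (B n ∆ (θ '' B n)) ≤ μ (θ.symm ⁻¹' (Y m)) +
          ∑ i ∈ Finset.range m, μ (moved ((e i)⁻¹ • · : X → X) (B n)) :=
          (measure_mono hsub).trans ((measure_union_le _ _).trans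
            (add_le_add le_rfl (measure_biUnion_finset_le _ _)))
      _ ≤ ε / 2 + ε / 2 := add_le_add hm hn
      _ = ε := ENNReal.add_halves ε

end Ergodicity

/-! ### Invariant measures and unboundedness of the cocycle in type III. -/

section Invariant

variable {X : Type*} [MeasurableSpace X] {G : Type*} [Group G] [MulAction G X]
  {R : Setoid X} {μ : Measure X}

/-- Assigning to each pair in `W` the first group element that realizes it splits `W`, up to null
fibres, into disjoint graphs over sets `T n`. The left count is then `∑ ν(T n)` and the right count
`∑ ν(e n • T n)`. -/
theorem IsGeneratingAction.isInvariant [StandardBorelSpace X] [Countable G]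
    [MeasurableConstSMul G X] (hG : IsGeneratingAction R μ G) {ν : Measure X} (hν : ν ≪ μ)
    (hinv : ∀ (g : G) (E : Set X), MeasurableSet E → ν ((g • · : X → X) ⁻¹' E) = ν E) :
    IsInvariant R ν := by
  classical
  have : MeasurableEq X := measurableEq_of_standardBorel
  intro W hW hWR
  obtain ⟨e, he⟩ := exists_surjective_nat G
  let T : ℕ → Set X := fun n => {x | (∀ m < n, e m • x ≠ e n • x) ∧ (x, e n • x) ∈ W}
  have hT : ∀ n, MeasurableSet (T n) := fun n => by
    refine MeasurableSet.inter (s₁ := {x | ∀ m < n, e m • x ≠ e n • x}) ?_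
      ((measurable_id.prodMk (measurable_const_smul (e n))) hW)
    simp only [Set.ofPred_forall]
    exact .iInter fun m => .iInter fun _ => (measurableSet_eq_fun (measurable_const_smul (e m))
      (measurable_const_smul (e n))).compl
  have hexists : ∀ x (g : G), (x, g • x) ∈ W → ∃ n, x ∈ T n ∧ e n • x = g • x := by
    intro x g hg
    have hex : ∃ n, e n • x = g • x := by
      obtain ⟨n, rfl⟩ := he g
      exact ⟨n, rfl⟩
    refine ⟨Nat.find hex, ⟨fun m hm h => Nat.find_min hex hm (h.trans (Nat.find_spec hex)), ?_⟩,
      Nat.find_spec hex⟩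
    rw [Nat.find_spec hex]; exact hg
  have hinjT : ∀ x n m, x ∈ T n → x ∈ T m → e n • x = e m • x → n = m := by
    intro x n m hn hm h
    rcases lt_trichotomy n m with hlt | heq | hgt
    · exact absurd h (hm.1 n hlt)
    · exact heq
    · exact absurd h.symm (hn.1 m hgt)
  have hcount : ∀ S : Set ℕ, ((S.encard : ℕ∞) : ℝ≥0∞) = ∑' n, S.indicator 1 n := by
    intro S
    rw [← ENNReal.tsum_set_one, tsum_subtype S (fun _ => (1 : ℝ≥0∞))]
    rfl
  have hleft : leftCount ν W = ∑' n, ν (T n) := by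
    have h1 : leftCount ν W = ∫⁻ x, ∑' n, (T n).indicator 1 x ∂ν := by
      refine lintegral_congr_ae (hν.ae_le ?_)
      filter_upwards [hG.exhausts] with x hx
      have himg : {y | (x, y) ∈ W} = (fun n => e n • x) '' {n | x ∈ T n} := by
        ext y
        constructor
        · intro hy
          obtain ⟨g, rfl⟩ := hx y (hWR _ hy)
          obtain ⟨n, hn, hn'⟩ := hexists x g hy
          exact ⟨n, hn, hn'⟩
        · rintro ⟨n, hn, rfl⟩
          exact hn.2
      have hinj : Set.InjOn (fun n => e n • x) {n | x ∈ T n} := fun n hn m hm h =>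
        hinjT x n m hn hm h
      rw [himg, hinj.encard_image, hcount]
      rfl
    rw [h1, lintegral_tsum fun n => (measurable_one.indicator (hT n)).aemeasurable]
    exact tsum_congr fun n => lintegral_indicator_one (hT n)
  have hright : rightCount ν W = ∑' n, ν (((e n)⁻¹ • · : X → X) ⁻¹' T n) := by
    have h1 : rightCount ν W =
        ∫⁻ y, ∑' n, (((e n)⁻¹ • · : X → X) ⁻¹' T n).indicator 1 y ∂ν := by
      refine lintegral_congr_ae (hν.ae_le ?_)
      filter_upwards [hG.exhausts] with y hy
      have himg : {x | (x, y) ∈ W} = (fun n => (e n)⁻¹ • y) '' {n | (e n)⁻¹ • y ∈ T n} := by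
        ext x
        constructor
        · intro hx
          obtain ⟨g, rfl⟩ := hy x (R.symm (hWR _ hx))
          have hx' : (g • y, g⁻¹ • (g • y)) ∈ W := by rw [inv_smul_smul]; exact hx
          obtain ⟨n, hn, hn'⟩ := hexists (g • y) g⁻¹ hx'
          rw [inv_smul_smul] at hn'
          have hn'' : (e n)⁻¹ • y = g • y := by rw [inv_smul_eq_iff, hn']
          refine ⟨n, ?_, hn''⟩
          change (e n)⁻¹ • y ∈ T n
          rw [hn'']; exact hn
        · rintro ⟨n, hn, rfl⟩
          have := hn.2
          rwa [smul_inv_smul] at this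
      have hinj : Set.InjOn (fun n => (e n)⁻¹ • y) {n | (e n)⁻¹ • y ∈ T n} := by
        intro n hn m hm h
        have h' : (e n)⁻¹ • y = (e m)⁻¹ • y := h
        refine hinjT ((e n)⁻¹ • y) n m hn (by rw [h']; exact hm) ?_
        rw [smul_inv_smul, h', smul_inv_smul]
      rw [himg, hinj.encard_image, hcount]
      rfl
    rw [h1, lintegral_tsum fun n =>
      (measurable_one.indicator (measurable_const_smul (e n)⁻¹ (hT n))).aemeasurable]
    exact tsum_congr fun n => lintegral_indicator_one (measurable_const_smul (e n)⁻¹ (hT n))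
  rw [hleft, hright]
  exact tsum_congr fun n => (hinv _ _ (hT n)).symm

/-- Invariance is tested on the part of the graph of `g` that ends in `E`, whose fibres on either
side have at most one point. -/
theorem IsGeneratingAction.measure_preimage_smul [StandardBorelSpace X]
    [MeasurableConstSMul G X] (hG : IsGeneratingAction R μ G) (hinv : IsInvariant R μ) (g : G)
    {E : Set X} (hE : MeasurableSet E) : μ ((g • · : X → X) ⁻¹' E) = μ E := by
  classical
  have : MeasurableEq X := measurableEq_of_standardBorel
  have hgE : MeasurableSet ((g • · : X → X) ⁻¹' E) := measurable_const_smul g hE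
  have h := hinv {p | g • p.1 = p.2 ∧ p.2 ∈ E}
    ((measurableSet_eq_fun ((measurable_const_smul g).comp measurable_fst) measurable_snd).inter
      (measurable_snd hE)) (fun p hp => hp.1 ▸ hG.rel g p.1)
  have hl : ∀ x : X, ((({y | (x, y) ∈ {p : X × X | g • p.1 = p.2 ∧ p.2 ∈ E}}.encard : ℕ∞)) : ℝ≥0∞)
      = ((g • · : X → X) ⁻¹' E).indicator 1 x := by
    intro x
    by_cases hx : g • x ∈ E
    · have : {y | (x, y) ∈ {p : X × X | g • p.1 = p.2 ∧ p.2 ∈ E}} = {g • x} := by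
        ext y
        simp only [Set.mem_ofPred_eq, Set.mem_singleton_iff]
        exact ⟨fun h => h.1.symm, fun h => by rw [h]; exact ⟨rfl, hx⟩⟩
      rw [this, Set.encard_singleton, Set.indicator_of_mem (by exact hx)]
      simp
    · have : {y | (x, y) ∈ {p : X × X | g • p.1 = p.2 ∧ p.2 ∈ E}} = ∅ := by
        ext y
        simp only [Set.mem_ofPred_eq, Set.mem_empty_iff_false, iff_false]
        rintro ⟨rfl, h⟩
        exact hx h
      rw [this, Set.encard_empty, Set.indicator_of_notMem (by exact hx)]
      simp
  have hr : ∀ y : X, ((({x | (x, y) ∈ {p : X × X | g • p.1 = p.2 ∧ p.2 ∈ E}}.encard : ℕ∞)) : ℝ≥0∞)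
      = E.indicator 1 y := by
    intro y
    by_cases hy : y ∈ E
    · have : {x | (x, y) ∈ {p : X × X | g • p.1 = p.2 ∧ p.2 ∈ E}} = {g⁻¹ • y} := by
        ext x
        simp only [Set.mem_ofPred_eq, Set.mem_singleton_iff, eq_inv_smul_iff, hy, and_true]
      rw [this, Set.encard_singleton, Set.indicator_of_mem hy]
      simp
    · have : {x | (x, y) ∈ {p : X × X | g • p.1 = p.2 ∧ p.2 ∈ E}} = ∅ := by
        ext x
        simp [hy]
      rw [this, Set.encard_empty, Set.indicator_of_notMem hy]
      simp
  simp only [leftCount, rightCount, hl, hr, lintegral_indicator_one hE,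
    lintegral_indicator_one hgE] at h
  exact h

theorem IsGeneratingAction.isLogDeriv_zero [StandardBorelSpace X]
    [MeasurableConstSMul G X] (hG : IsGeneratingAction R μ G) (hinv : IsInvariant R μ) :
    IsLogDeriv μ (fun (_ : G) (_ : X) => (0 : ℝ)) := by
  refine ⟨fun g => measurable_const, fun g h x => by simp, fun g f hf => ?_⟩
  have hmp : μ.map (g • · : X → X) = μ := by
    ext E hE
    rw [Measure.map_apply (measurable_const_smul g) hE, hG.measure_preimage_smul hinv g hE]
  simp only [Real.exp_zero, ENNReal.ofReal_one, mul_one]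
  conv_rhs => rw [← hmp]
  rw [lintegral_map hf (measurable_const_smul g)]

/-- In type `III`, the Radon–Nikodym cocycle is not a coboundary. -/
theorem IsTypeIII.not_coboundary [StandardBorelSpace X] [IsProbabilityMeasure μ] [Countable G]
    [MeasurableConstSMul G X] (hIII : IsTypeIII R μ) (hG : IsGeneratingAction R μ G)
    {c : G → X → ℝ} (hc : IsLogDeriv μ c) {h : X → ℝ≥0∞} (hm : Measurable h)
    (hpos : ∀ᵐ x ∂μ, h x ≠ 0) (htop : ∀ᵐ x ∂μ, h x ≠ ∞)
    (hcob : ∀ (g : G) x, h (g • x) * ENNReal.ofReal (Real.exp (c g x)) = h x) : False := by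
  obtain ⟨herg, hI, hII, hIIi⟩ := hIII
  -- By `hcob` this measure is invariant. Infinite mass would mean type II_∞, finite mass after
  -- normalization type II₁.
  set ν := μ.withDensity h with hν
  have hac : ν ≪ μ := withDensity_absolutelyContinuous _ _
  have hac' : μ ≪ ν := withDensity_absolutelyContinuous' hm.aemeasurable hpos
  have hσ : SigmaFinite ν := SigmaFinite.withDensity_of_ne_top htop
  have hinv : ∀ (g : G) (E : Set X), MeasurableSet E → ν ((g • · : X → X) ⁻¹' E) = ν E := by
    intro g E hE
    have hgE : MeasurableSet ((g • · : X → X) ⁻¹' E) := measurable_const_smul g hE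
    rw [withDensity_apply _ hgE, withDensity_apply _ hE, ← lintegral_indicator hgE,
      ← lintegral_indicator hE, ← hc.lintegral g (E.indicator h) (hm.indicator hE)]
    congr 1; ext x
    by_cases hx : g • x ∈ E
    · rw [Set.indicator_of_mem (by exact hx), Set.indicator_of_mem hx, hcob]
    · rw [Set.indicator_of_notMem (by exact hx), Set.indicator_of_notMem hx, zero_mul]
  by_cases hmass : ν Set.univ = ∞
  · exact hIIi ⟨herg, hI, ν, ⟨hσ, hac, hac'⟩, hmass, hG.isInvariant hac hinv⟩
  · have h0 : ν Set.univ ≠ 0 := fun h => by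
      have := hac' h
      simp at this
    have hr : (ν Set.univ)⁻¹ ≠ 0 := ENNReal.inv_ne_zero.2 hmass
    have hr' : (ν Set.univ)⁻¹ ≠ ∞ := ENNReal.inv_ne_top.2 h0
    have hpm : IsProbabilityMeasure ((ν Set.univ)⁻¹ • ν) := ⟨by
      rw [Measure.smul_apply, smul_eq_mul, ENNReal.inv_mul_cancel h0 hmass]⟩
    have hac2 : (ν Set.univ)⁻¹ • ν ≪ μ := hac.smul_left _
    refine hII ⟨herg, hI, (ν Set.univ)⁻¹ • ν, ⟨inferInstance, hac2, ?_⟩, hpm,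
      hG.isInvariant hac2 fun g E hE => ?_⟩
    · exact hac'.trans (Measure.absolutelyContinuous_smul hr)
    · rw [Measure.smul_apply, Measure.smul_apply, hinv g E hE]

/-- If `s * c` were bounded above on the visits to `W`, the supremum of `exp (s * c)` over these
visits would be finite and would transform like an invariant density for `s = 1`, its inverse like
one for `s = -1`. Ergodicity makes boundedness an all-or-nothing event. -/
theorem IsTypeIII.ae_not_bddAbove_of_sign [StandardBorelSpace X] [IsProbabilityMeasure μ]
    [Countable G] [MeasurableConstSMul G X] (hIII : IsTypeIII R μ) (hG : IsGeneratingAction R μ G)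
    {c : G → X → ℝ} (hc : IsLogDeriv μ c) {W : Set X} (hW : MeasurableSet W) (hW0 : μ W ≠ 0)
    (s : ℝ) (hs : s = 1 ∨ s = -1) :
    ∀ᵐ x ∂μ, ∀ N : ℝ, ∃ g : G, g • x ∈ W ∧ N < s * c g x := by
  classical
  let bad : Set X := {x | ∃ N : ℕ, ∀ g : G, g • x ∈ W → s * c g x ≤ N}
  have hbad : MeasurableSet bad := by
    simp only [bad, Set.ofPred_exists, Set.ofPred_forall]
    refine .iUnion fun N => .iInter fun g => ?_
    have : {x : X | g • x ∈ W → s * c g x ≤ N} =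
        ((g • · : X → X) ⁻¹' W)ᶜ ∪ {x | s * c g x ≤ N} := by
      ext x; simp [imp_iff_not_or]
    rw [this]
    exact (measurable_const_smul g hW).compl.union
      (measurableSet_le ((hc.measurable g).const_mul s) measurable_const)
  have hstep : ∀ (k : G) x, x ∈ bad → k • x ∈ bad := by
    rintro k x ⟨N, hN⟩
    obtain ⟨M, hM⟩ := exists_nat_ge ((N : ℝ) - s * c k x)
    refine ⟨M, fun g hg => ?_⟩
    have h1 := hN (g * k) (by rwa [mul_smul])
    rw [hc.mul, mul_add] at h1
    linarith
  have hbinv : ∀ x (k : G), k • x ∈ bad ↔ x ∈ bad := fun x k =>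
    ⟨fun h => by simpa using hstep k⁻¹ _ h, hstep k x⟩
  rcases hG.null_or_conull hIII.1 hbad (ae_of_all _ hbinv) with h | h
  · filter_upwards [h] with x hx N
    simp only [bad, Set.mem_ofPred_eq] at hx
    push Not at hx
    obtain ⟨M, hM⟩ := exists_nat_ge N
    obtain ⟨g, hg, hgM⟩ := hx M
    exact ⟨g, hg, hM.trans_lt hgM⟩
  · exfalso
    let H : X → ℝ≥0∞ := fun x => ⨆ g : G, ((g • · : X → X) ⁻¹' W).indicator
      (fun x => ENNReal.ofReal (Real.exp (s * c g x))) x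
    have hHm : Measurable H := .iSup fun g =>
      (((hc.measurable g).const_mul s).exp.ennreal_ofReal).indicator
        (measurable_const_smul g hW)
    have hH0 : ∀ᵐ x ∂μ, H x ≠ 0 := by
      filter_upwards [hG.ae_exists_smul_mem hIII.1 hW hW0] with x ⟨g, hg⟩ h0
      have h1 := ENNReal.iSup_eq_zero.1 h0 g
      rw [Set.indicator_of_mem (by exact hg), ENNReal.ofReal_eq_zero] at h1
      exact absurd (Real.exp_pos _) (not_lt.2 h1)
    have hHtop : ∀ᵐ x ∂μ, H x ≠ ∞ := by
      filter_upwards [h] with x ⟨N, hN⟩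
      refine ne_top_of_le_ne_top (ENNReal.ofReal_ne_top (r := Real.exp N)) (iSup_le fun g => ?_)
      by_cases hx : g • x ∈ W
      · rw [Set.indicator_of_mem (by exact hx)]
        exact ENNReal.ofReal_le_ofReal (Real.exp_le_exp.2 (hN g hx))
      · rw [Set.indicator_of_notMem (by exact hx)]
        exact zero_le
    have hHc : ∀ (k : G) x, H (k • x) * ENNReal.ofReal (Real.exp (s * c k x)) = H x := by
      intro k x
      simp only [H, ENNReal.iSup_mul]
      refine Equiv.iSup_congr (Equiv.mulRight k) fun g => ?_
      have hiff : k • x ∈ (g • · : X → X) ⁻¹' W ↔ x ∈ ((g * k) • · : X → X) ⁻¹' W := by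
        simp [mul_smul]
      simp only [Equiv.coe_mulRight]
      by_cases hx : k • x ∈ (g • · : X → X) ⁻¹' W
      · rw [Set.indicator_of_mem hx, Set.indicator_of_mem (hiff.1 hx), hc.mul, mul_add,
          Real.exp_add, ENNReal.ofReal_mul (Real.exp_pos _).le]
      · rw [Set.indicator_of_notMem hx, Set.indicator_of_notMem (fun h => hx (hiff.2 h)), zero_mul]
    rcases hs with rfl | rfl
    · exact hIII.not_coboundary hG hc hHm hH0 hHtop fun g x => by
        have := hHc g x
        rwa [one_mul] at this
    · refine hIII.not_coboundary hG hc (h := fun x => (H x)⁻¹) hHm.inv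
        (hHtop.mono fun x hx => ENNReal.inv_ne_zero.2 hx)
        (hH0.mono fun x hx => ENNReal.inv_ne_top.2 hx) fun g x => ?_
      have h1 := hHc g x
      rw [← h1, ENNReal.mul_inv (Or.inr ENNReal.ofReal_ne_top)
        (Or.inr (by simp [Real.exp_pos])), ← ENNReal.ofReal_inv_of_pos (Real.exp_pos _),
        ← Real.exp_neg]
      congr 3
      ring

theorem IsTypeIII.ae_not_bddAbove [StandardBorelSpace X] [IsProbabilityMeasure μ]
    [Countable G] [MeasurableConstSMul G X] (hIII : IsTypeIII R μ) (hG : IsGeneratingAction R μ G)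
    {c : G → X → ℝ} (hc : IsLogDeriv μ c) {W : Set X} (hW : MeasurableSet W) (hW0 : μ W ≠ 0) :
    ∀ᵐ x ∂μ, ∀ N : ℝ, ∃ g : G, g • x ∈ W ∧ N < c g x := by
  simpa only [one_mul] using hIII.ae_not_bddAbove_of_sign hG hc hW hW0 1 (Or.inl rfl)

theorem IsTypeIII.ae_not_bddBelow [StandardBorelSpace X] [IsProbabilityMeasure μ]
    [Countable G] [MeasurableConstSMul G X] (hIII : IsTypeIII R μ) (hG : IsGeneratingAction R μ G)
    {c : G → X → ℝ} (hc : IsLogDeriv μ c) {W : Set X} (hW : MeasurableSet W) (hW0 : μ W ≠ 0) :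
    ∀ᵐ x ∂μ, ∀ N : ℝ, ∃ g : G, g • x ∈ W ∧ c g x < N := by
  filter_upwards [hIII.ae_not_bddAbove_of_sign hG hc hW hW0 (-1) (Or.inr rfl)] with x hx N
  obtain ⟨g, hg, h⟩ := hx (-N)
  exact ⟨g, hg, by linarith⟩

end Invariant

/-! ### Cutting orbits by height. -/

section Neighbourhood

variable {X : Type*} {G : Type*} [Group G] [MulAction G X]

/-- The points whose orbit meets `Y` at a place where the cocycle `c` is at most `K` in absolute
value. -/
def nb (c : G → X → ℝ) (Y : Set X) (K : ℝ) : Set X := {x | ∃ g : G, g • x ∈ Y ∧ |c g x| ≤ K}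

/-- No point of `W` in the orbit of `x` lies between `x` and `g • x` with respect to `c`. -/
def Linked (c : G → X → ℝ) (W : Set X) (g : G) (x : X) : Prop :=
  ∀ h : G, h • x ∈ W → c h x ∉ Set.uIcc 0 (c g x)

theorem nb_mono {c : G → X → ℝ} {Y Y' : Set X} {K K' : ℝ} (hY : Y ⊆ Y') (hK : K ≤ K') :
    nb c Y K ⊆ nb c Y' K' := fun _ ⟨g, hg, h⟩ => ⟨g, hY hg, h.trans hK⟩

variable [MeasurableSpace X] {μ : Measure X} {c : G → X → ℝ}

theorem measurableSet_nb [Countable G] [MeasurableConstSMul G X] (hc : IsLogDeriv μ c)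
    {Y : Set X} (hY : MeasurableSet Y) (K : ℝ) : MeasurableSet (nb c Y K) := by
  simp only [nb, Set.ofPred_exists]
  exact .iUnion fun g => (measurable_const_smul g hY).inter
    (measurableSet_le (hc.measurable g).abs measurable_const)

theorem IsLogDeriv.smul_mem_nb (hc : IsLogDeriv μ c) {Y : Set X} {K : ℝ} {x : X}
    (hx : x ∈ nb c Y K) (k : G) : k • x ∈ nb c Y (K + |c k x|) := by
  obtain ⟨g, hg, h⟩ := hx
  refine ⟨g * k⁻¹, by rwa [mul_smul, inv_smul_smul], ?_⟩
  rw [hc.mul_inv]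
  exact (abs_sub _ _).trans (by gcongr)

theorem measurableSet_linked [Countable G] [MeasurableConstSMul G X] (hc : IsLogDeriv μ c)
    {W : Set X} (hW : MeasurableSet W) (g : G) : MeasurableSet {x | Linked c W g x} := by
  simp only [Linked, Set.ofPred_forall]
  refine .iInter fun h => ?_
  have : {x : X | h • x ∈ W → c h x ∉ Set.uIcc 0 (c g x)} = ((h • · : X → X) ⁻¹' W)ᶜ ∪
      {x | (min 0 (c g x) ≤ c h x) ∧ c h x ≤ max 0 (c g x)}ᶜ := by
    ext x
    simp only [Set.uIcc, Set.mem_Icc, Set.mem_ofPred_eq, Set.mem_union, Set.mem_compl_iff,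
      Set.mem_preimage, imp_iff_not_or]
  rw [this]
  refine (measurable_const_smul h hW).compl.union (MeasurableSet.compl ?_)
  exact (measurableSet_le (measurable_const.min (hc.measurable g)) (hc.measurable h)).inter
    (measurableSet_le (hc.measurable h) (measurable_const.max (hc.measurable g)))

theorem IsLogDeriv.linked_inv (hc : IsLogDeriv μ c) {W : Set X} {g : G} {x : X}
    (h : Linked c W g x) : Linked c W g⁻¹ (g • x) := by
  intro k hk hmem
  have h1 := h (k * g) (by rwa [mul_smul])
  rw [hc.mul] at h1
  rw [hc.inv, Set.mem_uIcc] at hmem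
  rw [Set.mem_uIcc] at h1
  refine h1 (hmem.elim (fun h => Or.inr ⟨?_, ?_⟩) fun h => Or.inl ⟨?_, ?_⟩) <;> linarith [h.1, h.2]

/-- The heights between `x` and `(k * g) • x` lie between `x` and `g • x` or between `g • x` and `(k
* g) • x`. With `linked_inv` this makes being linked an equivalence relation on orbits. -/
theorem IsLogDeriv.linked_mul (hc : IsLogDeriv μ c) {W : Set X} {g k : G} {x : X}
    (h : Linked c W g x) (h' : Linked c W k (g • x)) : Linked c W (k * g) x := by
  intro l hl hmem
  have h1 := h l hl
  have h2 := h' (l * g⁻¹) (by rwa [mul_smul, inv_smul_smul])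
  rw [hc.mul_inv] at h2
  rw [hc.mul] at hmem
  rw [Set.mem_uIcc] at h1 h2 hmem
  by_contra
  push Not at h1 h2
  obtain ⟨h1a, h1b⟩ := h1
  obtain ⟨h2a, h2b⟩ := h2
  rcases hmem with ⟨ha, hb⟩ | ⟨ha, hb⟩
  · have := h1a ha
    have := h2a (by linarith)
    linarith
  · by_cases h3 : c g x ≤ c l x
    · linarith [h1b h3]
    · have := h2b (by linarith)
      linarith

theorem IsLogDeriv.linked_iff (hc : IsLogDeriv μ c) {W : Set X} {g k : G} {x : X}
    (h : Linked c W g x) : Linked c W (k * g⁻¹) (g • x) ↔ Linked c W k x := by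
  constructor
  · intro h'
    simpa using hc.linked_mul h h'
  · intro h'
    refine hc.linked_mul (hc.linked_inv h) ?_
    rwa [inv_smul_smul]

/-- A set that is almost everywhere a union of `L`-classes. -/
def LInvariant (μ : Measure X) (L : G → X → Prop) (B : Set X) : Prop :=
  MeasurableSet B ∧ ∀ᵐ x ∂μ, ∀ g, L g x → (g • x ∈ B ↔ x ∈ B)

theorem LInvariant.compl {L : G → X → Prop} {B : Set X} (h : LInvariant μ L B) :
    LInvariant μ L Bᶜ :=
  ⟨h.1.compl, h.2.mono fun _ hx g hg => not_congr (hx g hg)⟩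

theorem LInvariant.iUnion {ι : Type*} [Countable ι] {L : G → X → Prop} {B : ι → Set X}
    (h : ∀ i, LInvariant μ L (B i)) : LInvariant μ L (⋃ i, B i) := by
  refine ⟨.iUnion fun i => (h i).1, ?_⟩
  filter_upwards [ae_all_iff.2 fun i => (h i).2] with x hx g hg
  simp only [Set.mem_iUnion]
  exact exists_congr fun i => hx i g hg

theorem LInvariant.union {L : G → X → Prop} {B C : Set X} (hB : LInvariant μ L B)
    (hC : LInvariant μ L C) : LInvariant μ L (B ∪ C) := by
  rw [Set.union_eq_iUnion]
  exact LInvariant.iUnion fun b => by cases b <;> assumption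

/-- If invariant sets are either small or of almost full measure, there is an ergodic component of
almost full measure. -/
theorem exists_ergodic_component [IsProbabilityMeasure μ] {L : G → X → Prop}
    (h : ∀ B, LInvariant μ L B → μ B < 1 / 8 ∨ μ Bᶜ < 1 / 8) :
    ∃ E, LInvariant μ L E ∧ μ Eᶜ < 1 / 8 ∧
      ∀ B, LInvariant μ L B → μ (E ∩ B) = 0 ∨ μ (E ∩ Bᶜ) = 0 := by
  have hbig : ∀ B, μ B ≤ 1 / 4 → ¬ μ Bᶜ < 1 / 8 := by
    intro B h1 h2
    have h3 : (1 : ℝ≥0∞) ≤ μ B + μ Bᶜ := by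
      rw [← measure_univ (μ := μ), ← Set.union_compl_self B]
      exact measure_union_le _ _
    have h4 : μ B + μ Bᶜ < 1 := by
      refine (add_le_add h1 h2.le).trans_lt ?_
      rw [← ENNReal.toReal_lt_toReal (by finiteness) (by finiteness),
        ENNReal.toReal_add (by finiteness) (by finiteness)]
      norm_num
    exact absurd h3 (not_le.2 h4)
  have h84 : (1 / 8 : ℝ≥0∞) + 1 / 8 = 1 / 4 := by
    rw [← ENNReal.toReal_eq_toReal_iff' (by finiteness) (by finiteness),
      ENNReal.toReal_add (by finiteness) (by finiteness)]
    norm_num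
  -- A maximal small invariant set. Since a union of two small sets has measure at most `1/4` and
  -- `1/4 + 1/8 < 1`, such a union is small again; so the complement of `N` contains no non-null
  -- small invariant set.
  obtain ⟨N, ⟨hN, hNs⟩, hmax⟩ := exists_ae_maximal μ
    (fun B => LInvariant μ L B ∧ μ B < 1 / 8) (A₀ := ∅)
    ⟨⟨.empty, by simp⟩, by simp⟩ (fun B hmono hB => by
      have hi := LInvariant.iUnion fun n => (hB n).1
      refine ⟨hi, (h _ hi).resolve_right (hbig _ ?_)⟩
      rw [hmono.measure_iUnion]
      refine iSup_le fun n => (hB n).2.le.trans ?_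
      rw [← h84]; exact le_self_add)
  have hsmall : ∀ B, LInvariant μ L B → μ B < 1 / 8 → μ (Nᶜ ∩ B) = 0 := by
    intro B hB hBs
    have hu := hN.union hB
    have hus : μ (N ∪ B) < 1 / 8 := (h _ hu).resolve_right (hbig _ (by
      rw [← h84]
      exact (measure_union_le _ _).trans (add_le_add hNs.le hBs.le)))
    have h1 := hmax _ ⟨hu, hus⟩ Set.subset_union_left
    have h2 : μ (N ∪ B) = μ N + μ (Nᶜ ∩ B) := by
      rw [← measure_inter_add_sdiff (N ∪ B) hN.1]
      congr 2
      · ext x; simp +contextual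
      · ext x; simp only [Set.mem_sdiff, Set.mem_union, Set.mem_inter_iff, Set.mem_compl_iff]
        tauto
    rw [h2] at h1
    have := ENNReal.le_of_add_le_add_left (measure_ne_top μ N) (c := 0) (by simpa using h1)
    simpa using this
  refine ⟨Nᶜ, hN.compl, by rwa [compl_compl], fun B hB => ?_⟩
  rcases h B hB with hs | hs
  · exact Or.inl (hsmall B hB hs)
  · exact Or.inr (hsmall _ hB.compl hs)

end Neighbourhood

/-! ### Uniform proximity to large sets. -/

section TypeThree

variable {X : Type*} [MeasurableSpace X] {G : Type*} [Group G] [MulAction G X]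
  {R : Setoid X} {μ : Measure X} {c : G → X → ℝ}

/-- Under strong ergodicity, cutting the orbits at the points that are far away from `Y` yields
relations without invariant sets of intermediate measure. -/
theorem exists_linked_dichotomy [StandardBorelSpace X] [IsProbabilityMeasure μ] [Countable G]
    [MeasurableConstSMul G X] (hG : IsGeneratingAction R μ G) (herg : IsErgodic R μ)
    (hSE : IsStronglyErgodic R μ) (hc : IsLogDeriv μ c) {Y : Set X} (hY : MeasurableSet Y)
    (hY0 : μ Y ≠ 0) :
    ∃ K : ℕ, 1 ≤ K ∧ ∀ B, LInvariant μ (Linked c (nb c Y K)ᶜ) B → μ B < 1 / 8 ∨ μ Bᶜ < 1 / 8 := by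
  -- Two complementary sets of measure at least `1/8` have product of measures at least `7/64 >
  -- 1/16`.
  obtain ⟨F, ε, hε, hF⟩ := hG.exists_finset_of_isStronglyErgodic hSE (δ := 1 / 16) (by simp)
  let N : G → ℕ → Set X := fun g n => {x | Linked c (nb c Y n)ᶜ g x}ᶜ
  have hN : ∀ g n, MeasurableSet (N g n) := fun g n =>
    (measurableSet_linked hc (measurableSet_nb hc hY _).compl g).compl
  have hanti : ∀ g, Antitone (N g) := by
    intro g n m hnm x hx hl
    refine hx fun h hh => hl h fun hmem => hh ?_
    exact nb_mono subset_rfl (by exact_mod_cast hnm) hmem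
  have hnull : ∀ g, μ (⋂ n, N g n) = 0 := by
    intro g
    rw [measure_eq_zero_iff_ae_notMem]
    filter_upwards [hG.ae_exists_smul_mem herg hY hY0] with x ⟨k, hk⟩ hx
    -- Orbit points at heights between `x` and `g • x` are within `|c g x|` of `x`, hence within `n`
    -- of `Y`; no cut lies between.
    obtain ⟨n, hn⟩ := exists_nat_ge (|c k x| + |c g x|)
    refine Set.mem_iInter.1 hx n fun h hh hmem => hh ?_
    refine nb_mono subset_rfl ?_ (hc.smul_mem_nb (K := |c k x|) ⟨k, hk, le_rfl⟩ h)
    have : |c h x| ≤ |c g x| := by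
      rw [Set.mem_uIcc] at hmem
      rcases hmem with ⟨h1, h2⟩ | ⟨h1, h2⟩
      · exact abs_le_abs h2 (by linarith)
      · rw [abs_of_nonpos h2, abs_of_nonpos (h1.trans h2)]; linarith
    linarith
  have hlim : ∀ g, ∀ᶠ n in atTop, μ (N g n) ≤ ε := by
    intro g
    have h1 : Tendsto (fun n => μ (N g n)) atTop (𝓝 0) := by
      rw [← hnull g]
      exact tendsto_measure_iInter_atTop (fun n => (hN g n).nullMeasurableSet) (hanti g)
        ⟨0, measure_ne_top _ _⟩
    exact ENNReal.tendsto_nhds_zero.1 h1 ε (by exact_mod_cast hε)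
  obtain ⟨K, hK1, hK⟩ := ((eventually_ge_atTop 1).and
    ((Finset.eventually_all F).2 fun g _ => hlim g)).exists
  refine ⟨K, hK1, fun B hB => ?_⟩
  have h1 := hF B hB.1 fun g hg => by
    refine (measure_mono_ae ?_).trans (hK g hg)
    filter_upwards [hB.2] with x hx hmoved hl
    exact hmoved (hx g hl)
  by_contra! hcon
  have hm : μ Bᶜ = 1 - μ B := prob_compl_eq_one_sub hB.1
  rw [← hm] at h1
  have hsum : μ B + μ Bᶜ = 1 := prob_add_prob_compl hB.1
  have hsum' : (μ B).toReal + (μ Bᶜ).toReal = 1 := by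
    rw [← ENNReal.toReal_add (by finiteness) (by finiteness), hsum, ENNReal.toReal_one]
  have h1' : (μ B).toReal * (μ Bᶜ).toReal < 1 / 16 := by
    rw [← ENNReal.toReal_mul]
    have := (ENNReal.toReal_lt_toReal (by finiteness) (by finiteness)).2 h1
    simpa using this
  have h2 : 1 / 8 ≤ (μ B).toReal := by
    simpa using ENNReal.toReal_mono (by finiteness) hcon.1
  have h3 : 1 / 8 ≤ (μ Bᶜ).toReal := by
    simpa using ENNReal.toReal_mono (by finiteness) hcon.2
  nlinarith

/-- In a strongly ergodic relation of type `III`, all points are within bounded distance of a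
given set of large measure. -/
theorem IsTypeIII.exists_ae_mem_nb [StandardBorelSpace X] [IsProbabilityMeasure μ] [Countable G]
    [MeasurableConstSMul G X] (hIII : IsTypeIII R μ) (hG : IsGeneratingAction R μ G)
    (hSE : IsStronglyErgodic R μ) (hc : IsLogDeriv μ c) {Y : Set X} (hY : MeasurableSet Y)
    (hY2 : μ Yᶜ ≤ 1 / 2) : ∃ K : ℕ, ∀ᵐ x ∂μ, x ∈ nb c Y K := by
  have hY0 : μ Y ≠ 0 := by
    intro h0
    have h1 := prob_add_prob_compl (μ := μ) hY
    rw [h0, zero_add] at h1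
    rw [h1] at hY2
    have := ENNReal.toReal_mono (by finiteness) hY2
    norm_num at this
  by_contra hcon'
  have hcon : ∀ K : ℕ, ¬ ∀ᵐ x ∂μ, x ∈ nb c Y K := fun K h => hcon' ⟨K, h⟩
  obtain ⟨K, hK1, hK⟩ := exists_linked_dichotomy hG hIII.1 hSE hc hY hY0
  have hK1' : (1 : ℝ) ≤ K := by exact_mod_cast hK1
  set W : Set X := (nb c Y K)ᶜ with hWdef
  have hWm : MeasurableSet W := (measurableSet_nb hc hY _).compl
  have hW0 : μ W ≠ 0 := fun h => hcon K (measure_eq_zero_iff_ae_notMem.1 h |>.mono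
    fun x hx => not_not.1 hx)
  obtain ⟨E, hE, hEs, hEerg⟩ := exists_ergodic_component hK
  set Q : Set X := E ∩ Y with hQdef
  have hQm : MeasurableSet Q := hE.1.inter hY
  have hQ0 : μ Q ≠ 0 := by
    intro h0
    have h1 : (1 : ℝ≥0∞) ≤ μ Q + (μ Eᶜ + μ Yᶜ) := by
      rw [← measure_univ (μ := μ), ← Set.union_compl_self Q, hQdef, Set.compl_inter]
      exact (measure_union_le _ _).trans (add_le_add le_rfl (measure_union_le _ _))
    rw [h0, zero_add] at h1
    have h2 := ENNReal.toReal_mono (by finiteness) (h1.trans (add_le_add hEs.le hY2))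
    rw [ENNReal.toReal_add (by finiteness) (by finiteness)] at h2
    norm_num at h2
  have hsep : ∀ (x : X) (h : G), x ∈ Y → h • x ∈ W → (K : ℝ) < |c h x| := by
    intro x h hx hW
    by_contra! hle
    refine hW (nb_mono subset_rfl ?_ (hc.smul_mem_nb (K := 0) (Y := Y) (x := x)
      ⟨1, by rwa [one_smul], by rw [hc.one, abs_zero]⟩ h))
    linarith
  -- With `c` as height: some point of `Q` beyond a cut above `x` is at most `n` higher than a point
  -- of `Q` on the same side of the cuts as `x`. Moving `x` to a linked point stays below that cut,
  -- so the condition is invariant.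
  let B : ℕ → Set X := fun n => {x | ∃ g k : G, (g • x ∈ Q ∧ 0 < c g x ∧ ¬ Linked c W g x) ∧
    (Linked c W k x ∧ k • x ∈ Q) ∧ c g x ≤ c k x + n}
  have hB : ∀ n, MeasurableSet (B n) := by
    intro n
    simp only [B, Set.ofPred_exists]
    refine .iUnion fun g => .iUnion fun k => .inter (.inter (measurable_const_smul g hQm) (.inter
      (measurableSet_lt measurable_const (hc.measurable g))
      (measurableSet_linked hc hWm g).compl)) (.inter (.inter (measurableSet_linked hc hWm k)
      (measurable_const_smul k hQm))
      (measurableSet_le (hc.measurable g) ((hc.measurable k).add_const _)))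
  have hBstep : ∀ n (l : G) x, Linked c W l x → x ∈ B n → l • x ∈ B n := by
    rintro n l x hl ⟨g, k, ⟨hgQ, hgpos, hgl⟩, ⟨hkl, hkQ⟩, hgk⟩
    have hgl' : ∃ h : G, h • x ∈ W ∧ c h x ∈ Set.uIcc 0 (c g x) := by
      by_contra! hh
      exact hgl hh
    obtain ⟨h, hhW, hh⟩ := hgl'
    rw [Set.uIcc_of_le hgpos.le] at hh
    have hlt : c l x < c h x := by
      by_contra! hle
      refine hl h hhW ?_
      rw [Set.uIcc_of_le (hh.1.trans hle)]
      exact ⟨hh.1, hle⟩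
    refine ⟨g * l⁻¹, k * l⁻¹, ⟨by rwa [mul_smul, inv_smul_smul], ?_, ?_⟩,
      ⟨(hc.linked_iff hl).2 hkl, by rwa [mul_smul, inv_smul_smul]⟩, ?_⟩
    · rw [hc.mul_inv]; linarith [hh.2]
    · rwa [hc.linked_iff hl]
    · rw [hc.mul_inv, hc.mul_inv]; linarith
  have hBinv : ∀ n, LInvariant μ (Linked c W) (B n) := fun n => ⟨hB n, ae_of_all _ fun x l hl =>
    ⟨fun h => by simpa using hBstep n l⁻¹ _ (hc.linked_inv hl) h, hBstep n l x hl⟩⟩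
  -- Type III supplies a cut above `x` and then a point of `Q` above the cut. The witness `k = 1` is
  -- allowed since points of `Y` are farther than `K` from every cut.
  have hQB : ∀ᵐ x ∂μ, x ∈ Q → ∃ n, x ∈ B n := by
    filter_upwards [hIII.ae_not_bddAbove hG hc hWm hW0, hIII.ae_not_bddAbove hG hc hQm hQ0] with
      x h1 h2 hx
    obtain ⟨h, hh, hh0⟩ := h1 0
    obtain ⟨g, hg, hgh⟩ := h2 (c h x)
    obtain ⟨n, hn⟩ := exists_nat_ge (c g x)
    refine ⟨n, g, 1, ⟨hg, hh0.trans hgh, fun hl => ?_⟩, ⟨fun l hl hmem => ?_, by rwa [one_smul]⟩,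
      ?_⟩
    · refine hl h hh ?_
      rw [Set.uIcc_of_le (hh0.trans hgh).le]
      exact ⟨hh0.le, hgh.le⟩
    · rw [hc.one, Set.uIcc_self, Set.mem_singleton_iff] at hmem
      have := hsep x l hx.2 hl
      rw [hmem, abs_zero] at this
      linarith
    · rw [hc.one]; linarith
  obtain ⟨n, hn⟩ : ∃ n, μ (E ∩ (B n)ᶜ) = 0 := by
    by_contra! hne
    refine hQ0 ?_
    have h1 : μ (⋃ n, E ∩ B n) = 0 :=
      measure_iUnion_null fun n => (hEerg _ (hBinv n)).resolve_right (hne n)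
    rw [measure_eq_zero_iff_ae_notMem] at h1 ⊢
    filter_upwards [h1, hQB] with x h2 h3 hx
    obtain ⟨n, hn⟩ := h3 hx
    exact h2 (Set.mem_iUnion.2 ⟨n, hx.1, hn⟩)
  refine hcon (max n K) ?_
  have hEB : ∀ᵐ x ∂μ, x ∈ E → x ∈ B n := by
    filter_upwards [measure_eq_zero_iff_ae_notMem.1 hn] with x hx hxE
    by_contra h
    exact hx ⟨hxE, h⟩
  filter_upwards [hG.ae_forall_smul hEB, hIII.ae_not_bddBelow hG hc hQm hQ0] with x h1 h2
  by_contra hx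
  have hxW : x ∈ W := fun h => hx (nb_mono subset_rfl (by simp) h)
  -- Heights of the visits to `Q` below `x`. The chosen `a` is within `1` of the supremum, and `1 ≤
  -- K` is less than the height difference between a point of `Q` and a cut.
  let P : Set ℝ := {t | ∃ a : G, a • x ∈ Q ∧ c a x = t ∧ t < 0}
  have hPne : P.Nonempty := by
    obtain ⟨a, ha, ha0⟩ := h2 0
    exact ⟨_, a, ha, rfl, ha0⟩
  have hPb : BddAbove P := ⟨0, fun t ⟨a, _, _, ht⟩ => ht.le⟩
  obtain ⟨_, ⟨a, haQ, rfl, ha0⟩, hat⟩ := exists_lt_of_lt_csSup hPne (sub_one_lt (sSup P))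
  obtain ⟨g, k, ⟨hgQ, hgpos, hgl⟩, ⟨hkl, hkQ⟩, hgk⟩ := h1 a haQ.1
  -- `x` is itself a cut, so a point linked to `a • x` lies below `x`.
  have hk0 : c k (a • x) < - c a x := by
    by_contra! hle
    refine hkl a⁻¹ (by rwa [inv_smul_smul]) ?_
    rw [hc.inv, Set.uIcc_of_le (by linarith)]
    exact ⟨by linarith, hle⟩
  have hgl' : ∃ h : G, h • a • x ∈ W ∧ c h (a • x) ∈ Set.uIcc 0 (c g (a • x)) := by
    by_contra! hh
    exact hgl hh
  obtain ⟨h, hhW, hh⟩ := hgl'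
  rw [Set.uIcc_of_le hgpos.le] at hh
  have hs1 := hsep (a • x) h haQ.2 hhW
  rw [abs_of_nonneg hh.1] at hs1
  have hga : c (g * a) x = c g (a • x) + c a x := hc.mul a g x
  -- Otherwise `g * a` would be a visit to `Q` below `x` and more than `K ≥ 1` above `a`, beyond the
  -- supremum.
  have hge : 0 ≤ c (g * a) x := by
    by_contra! hlt
    have := le_csSup hPb (⟨g * a, by rwa [mul_smul], rfl, hlt⟩ : c (g * a) x ∈ P)
    linarith [hh.2]
  refine hx ⟨g * a, by rw [mul_smul]; exact hgQ.2, ?_⟩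
  rw [abs_of_nonneg hge]
  have : (n : ℝ) ≤ ((max n K : ℕ) : ℝ) := by exact_mod_cast le_max_left n K
  linarith

/-- Uniform version of `IsTypeIII.exists_ae_mem_nb`. -/
theorem IsTypeIII.exists_uniform_nb [StandardBorelSpace X] [IsProbabilityMeasure μ] [Countable G]
    [MeasurableConstSMul G X] (hIII : IsTypeIII R μ) (hG : IsGeneratingAction R μ G)
    (hSE : IsStronglyErgodic R μ) (hc : IsLogDeriv μ c) :
    ∃ (η : ℝ≥0∞) (K : ℕ), 0 < η ∧ ∀ Y, MeasurableSet Y → μ Yᶜ ≤ η → ∀ᵐ x ∂μ, x ∈ nb c Y K := by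
  by_contra hcon'
  have hcon : ∀ (η : ℝ≥0∞) (K : ℕ), 0 < η →
      ∃ Y, MeasurableSet Y ∧ μ Yᶜ ≤ η ∧ ¬ ∀ᵐ x ∂μ, x ∈ nb c Y K := by
    intro η K hη
    by_contra hh
    refine hcon' ⟨η, K, hη, fun Y hY hYη => ?_⟩
    by_contra h
    exact hh ⟨Y, hY, hYη, h⟩
  -- Counterexamples `Y n` with summable complements have an intersection to which
  -- `exists_ae_mem_nb` applies; the `K` found there contradicts the choice of `Y K`.
  obtain ⟨η, hη, hsum⟩ := ENNReal.exists_pos_sum_of_countable (ε := 1 / 2) (by simp) ℕ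
  choose Y hYm hYη hY using fun n : ℕ => hcon (η n) n (by exact_mod_cast hη n)
  obtain ⟨K, hK⟩ := hIII.exists_ae_mem_nb hG hSE hc (Y := ⋂ n, Y n) (.iInter hYm) (by
    rw [Set.compl_iInter]
    exact (measure_iUnion_le _).trans ((ENNReal.tsum_le_tsum hYη).trans hsum.le))
  exact hY K (hK.mono fun x hx => nb_mono (Set.iInter_subset _ _) le_rfl hx)

/-- For the zero cocycle proximity only asks that the orbit meets `Y`, which ergodicity grants for
every non-null `Y`. -/
theorem exists_uniform_nb_of_isInvariant [IsProbabilityMeasure μ] [Countable G]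
    [MeasurableConstSMul G X] (hG : IsGeneratingAction R μ G) (herg : IsErgodic R μ) :
    ∃ (η : ℝ≥0∞) (K : ℕ), 0 < η ∧ ∀ Y, MeasurableSet Y → μ Yᶜ ≤ η →
      ∀ᵐ x ∂μ, x ∈ nb (fun (_ : G) (_ : X) => (0 : ℝ)) Y K := by
  refine ⟨1 / 2, 0, by simp, fun Y hY hY2 => ?_⟩
  have hY0 : μ Y ≠ 0 := by
    intro h0
    have h1 := prob_add_prob_compl (μ := μ) hY
    rw [h0, zero_add] at h1
    rw [h1] at hY2
    have := ENNReal.toReal_mono (by finiteness) hY2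
    norm_num at this
  filter_upwards [hG.ae_exists_smul_mem herg hY hY0] with x ⟨g, hg⟩
  exact ⟨g, hg, by simp⟩

end TypeThree

/-! ### Almost disjoint copies of small sets. -/

section Packing

variable {X : Type*} [MeasurableSpace X] {G : Type*} [Group G] [MulAction G X]
  {R : Setoid X} {μ : Measure X} {c : G → X → ℝ}

/-- If the points of `X` stay close to every subset of large measure, a small set can be moved
into a disjoint set of large measure by an involution of controlled distortion. -/
theorem IsGeneratingAction.exists_involution_into [StandardBorelSpace X]
    [Countable G] [MeasurableConstSMul G X] (hG : IsGeneratingAction R μ G)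
    (hc : IsLogDeriv μ c) {η : ℝ≥0∞} {K : ℕ}
    (hη : ∀ Y, MeasurableSet Y → μ Yᶜ ≤ η → ∀ᵐ x ∂μ, x ∈ nb c Y K) {C Y : Set X}
    (hC : MeasurableSet C) (hY : MeasurableSet Y) (hCY : Disjoint C Y)
    (hsmall : μ Yᶜ + ENNReal.ofReal (Real.exp K) * μ C ≤ η) :
    ∃ θ : X ≃ᵐ X, (∀ x, θ (θ x) = x) ∧ (∀ x, R x (θ x)) ∧
      DistortionLE μ (ENNReal.ofReal (Real.exp K)) θ ∧ ∀ᵐ x ∂μ, x ∈ C → θ x ∈ Y := by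
  classical
  set L := ENNReal.ofReal (Real.exp K) with hL
  have hL1 : 1 ≤ L := by
    rw [hL, ← ENNReal.ofReal_one]
    exact ENNReal.ofReal_le_ofReal (Real.one_le_exp (Nat.cast_nonneg K))
  obtain ⟨e, he⟩ := exists_surjective_nat G
  -- Greedy matching of `C` into `Y`: the pair `S` records the used points of `C` and of `Y`, and
  -- stage `n` matches by `e n` all unused points for which the cocycle is at most `K` in absolute
  -- value.
  let pick : ℕ → Set X × Set X → Set X := fun n S =>
    {x | (x ∈ C ∧ x ∉ S.1) ∧ (e n • x ∈ Y ∧ e n • x ∉ S.2) ∧ |c (e n) x| ≤ K}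
  let st : ℕ → Set X × Set X := fun n => Nat.rec (∅, ∅) (fun n S =>
    (S.1 ∪ pick n S, S.2 ∪ ((e n)⁻¹ • · : X → X) ⁻¹' pick n S)) n
  let P : ℕ → Set X := fun n => pick n (st n)
  let D : ℕ → Set X := fun n => ((e n)⁻¹ • · : X → X) ⁻¹' P n
  have hst : ∀ n, st (n + 1) = ((st n).1 ∪ P n, (st n).2 ∪ D n) := fun n => rfl
  have hst1 : ∀ n x, x ∈ (st n).1 ↔ ∃ m < n, x ∈ P m := by
    intro n x
    induction n with
    | zero => simp [st]
    | succ n ih =>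
      rw [hst]
      simp only [Set.mem_union, ih, Nat.lt_succ_iff_lt_or_eq]
      constructor
      · rintro (⟨m, hm, h⟩ | h)
        exacts [⟨m, Or.inl hm, h⟩, ⟨n, Or.inr rfl, h⟩]
      · rintro ⟨m, hm | rfl, h⟩
        exacts [Or.inl ⟨m, hm, h⟩, Or.inr h]
  have hst2 : ∀ n x, x ∈ (st n).2 ↔ ∃ m < n, x ∈ D m := by
    intro n x
    induction n with
    | zero => simp [st]
    | succ n ih =>
      rw [hst]
      simp only [Set.mem_union, ih, Nat.lt_succ_iff_lt_or_eq]
      constructor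
      · rintro (⟨m, hm, h⟩ | h)
        exacts [⟨m, Or.inl hm, h⟩, ⟨n, Or.inr rfl, h⟩]
      · rintro ⟨m, hm | rfl, h⟩
        exacts [Or.inl ⟨m, hm, h⟩, Or.inr h]
  have hpickm : ∀ n S, MeasurableSet S.1 → MeasurableSet S.2 → MeasurableSet (pick n S) :=
    fun n S h1 h2 => .inter (hC.inter h1.compl) (.inter
      ((measurable_const_smul (e n) hY).inter (measurable_const_smul (e n) h2.compl))
      (measurableSet_le (hc.measurable _).abs measurable_const))
  have hstm : ∀ n, MeasurableSet (st n).1 ∧ MeasurableSet (st n).2 := by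
    intro n
    induction n with
    | zero => exact ⟨.empty, .empty⟩
    | succ n ih =>
      rw [hst]
      have := hpickm n _ ih.1 ih.2
      exact ⟨ih.1.union this, ih.2.union (measurable_const_smul (e n)⁻¹ this)⟩
  have hPm : ∀ n, MeasurableSet (P n) := fun n => hpickm n _ (hstm n).1 (hstm n).2
  have hDm : ∀ n, MeasurableSet (D n) := fun n => measurable_const_smul (e n)⁻¹ (hPm n)
  have hPC : ∀ n x, x ∈ P n → x ∈ C := fun n x hx => hx.1.1
  have hPY : ∀ n x, x ∈ P n → e n • x ∈ Y := fun n x hx => hx.2.1.1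
  have hPD : ∀ n x, x ∈ P n → e n • x ∈ D n := fun n x hx => by
    change (e n)⁻¹ • e n • x ∈ P n
    rwa [inv_smul_smul]
  have hDY : ∀ n x, x ∈ D n → x ∈ Y := fun n x hx => by
    have := hPY n _ hx
    rwa [smul_inv_smul] at this
  have hPdisj : Pairwise (Function.onFun Disjoint P) := by
    refine (pairwise_disjoint_on _).2 fun m n hmn => ?_
    rw [Set.disjoint_left]
    exact fun x hm hn => hn.1.2 ((hst1 n x).2 ⟨m, hmn, hm⟩)
  have hDdisj : Pairwise (Function.onFun Disjoint D) := by
    refine (pairwise_disjoint_on _).2 fun m n hmn => ?_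
    rw [Set.disjoint_left]
    intro x hm hn
    have hn' : (e n)⁻¹ • x ∈ P n := hn
    refine hn'.2.1.2 ?_
    rw [smul_inv_smul]
    exact (hst2 n x).2 ⟨m, hmn, hm⟩
  have hμD : ∀ n E, MeasurableSet E → μ (((e n)⁻¹ • · : X → X) ⁻¹' (E ∩ P n)) ≤ L * μ (E ∩ P n) :=
    fun n E hE => hc.measure_preimage_inv_le (hE.inter (hPm n)) fun x hx =>
      (abs_le.1 hx.2.2.2).2
  have hμP : ∀ n E, MeasurableSet E → μ ((e n • · : X → X) ⁻¹' (E ∩ D n)) ≤ L * μ (E ∩ D n) :=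
    fun n E hE => hc.measure_preimage_le (hE.inter (hDm n)) fun x hx => by
      have h1 : (e n)⁻¹ • e n • x ∈ P n := hx.2
      rw [inv_smul_smul] at h1
      have := (abs_le.1 h1.2.2).1
      linarith
  obtain ⟨f, hfm, hf⟩ := exists_measurable_piecewise P hPm (fun n x => e n • x)
    (fun n => measurable_const_smul (e n)) fun i j hij x hx =>
      absurd hx.2 (Set.disjoint_left.1 (hPdisj hij) hx.1)
  have hf' : ∀ n x, x ∈ P n → f x = e n • x := fun n x hx => hf n hx
  have hinj : Set.InjOn f (⋃ n, P n) := by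
    intro x hx y hy hxy
    obtain ⟨n, hn⟩ := Set.mem_iUnion.1 hx
    obtain ⟨m, hm⟩ := Set.mem_iUnion.1 hy
    rw [hf' n x hn, hf' m y hm] at hxy
    by_cases hnm : n = m
    · subst hnm
      exact smul_left_cancel _ hxy
    · exact absurd (hPD m y hm) (Set.disjoint_left.1 (hDdisj hnm) (hxy ▸ hPD n x hn))
  obtain ⟨θ, h1, h2, h3⟩ := exists_involution hfm (.iUnion hPm) hinj fun x hx h => by
    obtain ⟨n, hn⟩ := Set.mem_iUnion.1 hx
    obtain ⟨m, hm⟩ := Set.mem_iUnion.1 h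
    rw [hf' n x hn] at hm
    exact Set.disjoint_left.1 hCY (hPC m _ hm) (hPY n x hn)
  refine ⟨θ, h1, fun x => ?_, fun E hE => ?_, ?_⟩
  · have hRf : ∀ x ∈ ⋃ n, P n, R x (f x) := fun x hx => by
      obtain ⟨n, hn⟩ := Set.mem_iUnion.1 hx
      rw [hf' n x hn]
      exact hG.rel _ _
    rcases h3 x with h | ⟨hx, h⟩ | ⟨hx, h⟩
    · rw [h]
    · rw [h]; exact hRf x hx
    · have := hRf _ hx
      rw [h] at this
      exact R.symm this
  · let UP := ⋃ n, P n
    let UD := ⋃ n, D n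
    have hUP : MeasurableSet UP := .iUnion hPm
    have hUD : MeasurableSet UD := .iUnion hDm
    have hUPD : Disjoint UP UD := by
      rw [Set.disjoint_left]
      intro x hx hx'
      obtain ⟨n, hn⟩ := Set.mem_iUnion.1 hx
      obtain ⟨m, hm⟩ := Set.mem_iUnion.1 hx'
      exact Set.disjoint_left.1 hCY (hPC n x hn) (hDY m x hm)
    have hθP : ∀ n x, x ∈ P n → θ x = e n • x := fun n x hx =>
      (h2 x (Set.mem_iUnion.2 ⟨n, hx⟩)).trans (hf' n x hx)
    have hsub : θ ⁻¹' E ⊆ (⋃ n, (e n • · : X → X) ⁻¹' (E ∩ D n)) ∪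
        (⋃ n, ((e n)⁻¹ • · : X → X) ⁻¹' (E ∩ P n)) ∪ (E \ (UP ∪ UD)) := by
      intro x hx
      have hx' : θ x ∈ E := hx
      by_cases hxP : x ∈ UP
      · obtain ⟨n, hn⟩ := Set.mem_iUnion.1 hxP
        rw [hθP n x hn] at hx'
        exact Or.inl (Or.inl (Set.mem_iUnion.2 ⟨n, hx', hPD n x hn⟩))
      · by_cases hxD : x ∈ UD
        · obtain ⟨n, hn⟩ := Set.mem_iUnion.1 hxD
          have hn' : (e n)⁻¹ • x ∈ P n := hn
          have h4 : θ x = (e n)⁻¹ • x := by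
            have h5 := hθP n _ hn'
            rw [smul_inv_smul] at h5
            conv_lhs => rw [← h5]
            exact h1 _
          rw [h4] at hx'
          exact Or.inl (Or.inr (Set.mem_iUnion.2 ⟨n, hx', hn'⟩))
        · rcases h3 x with h | ⟨hx1, -⟩ | ⟨hx1, h⟩
          · rw [h] at hx'
            exact Or.inr ⟨hx', fun h => h.elim hxP hxD⟩
          · exact absurd hx1 hxP
          · obtain ⟨n, hn⟩ := Set.mem_iUnion.1 hx1
            rw [hf' n _ hn] at h
            exact absurd (Set.mem_iUnion.2 ⟨n, h ▸ hPD n _ hn⟩) hxD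
    have hsumP : ∑' n, μ (E ∩ P n) = μ (E ∩ UP) := by
      rw [Set.inter_iUnion, measure_iUnion (fun i j hij =>
        (hPdisj hij).mono Set.inter_subset_right Set.inter_subset_right)
        fun n => hE.inter (hPm n)]
    have hsumD : ∑' n, μ (E ∩ D n) = μ (E ∩ UD) := by
      rw [Set.inter_iUnion, measure_iUnion (fun i j hij =>
        (hDdisj hij).mono Set.inter_subset_right Set.inter_subset_right)
        fun n => hE.inter (hDm n)]
    calc μ (θ ⁻¹' E) ≤ ∑' n, μ ((e n • · : X → X) ⁻¹' (E ∩ D n)) +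
          ∑' n, μ (((e n)⁻¹ • · : X → X) ⁻¹' (E ∩ P n)) + μ (E \ (UP ∪ UD)) := by
          refine (measure_mono hsub).trans ((measure_union_le _ _).trans ?_)
          gcongr
          refine (measure_union_le _ _).trans ?_
          gcongr <;> exact measure_iUnion_le _
      _ ≤ ∑' n, L * μ (E ∩ D n) + ∑' n, L * μ (E ∩ P n) + L * μ (E \ (UP ∪ UD)) := by
          gcongr with n n
          · exact hμP n E hE
          · exact hμD n E hE
          · exact le_mul_of_one_le_left zero_le hL1
      _ = L * (μ (E ∩ UP) + μ (E ∩ UD) + μ (E \ (UP ∪ UD))) := by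
          rw [ENNReal.tsum_mul_left, ENNReal.tsum_mul_left, hsumP, hsumD]
          ring
      _ = L * μ E := by
          congr 1
          rw [← measure_union (hUPD.mono Set.inter_subset_right Set.inter_subset_right)
            (hE.inter hUD), ← Set.inter_union_distrib_left,
            measure_inter_add_sdiff E (hUP.union hUD)]
  -- The used part of `Y` has measure at most `e^K μ(C)`, so `hη` applies to the rest. An unmatched
  -- point of `C` would reach `Y'` by some `e n` within `K`, and stage `n` would have matched it.
  · let Y' := Y \ ⋃ n, D n
    have hY' : MeasurableSet Y' := hY.diff (.iUnion hDm)
    have hY's : μ Y'ᶜ ≤ η := by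
      refine le_trans ?_ hsmall
      have : Y'ᶜ ⊆ Yᶜ ∪ ⋃ n, D n := by
        intro x hx
        by_contra h
        simp only [Set.mem_union, Set.mem_compl_iff, not_or, not_not] at h
        exact hx h
      refine (measure_mono this).trans ((measure_union_le _ _).trans ?_)
      gcongr
      calc μ (⋃ n, D n) ≤ ∑' n, μ (D n) := measure_iUnion_le _
        _ ≤ ∑' n, L * μ (P n) := by
            gcongr with n
            simpa using hμD n Set.univ .univ
        _ = L * μ (⋃ n, P n) := by rw [ENNReal.tsum_mul_left, measure_iUnion hPdisj hPm]
        _ ≤ L * μ C := by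
            gcongr
            exact Set.iUnion_subset fun n x hx => hPC n x hx
    filter_upwards [hη Y' hY' hY's] with x ⟨g, hgY, hgK⟩ hxC
    obtain ⟨n, rfl⟩ := he g
    by_cases hx : x ∈ ⋃ n, P n
    · obtain ⟨m, hm⟩ := Set.mem_iUnion.1 hx
      rw [h2 x hx, hf' m x hm]
      exact hPY m x hm
    · suffices h : x ∈ P n from absurd (Set.mem_iUnion.2 ⟨n, h⟩) hx
      refine ⟨⟨hxC, fun h => ?_⟩, ⟨hgY.1, fun h => ?_⟩, hgK⟩
      · obtain ⟨m, -, hm⟩ := (hst1 n x).1 h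
        exact hx (Set.mem_iUnion.2 ⟨m, hm⟩)
      · obtain ⟨m, -, hm⟩ := (hst2 n _).1 h
        exact hgY.2 (Set.mem_iUnion.2 ⟨m, hm⟩)

/-- A set of small measure has many almost disjoint copies of controlled distortion. -/
theorem IsGeneratingAction.exists_disjoint_copies [StandardBorelSpace X]
    [Countable G] [MeasurableConstSMul G X] (hG : IsGeneratingAction R μ G)
    (hR : IsCountableNonsingular R μ)
    (hc : IsLogDeriv μ c) {η : ℝ≥0∞} {K : ℕ}
    (hη : ∀ Y, MeasurableSet Y → μ Yᶜ ≤ η → ∀ᵐ x ∂μ, x ∈ nb c Y K) {C : Set X}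
    (hC : MeasurableSet C) (N : ℕ)
    (hsmall : (1 + N * ENNReal.ofReal (Real.exp K)) * μ C ≤ η) :
    ∃ θ : ℕ → X ≃ᵐ X, (∀ i < N, (∀ x, θ i (θ i x) = x) ∧ (∀ x, R x (θ i x)) ∧
      DistortionLE μ (ENNReal.ofReal (Real.exp K)) (θ i)) ∧
      ∀ j < N, ∀ i < j, ∀ᵐ x ∂μ, ¬ (θ i x ∈ C ∧ θ j x ∈ C) := by
  induction N with
  | zero => exact ⟨fun _ => MeasurableEquiv.refl X, by simp, by simp⟩
  | succ N ih =>
    set L := ENNReal.ofReal (Real.exp K) with hL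
    obtain ⟨θ, h1, h2⟩ := ih (le_trans (by gcongr; simp) hsmall)
    -- The new involution sends `C` outside `V`, hence outside every earlier preimage of `C`; being
    -- an involution, its own preimage of `C` then avoids them.
    let V : Set X := C ∪ ⋃ i ∈ Finset.range N, θ i ⁻¹' C
    have hV : MeasurableSet V :=
      hC.union (Finset.measurableSet_biUnion _ fun i _ => (θ i).measurable hC)
    have hVs : μ V ≤ (1 + N * L) * μ C := by
      refine (measure_union_le _ _).trans ?_
      rw [add_mul, one_mul, mul_assoc]
      gcongr
      refine (measure_biUnion_finset_le _ _).trans ?_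
      calc ∑ i ∈ Finset.range N, μ (θ i ⁻¹' C) ≤ ∑ i ∈ Finset.range N, L * μ C :=
            Finset.sum_le_sum fun i hi => (h1 i (Finset.mem_range.1 hi)).2.2 C hC
        _ = N * (L * μ C) := by simp
    obtain ⟨τ, t1, t2, t3, t4⟩ := hG.exists_involution_into hc hη (Y := Vᶜ) hC hV.compl
      (Set.disjoint_compl_right_iff_subset.2 Set.subset_union_left) (by
        rw [compl_compl]
        refine le_trans ?_ hsmall
        calc μ V + L * μ C ≤ (1 + N * L) * μ C + L * μ C := by gcongr
          _ = (1 + (N + 1 : ℕ) * L) * μ C := by push_cast; ring)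
    refine ⟨fun i => if i < N then θ i else τ, fun i hi => ?_, fun j hj i hij => ?_⟩
    · by_cases hiN : i < N
      · simp only [hiN, if_true]; exact h1 i hiN
      · simp only [hiN, if_false]; exact ⟨t1, t2, t3⟩
    · by_cases hjN : j < N
      · simp only [hjN, hij.trans hjN, if_true]; exact h2 j hjN i hij
      · have hiN : i < N := by omega
        simp only [hjN, hiN, if_true, if_false]
        filter_upwards [(hR.quasiMeasurePreserving τ.measurable t2).ae t4] with x hx h
        have := hx h.2
        rw [t1] at this
        refine this (Or.inr ?_)
        simp only [Set.mem_iUnion, Finset.mem_range]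
        exact ⟨i, hiN, h.1⟩

end Packing

/-! ### Equivariant means are equal to the measure. -/

section Mean

variable {X : Type*} [MeasurableSpace X] {G : Type*} [Group G] [MulAction G X]
  {R : Setoid X} {μ : Measure X} {c : G → X → ℝ}

/-- The automorphisms of bounded distortion whose graph is contained in `R`. -/
def boundedGroup (R : Setoid X) (μ : Measure X) : Set (X ≃ᵐ X) :=
  {θ | (∀ x, R x (θ x)) ∧
    ∃ K : ℝ≥0∞, K ≠ ∞ ∧ DistortionLE μ K θ ∧ DistortionLE μ K θ.symm}

theorem IsGeneratingAction.smul_mem_boundedGroup [MeasurableConstSMul G X]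
    (hG : IsGeneratingAction R μ G) (g : G) : MeasurableEquiv.smul g ∈ boundedGroup R μ := by
  obtain ⟨K, hK, h1⟩ := hG.bounded g
  obtain ⟨L, hL, h2⟩ := hG.bounded g⁻¹
  refine ⟨fun x => hG.rel g x, max K L, by simp [hK, hL], fun E hE => ?_, fun E hE => ?_⟩
  · exact (h1 E hE).trans (by gcongr; exact le_max_left _ _)
  · exact (h2 E hE).trans (by gcongr; exact le_max_right _ _)

theorem mem_boundedGroup_of_involution {θ : X ≃ᵐ X} (h : ∀ x, θ (θ x) = x)
    (hRθ : ∀ x, R x (θ x)) {K : ℝ≥0∞} (hK : K ≠ ∞) (hd : DistortionLE μ K θ) :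
    θ ∈ boundedGroup R μ := by
  have : θ.symm = θ := MeasurableEquiv.ext (funext fun x => by
    rw [MeasurableEquiv.symm_apply_eq, h])
  exact ⟨hRθ, K, hK, hd, by rwa [this]⟩

/-- A finitely additive probability that is transported by the bounded automorphisms in the same
way as `μ`. -/
structure IsEquivariantMean (R : Setoid X) (μ : Measure X) (φ : Set X → ℝ) : Prop where
  nonneg : ∀ C, 0 ≤ φ C
  univ : φ Set.univ = 1
  union : ∀ C D, MeasurableSet C → MeasurableSet D → Disjoint C D → φ (C ∪ D) = φ C + φ D
  null : ∀ C, μ C = 0 → φ C = 0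
  transport : ∀ T ∈ boundedGroup R μ, ∀ C, MeasurableSet C → ∀ L : ℝ≥0∞, L ≠ ∞ →
    (∀ E ⊆ C, MeasurableSet E → μ (T ⁻¹' E) ≤ L * μ E) → φ (T ⁻¹' C) ≤ L.toReal * φ C

namespace IsEquivariantMean

variable {φ : Set X → ℝ}

theorem mono (hφ : IsEquivariantMean R μ φ) {C D : Set X} (hC : MeasurableSet C)
    (hD : MeasurableSet D) (h : C ⊆ D) : φ C ≤ φ D := by
  have := hφ.union C (D \ C) hC (hD.diff hC) Set.disjoint_sdiff_right
  rw [Set.union_sdiff_cancel h] at this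
  linarith [hφ.nonneg (D \ C)]

theorem sum_le_one (hφ : IsEquivariantMean R μ φ) {C : ℕ → Set X}
    (hC : ∀ i, MeasurableSet (C i)) (N : ℕ)
    (hd : ∀ j < N, ∀ i < j, μ (C i ∩ C j) = 0) : ∑ i ∈ Finset.range N, φ (C i) ≤ 1 := by
  have key : ∀ n ≤ N, ∑ i ∈ Finset.range n, φ (C i) = φ (⋃ i ∈ Finset.range n, C i) := by
    intro n hn
    induction n with
    | zero => simp [hφ.null ∅ (measure_empty)]
    | succ n ih =>
      have hU : MeasurableSet (⋃ i ∈ Finset.range n, C i) :=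
        Finset.measurableSet_biUnion _ fun i _ => hC i
      set U := ⋃ i ∈ Finset.range n, C i with hUdef
      have h1 : (⋃ i ∈ Finset.range (n + 1), C i) = U ∪ (C n \ U) := by
        rw [Set.union_sdiff_self, Finset.range_add_one, Finset.set_biUnion_insert, Set.union_comm]
      have h2 : φ (C n) = φ (C n ∩ U) + φ (C n \ U) := by
        rw [← hφ.union _ _ ((hC n).inter hU) ((hC n).diff hU)
          (Set.disjoint_sdiff_right.mono_left Set.inter_subset_right), Set.inter_union_sdiff]
      have h3 : φ (C n ∩ U) = 0 := by
        refine hφ.null _ ?_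
        rw [hUdef, Set.inter_iUnion₂]
        refine (measure_biUnion_null_iff (Finset.countable_toSet _)).2 fun i hi => ?_
        rw [Set.inter_comm]
        exact hd n hn i (Finset.mem_range.1 hi)
      rw [Finset.sum_range_succ, ih (by omega), h1,
        hφ.union _ _ hU ((hC n).diff hU) Set.disjoint_sdiff_right, h2, h3, zero_add]
  rw [key N le_rfl, ← hφ.univ]
  exact hφ.mono (Finset.measurableSet_biUnion _ fun i _ => hC i) .univ (Set.subset_univ _)

/-- Each of `N` almost disjoint copies of `C` carries at least `e^{-K} φ(C)`, and together they
carry at most `1`. As `K` does not depend on `N`, choosing `N > e^K / ε` suffices; the value of `δ`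
is what the packing of `N` copies requires. -/
theorem absolutelyContinuous [StandardBorelSpace X] [Countable G]
    [MeasurableConstSMul G X] (hφ : IsEquivariantMean R μ φ) (hG : IsGeneratingAction R μ G)
    (hR : IsCountableNonsingular R μ) (hc : IsLogDeriv μ c) {η : ℝ≥0∞} {K : ℕ} (hη0 : 0 < η)
    (hη : ∀ Y, MeasurableSet Y → μ Yᶜ ≤ η → ∀ᵐ x ∂μ, x ∈ nb c Y K) {ε : ℝ} (hε : 0 < ε) :
    ∃ δ : ℝ≥0∞, 0 < δ ∧ ∀ C, MeasurableSet C → μ C ≤ δ → φ C ≤ ε := by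
  set L := ENNReal.ofReal (Real.exp K) with hL
  have hLr : L.toReal = Real.exp K := ENNReal.toReal_ofReal (Real.exp_pos _).le
  obtain ⟨N, hN⟩ := exists_nat_gt (Real.exp K / ε)
  have hNpos : (0 : ℝ) < N := lt_trans (by positivity) hN
  have hden : 1 + (N : ℝ≥0∞) * L ≠ ∞ := by finiteness
  refine ⟨η / (1 + N * L), ENNReal.div_pos hη0.ne' hden, fun C hC hCs => ?_⟩
  obtain ⟨θ, h1, h2⟩ := hG.exists_disjoint_copies hR hc hη hC N (by
    calc (1 + N * L) * μ C ≤ (1 + N * L) * (η / (1 + N * L)) := by gcongr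
      _ ≤ η := ENNReal.mul_div_le)
  have h3 : ∀ i < N, φ C ≤ Real.exp K * φ (θ i ⁻¹' C) := by
    intro i hi
    obtain ⟨a1, a2, a3⟩ := h1 i hi
    have := hφ.transport (θ i) (mem_boundedGroup_of_involution a1 a2 ENNReal.ofReal_ne_top a3)
      (θ i ⁻¹' C) ((θ i).measurable hC) L ENNReal.ofReal_ne_top fun E _ hE => a3 E hE
    rwa [← Set.preimage_comp, show (θ i : X → X) ∘ θ i = id from funext a1, Set.preimage_id,
      hLr] at this
  have h4 := hφ.sum_le_one (C := fun i => θ i ⁻¹' C) (fun i => (θ i).measurable hC) N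
    fun j hj i hij => by
      rw [measure_eq_zero_iff_ae_notMem]
      exact h2 j hj i hij
  have h5 : N * φ C ≤ Real.exp K := by
    calc N * φ C = ∑ i ∈ Finset.range N, φ C := by simp
      _ ≤ ∑ i ∈ Finset.range N, Real.exp K * φ (θ i ⁻¹' C) :=
          Finset.sum_le_sum fun i hi => h3 i (Finset.mem_range.1 hi)
      _ = Real.exp K * ∑ i ∈ Finset.range N, φ (θ i ⁻¹' C) := by rw [Finset.mul_sum]
      _ ≤ Real.exp K * 1 := by gcongr
      _ = Real.exp K := mul_one _
  rw [div_lt_iff₀ hε] at hN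
  have h6 : N * φ C ≤ N * ε := h5.trans hN.le
  exact le_of_mul_le_mul_left h6 hNpos

/-- An absolutely continuous equivariant mean is countably additive. -/
theorem exists_measure [IsFiniteMeasure μ] (hφ : IsEquivariantMean R μ φ)
    (hac : ∀ ε : ℝ, 0 < ε → ∃ δ : ℝ≥0∞, 0 < δ ∧ ∀ C, MeasurableSet C → μ C ≤ δ → φ C ≤ ε) :
    ∃ ν : Measure X, ∀ C, MeasurableSet C → ν C = ENNReal.ofReal (φ C) := by
  refine ⟨Measure.ofMeasurable (fun C _ => ENNReal.ofReal (φ C))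
    (by rw [hφ.null ∅ measure_empty, ENNReal.ofReal_zero]) ?_, fun C hC =>
    Measure.ofMeasurable_apply C hC⟩
  intro f hf hd
  let tail : ℕ → Set X := fun n => ⋃ i, ⋃ _ : n ≤ i, f i
  have htm : ∀ n, MeasurableSet (tail n) := fun n => .iUnion fun i => .iUnion fun _ => hf i
  have hmem : ∀ n x, x ∈ tail n ↔ ∃ i, n ≤ i ∧ x ∈ f i := fun n x => by simp [tail]
  have hsucc : ∀ n, φ (tail n) = φ (f n) + φ (tail (n + 1)) := by
    intro n
    rw [← hφ.union _ _ (hf n) (htm _)]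
    · congr 1
      ext x
      rw [Set.mem_union, hmem, hmem]
      constructor
      · rintro ⟨i, hi, hx⟩
        rcases hi.eq_or_lt with rfl | h
        exacts [Or.inl hx, Or.inr ⟨i, h, hx⟩]
      · rintro (hx | ⟨i, hi, hx⟩)
        exacts [⟨n, le_rfl, hx⟩, ⟨i, by omega, hx⟩]
    · rw [Set.disjoint_left]
      intro x hx hx'
      obtain ⟨i, hi, hxi⟩ := (hmem _ _).1 hx'
      exact Set.disjoint_left.1 (hd (show n ≠ i by omega)) hx hxi
  have h0 : tail 0 = ⋃ i, f i := by simp [tail]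
  have hpart : ∀ n, ∑ i ∈ Finset.range n, φ (f i) = φ (⋃ i, f i) - φ (tail n) := by
    intro n
    induction n with
    | zero => simp [h0]
    | succ n ih => rw [Finset.sum_range_succ, ih, hsucc n]; ring
  have hanti : Antitone tail := fun n m hnm x hx => by
    obtain ⟨i, hi, hxi⟩ := (hmem _ _).1 hx
    exact (hmem _ _).2 ⟨i, hnm.trans hi, hxi⟩
  have hinter : ⋂ n, tail n = ∅ := by
    ext x
    simp only [Set.mem_iInter, Set.mem_empty_iff_false, iff_false]
    intro hx
    obtain ⟨i, -, hi⟩ := (hmem _ _).1 (hx 0)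
    obtain ⟨j, hj, hj'⟩ := (hmem _ _).1 (hx (i + 1))
    exact Set.disjoint_left.1 (hd (show i ≠ j by omega)) hi hj'
  have hμ : Tendsto (fun n => μ (tail n)) atTop (𝓝 0) := by
    rw [← measure_empty (μ := μ), ← hinter]
    exact tendsto_measure_iInter_atTop (fun n => (htm n).nullMeasurableSet) hanti
      ⟨0, measure_ne_top _ _⟩
  have hφt : Tendsto (fun n => φ (tail n)) atTop (𝓝 0) := by
    rw [Metric.tendsto_nhds]
    intro ε hε
    obtain ⟨δ, hδ, h⟩ := hac (ε / 2) (half_pos hε)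
    filter_upwards [ENNReal.tendsto_nhds_zero.1 hμ δ hδ] with n hn
    rw [Real.dist_eq, sub_zero, abs_of_nonneg (hφ.nonneg _)]
    linarith [h _ (htm n) hn]
  have hlim : Tendsto (fun n => ∑ i ∈ Finset.range n, ENNReal.ofReal (φ (f i))) atTop
      (𝓝 (ENNReal.ofReal (φ (⋃ i, f i)))) := by
    have h1 : Tendsto (fun n => ENNReal.ofReal (φ (⋃ i, f i) - φ (tail n))) atTop
        (𝓝 (ENNReal.ofReal (φ (⋃ i, f i) - 0))) :=
      ENNReal.tendsto_ofReal (tendsto_const_nhds.sub hφt)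
    rw [sub_zero] at h1
    refine h1.congr fun n => ?_
    rw [← hpart, ENNReal.ofReal_sum_of_nonneg fun i _ => hφ.nonneg _]
  exact tendsto_nhds_unique hlim (ENNReal.tendsto_nat_tsum _)

/-- An equivariant mean that is given by a measure equals `μ`, by ergodicity. -/
theorem eq_of_measure [IsProbabilityMeasure μ] [Countable G] [MeasurableConstSMul G X]
    (hφ : IsEquivariantMean R μ φ) (hG : IsGeneratingAction R μ G) (herg : IsErgodic R μ)
    (hc : IsLogDeriv μ c) {ν : Measure X}
    (hν : ∀ C, MeasurableSet C → ν C = ENNReal.ofReal (φ C)) : ν = μ := by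
  have hνp : IsProbabilityMeasure ν := ⟨by rw [hν _ .univ, hφ.univ, ENNReal.ofReal_one]⟩
  have hac : ν ≪ μ := Measure.AbsolutelyContinuous.mk fun C hC h0 => by
    rw [hν C hC, hφ.null C h0, ENNReal.ofReal_zero]
  set h := ν.rnDeriv μ with hh
  have hm : Measurable h := Measure.measurable_rnDeriv _ _
  have hset : ∀ C, MeasurableSet C → ∫⁻ x in C, h x ∂μ = ν C := fun C _ =>
    Measure.setLIntegral_rnDeriv hac C
  -- Ergodicity gives a `g` from the region of low density to that of high density. On a slice where
  -- `c g` lies in an interval of length `κ/2`, the two distortion estimates combine with the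
  -- density bounds to `ν(D) ≤ e^{-κ/2} ν(D)`, so each slice is null.
  have key : ∀ κ : ℝ, 0 < κ → μ {x | h x ≤ ENNReal.ofReal (Real.exp (-κ))} ≠ 0 →
      μ {x | 1 < h x} ≠ 0 → False := by
    intro κ hκ hlow hhigh
    have hlm : MeasurableSet {x | h x ≤ ENNReal.ofReal (Real.exp (-κ))} :=
      measurableSet_le hm measurable_const
    have hhm : MeasurableSet {x | 1 < h x} := measurableSet_lt measurable_const hm
    obtain ⟨g, hg⟩ := hG.exists_smul_inter herg hhm hlow hhigh
    let C : ℤ → Set X := fun j => {x | (h x ≤ ENNReal.ofReal (Real.exp (-κ)) ∧ 1 < h (g • x)) ∧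
      (j * (κ / 2) ≤ c g x ∧ c g x ≤ (j + 1) * (κ / 2))}
    have hCm : ∀ j, MeasurableSet (C j) := fun j =>
      (hlm.inter (measurable_const_smul g hhm)).inter
        ((measurableSet_le measurable_const (hc.measurable g)).inter
          (measurableSet_le (hc.measurable g) measurable_const))
    refine hg (measure_mono_null (t := ⋃ j, C j) ?_ (measure_iUnion_null fun j => ?_))
    · intro x hx
      refine Set.mem_iUnion.2 ⟨⌊c g x / (κ / 2)⌋, hx, ?_, ?_⟩
      · have := Int.floor_le (c g x / (κ / 2))
        rwa [le_div_iff₀ (half_pos hκ)] at this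
      · have := (Int.lt_floor_add_one (c g x / (κ / 2))).le
        rwa [div_le_iff₀ (half_pos hκ)] at this
    · let D : Set X := (g⁻¹ • · : X → X) ⁻¹' C j
      have hDm : MeasurableSet D := measurable_const_smul g⁻¹ (hCm j)
      have hCD : (g • · : X → X) ⁻¹' D = C j := by
        ext x
        simp [D]
      have e1 : μ (C j) ≤ ENNReal.ofReal (Real.exp (-(j * (κ / 2)))) * μ D := by
        rw [← hCD]
        refine hc.measure_preimage_le hDm fun x hx => ?_
        have hx' : x ∈ C j := by rw [← hCD]; exact hx
        linarith [hx'.2.1]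
      have e2 : ν D ≤ ENNReal.ofReal (Real.exp ((j + 1) * (κ / 2))) * ν (C j) := by
        have := hφ.transport (MeasurableEquiv.smul g⁻¹) (hG.smul_mem_boundedGroup g⁻¹) (C j) (hCm j)
          (ENNReal.ofReal (Real.exp ((j + 1) * (κ / 2)))) ENNReal.ofReal_ne_top
          fun E hE hEm => hc.measure_preimage_inv_le hEm fun x hx => (hE hx).2.2
        rw [hν D hDm, hν _ (hCm j), ← ENNReal.ofReal_mul (Real.exp_pos _).le]
        refine ENNReal.ofReal_le_ofReal ?_
        rwa [ENNReal.toReal_ofReal (Real.exp_pos _).le] at this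
      have e3 : ν (C j) ≤ ENNReal.ofReal (Real.exp (-κ)) * μ (C j) := by
        rw [← hset _ (hCm j), ← setLIntegral_const]
        exact setLIntegral_mono measurable_const fun x hx => hx.1.1
      have e4 : μ D ≤ ν D := by
        rw [← hset _ hDm, ← setLIntegral_one]
        refine setLIntegral_mono hm fun x hx => ?_
        have : 1 < h (g • (g⁻¹ • x)) := hx.1.2
        rw [smul_inv_smul] at this
        exact this.le
      have e5 : ν D ≤ ENNReal.ofReal (Real.exp (-(κ / 2))) * ν D := by
        calc ν D ≤ ENNReal.ofReal (Real.exp ((j + 1) * (κ / 2))) *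
              (ENNReal.ofReal (Real.exp (-κ)) *
                (ENNReal.ofReal (Real.exp (-(j * (κ / 2)))) * ν D)) := by
              refine e2.trans ?_
              gcongr
              refine e3.trans ?_
              gcongr
              refine e1.trans ?_
              gcongr
          _ = ENNReal.ofReal (Real.exp (-(κ / 2))) * ν D := by
              rw [← mul_assoc, ← mul_assoc, ← ENNReal.ofReal_mul (Real.exp_pos _).le,
                ← ENNReal.ofReal_mul (by positivity), ← Real.exp_add, ← Real.exp_add]
              congr 3
              ring
      have e6 : ν D = 0 := by
        by_contra hne
        have h1 : ENNReal.ofReal (Real.exp (-(κ / 2))) < 1 := by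
          rw [← ENNReal.ofReal_one]
          exact (ENNReal.ofReal_lt_ofReal_iff one_pos).2 ((Real.exp_lt_exp.2 (by linarith)).trans_eq Real.exp_zero)
        have h2 := ENNReal.mul_lt_mul_left hne (measure_ne_top ν D) h1
        rw [one_mul] at h2
        exact absurd e5 (not_le.2 h2)
      have e7 : μ D = 0 := le_antisymm (e4.trans e6.le) zero_le
      rw [e7, mul_zero] at e1
      exact le_antisymm e1 zero_le
  -- By `key`, either `h ≤ 1` or `h ≥ 1` almost everywhere; equal total masses turn the inequality
  -- of measures into equality.
  by_cases hhigh : μ {x | 1 < h x} = 0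
  · have hle : ∀ᵐ x ∂μ, h x ≤ 1 := by
      filter_upwards [measure_eq_zero_iff_ae_notMem.1 hhigh] with x hx using not_lt.1 hx
    refine Measure.eq_of_le_of_measure_univ_eq ?_ (by simp)
    refine Measure.le_intro fun C hC _ => ?_
    rw [← hset C hC, ← setLIntegral_one]
    exact lintegral_mono_ae (ae_restrict_of_ae hle)
  · have hge : ∀ᵐ x ∂μ, 1 ≤ h x := by
      have h1 : ∀ n : ℕ, ∀ᵐ x ∂μ, ¬ h x ≤ ENNReal.ofReal (Real.exp (-(1 / ((n : ℝ) + 1)))) := by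
        intro n
        by_contra hne
        exact key _ (by positivity) (fun h0 => hne (measure_eq_zero_iff_ae_notMem.1 h0)) hhigh
      filter_upwards [ae_all_iff.2 h1] with x hx
      have hlim : Tendsto (fun n : ℕ => ENNReal.ofReal (Real.exp (-(1 / ((n : ℝ) + 1))))) atTop
          (𝓝 (ENNReal.ofReal (Real.exp (-0)))) :=
        ENNReal.tendsto_ofReal ((Real.continuous_exp.tendsto _).comp
          tendsto_one_div_add_atTop_nhds_zero_nat.neg)
      rw [neg_zero, Real.exp_zero, ENNReal.ofReal_one] at hlim
      exact le_of_tendsto' hlim fun n => (not_le.1 (hx n)).le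
    refine (Measure.eq_of_le_of_measure_univ_eq ?_ (by simp)).symm
    refine Measure.le_intro fun C hC _ => ?_
    rw [← hset C hC, ← setLIntegral_one]
    exact lintegral_mono_ae (ae_restrict_of_ae hge)

end IsEquivariantMean

end Mean

/-! ### Almost invariant sets are almost independent of a given set. -/

section Equidistribution

variable {X : Type*} [MeasurableSpace X] {G : Type*} [Group G] [MulAction G X]
  {R : Setoid X} {μ : Measure X} {c : G → X → ℝ}

/-- Sets that are almost invariant under enough bounded automorphisms, relative to their measure,
are almost independent of a given set. -/
theorem IsGeneratingAction.exists_equidistribution [StandardBorelSpace X] [Countable G]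
    [IsProbabilityMeasure μ] [MeasurableConstSMul G X] (hG : IsGeneratingAction R μ G)
    (hR : IsCountableNonsingular R μ) (herg : IsErgodic R μ) (hc : IsLogDeriv μ c) {η : ℝ≥0∞}
    {K : ℕ} (hη0 : 0 < η)
    (hη : ∀ Y, MeasurableSet Y → μ Yᶜ ≤ η → ∀ᵐ x ∂μ, x ∈ nb c Y K) {A : Set X}
    (hA : MeasurableSet A) {ε : ℝ} (hε : 0 < ε) :
    ∃ F : Finset (X ≃ᵐ X), (↑F ⊆ boundedGroup R μ) ∧ ∃ ε' : ℝ, 0 < ε' ∧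
      ∀ B, MeasurableSet B → μ B ≠ 0 → (∀ θ ∈ F, μ.real (moved θ B) ≤ ε' * μ.real B) →
        |μ.real (A ∩ B) - μ.real A * μ.real B| ≤ ε * μ.real B := by
  classical
  by_contra! hcon
  -- Counterexamples are indexed by finite families and tolerances. Along an ultrafilter finer than
  -- `atTop` their relative displacement under each bounded automorphism tends to zero.
  let I := Finset (boundedGroup R μ) × ℕ
  have hpos : ∀ n : ℕ, (0 : ℝ) < 1 / ((n : ℝ) + 1) := fun n => by positivity
  choose B hBm hB0 hB hBA using fun i : I => hcon (i.1.map (Function.Embedding.subtype _))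
    (by simp) (1 / ((i.2 : ℝ) + 1)) (hpos i.2)
  have hBr : ∀ i, 0 < μ.real (B i) := fun i =>
    ENNReal.toReal_pos (hB0 i) (measure_ne_top _ _)
  let m : I → Set X → ℝ := fun i C => μ.real (C ∩ B i) / μ.real (B i)
  have hm0 : ∀ i C, 0 ≤ m i C := fun i C => by positivity
  have hm1 : ∀ i C, m i C ≤ 1 := fun i C =>
    div_le_one_of_le₀ (measureReal_mono Set.inter_subset_right) (hBr i).le
  let U : Ultrafilter I := Ultrafilter.of atTop
  have hU : (U : Filter I) ≤ atTop := Ultrafilter.of_le atTop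
  have hlim : ∀ C, ∃ a, Tendsto (fun i => m i C) U (𝓝 a) := by
    intro C
    obtain ⟨a, -, ha⟩ := (isCompact_Icc (a := (0 : ℝ)) (b := 1)).ultrafilter_le_nhds
      (U.map fun i => m i C) (by
        rw [le_principal_iff]
        exact Filter.univ_mem' (f := (U : Filter I)) fun i => ⟨hm0 i C, hm1 i C⟩)
    exact ⟨a, ha⟩
  choose φ hφ using hlim
  have hmean : IsEquivariantMean R μ φ := by
    refine ⟨fun C => ge_of_tendsto' (hφ C) fun i => hm0 i C, ?_, fun C D hC hD hCD => ?_,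
      fun C hC => ?_, fun T hT C hC L hL hTC => ?_⟩
    · refine tendsto_nhds_unique (hφ Set.univ) (tendsto_const_nhds.congr fun i => ?_)
      simp only [m, Set.univ_inter]
      exact (div_self (hBr i).ne').symm
    · refine tendsto_nhds_unique (hφ (C ∪ D)) (((hφ C).add (hφ D)).congr fun i => ?_)
      simp only [m]
      rw [Set.union_inter_distrib_right, measureReal_union
        (hCD.mono Set.inter_subset_left Set.inter_subset_left) (hD.inter (hBm i)), add_div]
    · refine tendsto_nhds_unique (hφ C) (tendsto_const_nhds.congr fun i => ?_)
      have : μ.real (C ∩ B i) = 0 := by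
        rw [measureReal_def, measure_mono_null Set.inter_subset_left hC, ENNReal.toReal_zero]
      simp only [m, this, zero_div]
    · have hr : Tendsto (fun i => μ.real (moved T (B i)) / μ.real (B i)) U (𝓝 0) := by
        refine Tendsto.mono_left ?_ hU
        have h1 : Tendsto (fun i : I => 1 / ((i.2 : ℝ) + 1)) atTop (𝓝 0) :=
          tendsto_one_div_add_atTop_nhds_zero_nat.comp
            (prod_atTop_atTop_eq (α := Finset (boundedGroup R μ)) (β := ℕ) ▸ tendsto_snd)
        refine tendsto_of_tendsto_of_tendsto_of_le_of_le' tendsto_const_nhds h1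
          (Eventually.of_forall fun i => by positivity) ?_
        filter_upwards [eventually_ge_atTop (({⟨T, hT⟩}, 0) : I)] with i hi
        rw [div_le_iff₀ (hBr i)]
        refine hB i T ?_
        have hTi : (⟨T, hT⟩ : boundedGroup R μ) ∈ i.1 := hi.1 (Finset.mem_singleton_self _)
        exact Finset.mem_map.2 ⟨_, hTi, rfl⟩
      have h2 := ((hφ C).const_mul L.toReal).add hr
      rw [add_zero] at h2
      refine le_of_tendsto_of_tendsto' (hφ _) h2 fun i => ?_
      simp only [m]
      rw [← mul_div_assoc, ← add_div]
      gcongr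
      -- Transport passes to the limit because `B i` differs from its preimage only in `moved T (B
      -- i)`, whose relative measure vanishes.
      have hsub : T ⁻¹' C ∩ B i ⊆ T ⁻¹' (C ∩ B i) ∪ moved T (B i) := by
        intro x hx
        by_cases h : T x ∈ B i
        · exact Or.inl ⟨hx.1, h⟩
        · exact Or.inr fun hiff => h (hiff.2 hx.2)
      calc μ.real (T ⁻¹' C ∩ B i) ≤ μ.real (T ⁻¹' (C ∩ B i)) + μ.real (moved T (B i)) :=
            (measureReal_mono hsub).trans (measureReal_union_le _ _)
        _ ≤ L.toReal * μ.real (C ∩ B i) + μ.real (moved T (B i)) := by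
            gcongr
            rw [measureReal_def, measureReal_def, ← ENNReal.toReal_mul]
            exact ENNReal.toReal_mono (ENNReal.mul_ne_top hL (measure_ne_top _ _))
              (hTC _ Set.inter_subset_left (hC.inter (hBm i)))
  obtain ⟨ν, hν⟩ := hmean.exists_measure fun ε hε =>
    hmean.absolutelyContinuous hG hR hc hη0 hη hε
  have hνμ := hmean.eq_of_measure hG herg hc hν
  have hφA : φ A = μ.real A := by
    have := hν A hA
    rw [hνμ] at this
    rw [measureReal_def, this, ENNReal.toReal_ofReal (hmean.nonneg A)]
  have hA' := hφ A
  rw [hφA] at hA'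
  obtain ⟨i, hi⟩ := (Metric.tendsto_nhds.1 hA' ε hε).exists
  have h1 := hBA i
  rw [Real.dist_eq] at hi
  have h2 : μ.real (A ∩ B i) - μ.real A * μ.real (B i) = (m i A - μ.real A) * μ.real (B i) := by
    simp only [m]
    rw [sub_mul, div_mul_cancel₀ _ (hBr i).ne']
  rw [h2, abs_mul, abs_of_pos (hBr i)] at h1
  have := lt_of_mul_lt_mul_right h1 (hBr i).le
  linarith

end Equidistribution

/-! ### Coarea formula and Cheeger's inequality. -/

section LevelSets

variable {X : Type*} [MeasurableSpace X] {μ : Measure X}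

/-- Coarea formula: the `L¹`-displacement of `u` is the integral of the displacements of its level
sets. -/
theorem lintegral_abs_comp_sub [SFinite μ] {u : X → ℝ} (hu : Measurable u) (hu0 : ∀ x, 0 ≤ u x)
    {T : X → X} (hT : Measurable T) :
    ∫⁻ x, ENNReal.ofReal |u (T x) - u x| ∂μ = ∫⁻ t in Set.Ioi (0 : ℝ), μ (moved T {x | t < u x}) := by
  -- The slices found below are half-open intervals that may contain `0`.
  have hr : (volume : Measure ℝ).restrict (Set.Ioi 0) = volume.restrict (Set.Ici 0) :=
    Measure.restrict_congr_set Ioi_ae_eq_Ici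
  let S : Set (X × ℝ) := {p | ¬ (p.2 < u (T p.1) ↔ p.2 < u p.1)}
  have hS : MeasurableSet S := by
    have : S = {p : X × ℝ | p.2 < u (T p.1)} ∆ {p : X × ℝ | p.2 < u p.1} := by
      ext p
      simp only [S, Set.mem_ofPred_eq, Set.mem_symmDiff]
      tauto
    rw [this]
    exact (measurableSet_lt measurable_snd ((hu.comp hT).comp measurable_fst)).symmDiff
      (measurableSet_lt measurable_snd (hu.comp measurable_fst))
  have h1 := Measure.prod_apply (μ := μ) (ν := (volume : Measure ℝ).restrict (Set.Ioi 0)) hS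
  have h2 := Measure.prod_apply_symm (μ := μ) (ν := (volume : Measure ℝ).restrict (Set.Ioi 0)) hS
  refine Eq.trans ?_ (h1.symm.trans h2)
  congr 1
  ext x
  have hx : (Prod.mk x ⁻¹' S) ∩ Set.Ici 0 = Set.Ico (min (u (T x)) (u x)) (max (u (T x)) (u x)) := by
    ext t
    have ha := hu0 (T x)
    have hb := hu0 x
    simp only [S, Set.mem_inter_iff, Set.mem_preimage, Set.mem_ofPred_eq, Set.mem_Ici, Set.mem_Ico,
      min_le_iff, lt_max_iff]
    constructor
    · rintro ⟨h, -⟩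
      by_cases h1 : t < u (T x)
      · by_cases h2 : t < u x
        · exact absurd ⟨fun _ => h2, fun _ => h1⟩ h
        · exact ⟨Or.inr (not_lt.1 h2), Or.inl h1⟩
      · by_cases h2 : t < u x
        · exact ⟨Or.inl (not_lt.1 h1), Or.inr h2⟩
        · exact absurd ⟨fun h => absurd h h1, fun h => absurd h h2⟩ h
    · rintro ⟨h | h, h' | h'⟩
      · exact absurd h' (not_lt.2 h)
      · exact ⟨fun hiff => absurd (hiff.2 h') (not_lt.2 h), ha.trans h⟩
      · exact ⟨fun hiff => absurd (hiff.1 h') (not_lt.2 h), hb.trans h⟩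
      · exact absurd h' (not_lt.2 h)
  rw [hr, Measure.restrict_apply (measurable_prodMk_left hS), hx, Real.volume_Ico,
    max_sub_min_eq_abs']

variable {ι : Type*} [Fintype ι] {T : ι → X → X} {ε : ℝ}

/-- Expansion is integrated over the level sets `{t < u}`, `t > 0`, with the layer cake formula on
the left and the coarea formula on the right. -/
theorem lintegral_le_sum_lintegral_abs [SFinite μ] (hT : ∀ k, Measurable (T k))
    (hexp : ∀ B, MeasurableSet B → μ B ≤ 1 / 2 →
      ENNReal.ofReal ε * μ B ≤ ∑ k, μ (moved (T k) B))
    {u : X → ℝ} (hu : Measurable u) (hu0 : ∀ x, 0 ≤ u x) (hsupp : μ {x | 0 < u x} ≤ 1 / 2) :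
    ENNReal.ofReal ε * ∫⁻ x, ENNReal.ofReal (u x) ∂μ ≤
      ∑ k, ∫⁻ x, ENNReal.ofReal |u (T k x) - u x| ∂μ := by
  have hlev : ∀ t, MeasurableSet {x | t < u x} := fun t => measurableSet_lt measurable_const hu
  have hmm : ∀ k, Measurable fun t : ℝ => μ (moved (T k) {x | t < u x}) := by
    intro k
    have hS : MeasurableSet {p : ℝ × X | ¬ (p.1 < u (T k p.2) ↔ p.1 < u p.2)} := by
      have : {p : ℝ × X | ¬ (p.1 < u (T k p.2) ↔ p.1 < u p.2)} =
          {p : ℝ × X | p.1 < u (T k p.2)} ∆ {p : ℝ × X | p.1 < u p.2} := by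
        ext p
        simp only [Set.mem_ofPred_eq, Set.mem_symmDiff]
        tauto
      rw [this]
      exact (measurableSet_lt measurable_fst ((hu.comp (hT k)).comp measurable_snd)).symmDiff
        (measurableSet_lt measurable_fst (hu.comp measurable_snd))
    exact measurable_measure_prodMk_left hS
  simp only [lintegral_abs_comp_sub hu hu0 (hT _)]
  rw [lintegral_eq_lintegral_meas_lt μ (ae_of_all _ hu0) hu.aemeasurable,
    ← lintegral_const_mul' _ _ ENNReal.ofReal_ne_top, ← lintegral_finsetSum _ fun k _ => hmm k]
  refine setLIntegral_mono' measurableSet_Ioi fun t ht => hexp _ (hlev t) ?_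
  refine (measure_mono ?_).trans hsupp
  intro x (hx : t < u x)
  exact lt_trans (Set.mem_Ioi.1 ht) hx

/-- From `|a² - b²| ≤ |a - b|(|a - b| + 2|b|)` and Young's inequality. A large `s` makes the `b²`
term small enough to be absorbed later. -/
theorem abs_sq_sub_sq_le {s : ℝ} (hs : 0 < s) (a b : ℝ) :
    |a ^ 2 - b ^ 2| ≤ (1 + s) * (a - b) ^ 2 + s⁻¹ * b ^ 2 := by
  have h1 : |a ^ 2 - b ^ 2| = |a - b| * |a + b| := by rw [← abs_mul]; ring_nf
  have h2 : |a + b| ≤ |a - b| + 2 * |b| := by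
    have : a + b = (a - b) + 2 * b := by ring
    rw [this]
    exact (abs_add_le _ _).trans (by rw [abs_mul, abs_two])
  have h3 : 2 * (|a - b| * |b|) ≤ s * |a - b| ^ 2 + s⁻¹ * |b| ^ 2 := by
    have h4 : 0 ≤ s⁻¹ * (s * |a - b| - |b|) ^ 2 := by positivity
    have h5 : s⁻¹ * (s * |a - b| - |b|) ^ 2 =
        s * |a - b| ^ 2 + s⁻¹ * |b| ^ 2 - 2 * (|a - b| * |b|) := by
      field_simp
      ring
    linarith
  rw [sq_abs, sq_abs] at h3
  have h6 : |a - b| * |a + b| ≤ |a - b| * (|a - b| + 2 * |b|) := by gcongr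
  have h7 : |a - b| * |a - b| = (a - b) ^ 2 := by rw [← abs_mul, abs_mul_self]; ring
  rw [h1]
  nlinarith

/-- The spectral gap constant obtained from the expansion constant `ε` of `n` maps. -/
noncomputable def gapConst (n : ℕ) (ε : ℝ) : ℝ := 2 / ε * (1 + 2 * (n + 1) / ε)

theorem gapConst_pos {n : ℕ} (hε : 0 < ε) : 0 < gapConst n ε := by
  unfold gapConst; positivity

/-- Cheeger's inequality for nonnegative functions of small support. -/
theorem lintegral_sq_le_of_small_support [SFinite μ] (hε : 0 < ε) (hT : ∀ k, Measurable (T k))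
    (hexp : ∀ B, MeasurableSet B → μ B ≤ 1 / 2 →
      ENNReal.ofReal ε * μ B ≤ ∑ k, μ (moved (T k) B))
    {g : X → ℝ} (hg : Measurable g) (hg0 : ∀ x, 0 ≤ g x) (hsupp : μ {x | 0 < g x} ≤ 1 / 2)
    (hfin : ∫⁻ x, ENNReal.ofReal (g x ^ 2) ∂μ ≠ ∞) :
    ∫⁻ x, ENNReal.ofReal (g x ^ 2) ∂μ ≤ ENNReal.ofReal (gapConst (Fintype.card ι) ε) *
      ∑ k, ∫⁻ x, ENNReal.ofReal ((g (T k x) - g x) ^ 2) ∂μ := by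
  set J := ∫⁻ x, ENNReal.ofReal (g x ^ 2) ∂μ with hJ
  set n := Fintype.card ι with hn
  -- Makes `n s⁻¹ ≤ ε/2`, so half of the left side absorbs the error, `J` being finite. Using `n +
  -- 1` keeps `s` positive when `n = 0`.
  set s : ℝ := 2 * (n + 1) / ε with hsdef
  have hs : 0 < s := by positivity
  have hsupp' : μ {x | 0 < g x ^ 2} ≤ 1 / 2 := by
    refine (measure_mono fun x hx => ?_).trans hsupp
    have hx' : 0 < g x ^ 2 := hx
    exact lt_of_le_of_ne (hg0 x) fun h => by rw [← h] at hx'; norm_num at hx'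
  have h1 := lintegral_le_sum_lintegral_abs hT hexp (hg.pow_const 2) (fun x => sq_nonneg _) hsupp'
  have h2 : ∀ k, ∫⁻ x, ENNReal.ofReal |g (T k x) ^ 2 - g x ^ 2| ∂μ ≤
      ENNReal.ofReal (1 + s) * ∫⁻ x, ENNReal.ofReal ((g (T k x) - g x) ^ 2) ∂μ +
        ENNReal.ofReal s⁻¹ * J := by
    intro k
    have hmk : Measurable fun x => ENNReal.ofReal ((g (T k x) - g x) ^ 2) :=
      (((hg.comp (hT k)).sub hg).pow_const 2).ennreal_ofReal
    rw [hJ, ← lintegral_const_mul' _ _ ENNReal.ofReal_ne_top,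
      ← lintegral_const_mul' _ _ ENNReal.ofReal_ne_top, ← lintegral_add_left (hmk.const_mul _)]
    refine lintegral_mono fun x => ?_
    rw [← ENNReal.ofReal_mul (by positivity), ← ENNReal.ofReal_mul (by positivity),
      ← ENNReal.ofReal_add (by positivity) (by positivity)]
    exact ENNReal.ofReal_le_ofReal (abs_sq_sub_sq_le hs _ _)
  set S := ∑ k, ∫⁻ x, ENNReal.ofReal ((g (T k x) - g x) ^ 2) ∂μ with hS
  have h3 : ENNReal.ofReal ε * J ≤ ENNReal.ofReal (1 + s) * S + ENNReal.ofReal (ε / 2) * J := by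
    refine h1.trans ((Finset.sum_le_sum fun k _ => h2 k).trans ?_)
    rw [Finset.sum_add_distrib, ← Finset.mul_sum, Finset.sum_const, Finset.card_univ, ← hn,
      nsmul_eq_mul, ← mul_assoc]
    gcongr
    rw [← ENNReal.ofReal_natCast, ← ENNReal.ofReal_mul (by positivity)]
    refine ENNReal.ofReal_le_ofReal ?_
    rw [hsdef, inv_div, mul_div_assoc', div_le_div_iff₀ (by positivity) (by positivity)]
    nlinarith
  have h4 : ENNReal.ofReal ε * J = ENNReal.ofReal (ε / 2) * J + ENNReal.ofReal (ε / 2) * J := by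
    rw [← add_mul, ← ENNReal.ofReal_add (by positivity) (by positivity), add_halves]
  rw [h4] at h3
  have h5 : ENNReal.ofReal (ε / 2) * J ≤ ENNReal.ofReal (1 + s) * S :=
    ENNReal.le_of_add_le_add_right (ENNReal.mul_ne_top ENNReal.ofReal_ne_top hfin) h3
  calc J = ENNReal.ofReal (2 / ε) * (ENNReal.ofReal (ε / 2) * J) := by
        rw [← mul_assoc, ← ENNReal.ofReal_mul (by positivity),
          show 2 / ε * (ε / 2) = 1 by field_simp, ENNReal.ofReal_one, one_mul]
    _ ≤ ENNReal.ofReal (2 / ε) * (ENNReal.ofReal (1 + s) * S) := by gcongr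
    _ = ENNReal.ofReal (gapConst n ε) * S := by
        rw [← mul_assoc, ← ENNReal.ofReal_mul (by positivity)]
        rfl

/-- The supremum of all `t` with `μ {f < t} ≤ 1/2` works. Both parts of `f - a` then have support of
measure at most `1/2`, as Cheeger's argument needs. -/
theorem exists_median [IsProbabilityMeasure μ] {f : X → ℝ} (hf : Measurable f) :
    ∃ a : ℝ, μ {x | a < f x} ≤ 1 / 2 ∧ μ {x | f x < a} ≤ 1 / 2 := by
  let S : Set ℝ := {t | μ {x | f x < t} ≤ 1 / 2}
  have hlt : ∀ t, MeasurableSet {x | f x < t} := fun t => measurableSet_lt hf measurable_const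
  have hdown : ∀ t ∈ S, ∀ s ≤ t, s ∈ S := fun t ht s hst =>
    (measure_mono fun x (hx : f x < s) => hx.trans_le hst).trans ht
  have hne : S.Nonempty := by
    have h1 : Tendsto (fun n : ℕ => μ {x | f x < -(n : ℝ)}) atTop (𝓝 0) := by
      have : ⋂ n : ℕ, {x | f x < -(n : ℝ)} = ∅ := by
        ext x
        simp only [Set.mem_iInter, Set.mem_ofPred_eq, Set.mem_empty_iff_false, iff_false, not_forall,
          not_lt]
        obtain ⟨n, hn⟩ := exists_nat_ge (-f x)
        exact ⟨n, by linarith⟩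
      rw [← measure_empty (μ := μ), ← this]
      refine tendsto_measure_iInter_atTop (fun n => (hlt _).nullMeasurableSet) ?_
        ⟨0, measure_ne_top _ _⟩
      intro n m hnm x (hx : f x < -(m : ℝ))
      have : (n : ℝ) ≤ m := by exact_mod_cast hnm
      exact lt_of_lt_of_le hx (by linarith)
    obtain ⟨n, hn⟩ := (ENNReal.tendsto_nhds_zero.1 h1 (1 / 2) (by simp)).exists
    exact ⟨_, hn⟩
  have hbdd : BddAbove S := by
    have h1 : Tendsto (fun n : ℕ => μ {x | f x < (n : ℝ)}) atTop (𝓝 1) := by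
      have : ⋃ n : ℕ, {x | f x < (n : ℝ)} = Set.univ := by
        ext x
        simp only [Set.mem_iUnion, Set.mem_ofPred_eq, Set.mem_univ, iff_true]
        exact exists_nat_gt (f x)
      rw [← measure_univ (μ := μ), ← this]
      refine tendsto_measure_iUnion_atTop fun n m hnm x (hx : f x < (n : ℝ)) => ?_
      exact hx.trans_le (by exact_mod_cast hnm)
    have h2 : (1 / 2 : ℝ≥0∞) < 1 := by simp
    obtain ⟨n, hn⟩ := (h1.eventually (lt_mem_nhds h2)).exists
    refine ⟨n, fun t ht => ?_⟩
    by_contra! hlt'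
    exact absurd (hdown t ht n hlt'.le) (not_le.2 hn)
  have hseq : ∀ n : ℕ, (0 : ℝ) < 1 / ((n : ℝ) + 1) := fun n => by positivity
  have hanti : ∀ {n m : ℕ}, n ≤ m → 1 / ((m : ℝ) + 1) ≤ 1 / ((n : ℝ) + 1) := fun {n m} hnm =>
    one_div_le_one_div_of_le (by positivity) (by
      have : (n : ℝ) ≤ m := by exact_mod_cast hnm
      linarith)
  refine ⟨sSup S, ?_, ?_⟩
  · have h1 : {x | sSup S < f x} = ⋃ n : ℕ, {x | sSup S + 1 / ((n : ℝ) + 1) ≤ f x} := by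
      ext x
      simp only [Set.mem_ofPred_eq, Set.mem_iUnion]
      constructor
      · intro h
        obtain ⟨n, hn⟩ := exists_nat_one_div_lt (sub_pos.2 h)
        exact ⟨n, by linarith⟩
      · rintro ⟨n, hn⟩
        linarith [hseq n]
    rw [h1, Monotone.measure_iUnion]
    · refine iSup_le fun n => ?_
      have h2 : sSup S + 1 / ((n : ℝ) + 1) ∉ S := fun h => by
        have := le_csSup hbdd h
        linarith [hseq n]
      have h3 : 1 / 2 < μ {x | f x < sSup S + 1 / ((n : ℝ) + 1)} := not_le.1 h2
      have h4 : {x | sSup S + 1 / ((n : ℝ) + 1) ≤ f x} =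
          {x | f x < sSup S + 1 / ((n : ℝ) + 1)}ᶜ := by
        ext x; simp
      rw [h4, prob_compl_eq_one_sub (hlt _)]
      refine (tsub_le_tsub_left h3.le 1).trans ?_
      rw [one_div, ENNReal.one_sub_inv_two]
    · intro n m hnm x (hx : _ ≤ f x)
      exact le_trans (by linarith [hanti hnm]) hx
  · have h1 : {x | f x < sSup S} = ⋃ n : ℕ, {x | f x < sSup S - 1 / ((n : ℝ) + 1)} := by
      ext x
      simp only [Set.mem_ofPred_eq, Set.mem_iUnion]
      constructor
      · intro h
        obtain ⟨n, hn⟩ := exists_nat_one_div_lt (sub_pos.2 h)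
        exact ⟨n, by linarith⟩
      · rintro ⟨n, hn⟩
        linarith [hseq n]
    rw [h1, Monotone.measure_iUnion]
    · refine iSup_le fun n => ?_
      obtain ⟨t, ht, hlt'⟩ := exists_lt_of_lt_csSup hne (sub_lt_self (sSup S) (hseq n))
      exact hdown t ht _ hlt'.le
    · intro n m hnm x (hx : f x < _)
      exact lt_of_lt_of_le hx (by linarith [hanti hnm])

/-- Cheeger's inequality for real functions. -/
theorem exists_lintegral_sq_sub_le [IsProbabilityMeasure μ] (hε : 0 < ε)
    (hT : ∀ k, Measurable (T k))
    (hexp : ∀ B, MeasurableSet B → μ B ≤ 1 / 2 →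
      ENNReal.ofReal ε * μ B ≤ ∑ k, μ (moved (T k) B))
    {f : X → ℝ} (hf : Measurable f) (hfin : ∫⁻ x, ENNReal.ofReal (f x ^ 2) ∂μ ≠ ∞) :
    ∃ a : ℝ, ∫⁻ x, ENNReal.ofReal ((f x - a) ^ 2) ∂μ ≤
      ENNReal.ofReal (gapConst (Fintype.card ι) ε) *
        ∑ k, ∫⁻ x, ENNReal.ofReal ((f (T k x) - f x) ^ 2) ∂μ := by
  obtain ⟨a, ha1, ha2⟩ := exists_median (μ := μ) hf
  refine ⟨a, ?_⟩
  let g : X → ℝ := fun x => max (f x - a) 0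
  let h : X → ℝ := fun x => max (a - f x) 0
  have hg : Measurable g := (hf.sub_const a).max measurable_const
  have hh : Measurable h := (hf.const_sub a).max measurable_const
  have hsq : ∀ x, g x ^ 2 + h x ^ 2 = (f x - a) ^ 2 := fun x => by
    rcases le_total (f x) a with hx | hx
    · simp only [g, h, max_eq_right (sub_nonpos.2 hx), max_eq_left (sub_nonneg.2 hx)]; ring
    · simp only [g, h, max_eq_right (sub_nonpos.2 hx), max_eq_left (sub_nonneg.2 hx)]; ring
  have hdiff : ∀ x y, (g x - g y) ^ 2 + (h x - h y) ^ 2 ≤ (f x - f y) ^ 2 := fun x y => by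
    rcases le_total (f x) a with hx | hx <;> rcases le_total (f y) a with hy | hy <;>
    simp only [g, h, max_eq_right (sub_nonpos.2 hx), max_eq_left (sub_nonneg.2 hx),
      max_eq_right (sub_nonpos.2 hy), max_eq_left (sub_nonneg.2 hy)] <;>
    nlinarith [mul_nonneg (sub_nonneg.2 hx) (sub_nonneg.2 hy)]
  have hgh : ∫⁻ x, ENNReal.ofReal ((f x - a) ^ 2) ∂μ =
      ∫⁻ x, ENNReal.ofReal (g x ^ 2) ∂μ + ∫⁻ x, ENNReal.ofReal (h x ^ 2) ∂μ := by
    rw [← lintegral_add_left (hg.pow_const 2).ennreal_ofReal]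
    refine lintegral_congr fun x => ?_
    rw [← ENNReal.ofReal_add (sq_nonneg _) (sq_nonneg _), hsq]
  have hfin' : ∫⁻ x, ENNReal.ofReal ((f x - a) ^ 2) ∂μ ≠ ∞ := by
    have h1 : ∫⁻ x, ENNReal.ofReal ((f x - a) ^ 2) ∂μ ≤
        ∫⁻ x, (ENNReal.ofReal 2 * ENNReal.ofReal (f x ^ 2) + ENNReal.ofReal (2 * a ^ 2)) ∂μ := by
      refine lintegral_mono fun x => ?_
      rw [← ENNReal.ofReal_mul (by norm_num), ← ENNReal.ofReal_add (by positivity) (by positivity)]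
      exact ENNReal.ofReal_le_ofReal (by nlinarith [sq_nonneg (f x + a)])
    refine ne_top_of_le_ne_top ?_ h1
    rw [lintegral_add_right _ measurable_const, lintegral_const_mul' _ _ ENNReal.ofReal_ne_top,
      lintegral_const, measure_univ, mul_one]
    exact ENNReal.add_ne_top.2 ⟨ENNReal.mul_ne_top ENNReal.ofReal_ne_top hfin,
      ENNReal.ofReal_ne_top⟩
  rw [hgh] at hfin' ⊢
  rw [ENNReal.add_ne_top] at hfin'
  have k1 := lintegral_sq_le_of_small_support hε hT hexp hg (fun x => le_max_right _ _)
    ((measure_mono fun x (hx : 0 < g x) => by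
      have : 0 < f x - a := (lt_max_iff.1 hx).resolve_right (lt_irrefl _)
      exact sub_pos.1 this).trans ha1) hfin'.1
  have k2 := lintegral_sq_le_of_small_support hε hT hexp hh (fun x => le_max_right _ _)
    ((measure_mono fun x (hx : 0 < h x) => by
      have : 0 < a - f x := (lt_max_iff.1 hx).resolve_right (lt_irrefl _)
      exact sub_pos.1 this).trans ha2) hfin'.2
  refine (add_le_add k1 k2).trans ?_
  rw [← mul_add, ← Finset.sum_add_distrib]
  gcongr with k
  have hmk : Measurable fun x => ENNReal.ofReal ((g (T k x) - g x) ^ 2) :=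
    (((hg.comp (hT k)).sub hg).pow_const 2).ennreal_ofReal
  rw [← lintegral_add_left hmk]
  refine lintegral_mono fun x => ?_
  rw [← ENNReal.ofReal_add (sq_nonneg _) (sq_nonneg _)]
  exact ENNReal.ofReal_le_ofReal (hdiff _ _)

theorem eLpNorm_two_sq {E : Type*} [NormedAddCommGroup E] (f : X → E) :
    eLpNorm f 2 μ ^ 2 = ∫⁻ x, ‖f x‖ₑ ^ 2 ∂μ := by
  have h := eLpNorm_nnreal_pow_eq_lintegral (f := f) (μ := μ) (p := 2) two_ne_zero
  have h2 : ((2 : ℝ≥0) : ℝ) = ((2 : ℕ) : ℝ) := by norm_num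
  simp only [h2, ENNReal.rpow_natCast] at h
  exact h

theorem enorm_sq_eq_ofReal (z : ℂ) :
    ‖z‖ₑ ^ 2 = ENNReal.ofReal (z.re ^ 2) + ENNReal.ofReal (z.im ^ 2) := by
  rw [← ENNReal.ofReal_add (sq_nonneg _) (sq_nonneg _), ← ofReal_norm,
    ← ENNReal.ofReal_pow (norm_nonneg _), Complex.sq_norm, Complex.normSq_apply]
  congr 1
  ring

/-- The constant is `a` plus an error: `|a - ∫ f| ≤ ‖f - a‖₁ ≤ ‖f - a‖₂`. This replaces the median
by the mean. -/
theorem eLpNorm_sub_integral_le [IsProbabilityMeasure μ] {f : X → ℂ} (hf : MemLp f 2 μ) (a : ℂ) :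
    eLpNorm (fun x => f x - ∫ y, f y ∂μ) 2 μ ≤ 2 * eLpNorm (fun x => f x - a) 2 μ := by
  have hint : Integrable f μ := hf.integrable one_le_two
  have hsub : AEStronglyMeasurable (fun x => f x - a) μ :=
    hf.1.sub aestronglyMeasurable_const
  have h1 : (fun x => f x - ∫ y, f y ∂μ) = (fun x => f x - a) + fun _ => a - ∫ y, f y ∂μ := by
    ext x; simp
  have h2 : eLpNorm (fun _ : X => a - ∫ y, f y ∂μ) 2 μ ≤ eLpNorm (fun x => f x - a) 2 μ := by
    rw [eLpNorm_const _ two_ne_zero (IsProbabilityMeasure.ne_zero μ), measure_univ,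
      ENNReal.one_rpow, mul_one]
    have h3 : a - ∫ y, f y ∂μ = - ∫ y, (f y - a) ∂μ := by
      rw [integral_sub hint (integrable_const a), integral_const]
      simp
    rw [h3, enorm_neg]
    refine (enorm_integral_le_lintegral_enorm _).trans ?_
    rw [← eLpNorm_one_eq_lintegral_enorm]
    exact eLpNorm_le_eLpNorm_of_exponent_le one_le_two hsub
  rw [h1, two_mul]
  exact (eLpNorm_add_le hsub aestronglyMeasurable_const one_le_two).trans (add_le_add le_rfl h2)

/-- Cheeger's inequality: expansion of sets of measure at most one half implies a spectral gap. -/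
theorem spectralGap_of_expansion [IsProbabilityMeasure μ] (hε : 0 < ε)
    (hT : ∀ k, Measure.QuasiMeasurePreserving (T k) μ μ)
    (hexp : ∀ B, MeasurableSet B → μ B ≤ 1 / 2 →
      ENNReal.ofReal ε * μ B ≤ ∑ k, μ (moved (T k) B))
    {f : X → ℂ} (hf : MemLp f 2 μ) :
    eLpNorm (fun x => f x - ∫ y, f y ∂μ) 2 μ ^ 2 ≤
      ENNReal.ofReal (4 * gapConst (Fintype.card ι) ε) *
        ∑ k, eLpNorm (fun x => f (T k x) - f x) 2 μ ^ 2 := by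
  wlog hfm : Measurable f generalizing f
  · obtain ⟨f', hf'm, hff'⟩ := hf.1.aemeasurable
    have h := this (f := f') ((memLp_congr_ae hff').1 hf) hf'm
    have e1 : eLpNorm (fun x => f' x - ∫ y, f' y ∂μ) 2 μ =
        eLpNorm (fun x => f x - ∫ y, f y ∂μ) 2 μ := by
      rw [integral_congr_ae hff']
      refine eLpNorm_congr_ae ?_
      filter_upwards [hff'] with x hx
      rw [hx]
    have e2 : ∀ k, eLpNorm (fun x => f' (T k x) - f' x) 2 μ =
        eLpNorm (fun x => f (T k x) - f x) 2 μ := fun k => by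
      refine eLpNorm_congr_ae ?_
      filter_upwards [hff', (hT k).ae hff'] with x hx hx'
      rw [hx, hx']
    rw [e1] at h
    simpa only [e2] using h
  have hTm : ∀ k, Measurable (T k) := fun k => (hT k).measurable
  have hre : Measurable fun x => (f x).re := Complex.measurable_re.comp hfm
  have him : Measurable fun x => (f x).im := Complex.measurable_im.comp hfm
  have hQ : ∫⁻ x, ‖f x‖ₑ ^ 2 ∂μ ≠ ∞ := by
    rw [← eLpNorm_two_sq]
    exact ENNReal.pow_ne_top hf.2.ne
  have hsplit : ∀ h : X → ℂ, Measurable h → ∫⁻ x, ‖h x‖ₑ ^ 2 ∂μ =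
      ∫⁻ x, ENNReal.ofReal ((h x).re ^ 2) ∂μ + ∫⁻ x, ENNReal.ofReal ((h x).im ^ 2) ∂μ := by
    intro h hh
    have hre' : Measurable fun x => ENNReal.ofReal ((h x).re ^ 2) :=
      ((Complex.measurable_re.comp hh).pow_const 2).ennreal_ofReal
    rw [← lintegral_add_left hre']
    exact lintegral_congr fun x => enorm_sq_eq_ofReal _
  rw [hsplit f hfm, ENNReal.add_ne_top] at hQ
  obtain ⟨a, ha⟩ := exists_lintegral_sq_sub_le hε hTm hexp hre hQ.1
  obtain ⟨b, hb⟩ := exists_lintegral_sq_sub_le hε hTm hexp him hQ.2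
  have hmain : eLpNorm (fun x => f x - (⟨a, b⟩ : ℂ)) 2 μ ^ 2 ≤
      ENNReal.ofReal (gapConst (Fintype.card ι) ε) *
        ∑ k, eLpNorm (fun x => f (T k x) - f x) 2 μ ^ 2 := by
    simp only [eLpNorm_two_sq]
    rw [hsplit _ (hfm.sub_const _)]
    have hk : ∀ k, ∫⁻ x, ‖f (T k x) - f x‖ₑ ^ 2 ∂μ =
        ∫⁻ x, ENNReal.ofReal ((f (T k x) - f x).re ^ 2) ∂μ +
          ∫⁻ x, ENNReal.ofReal ((f (T k x) - f x).im ^ 2) ∂μ :=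
      fun k => hsplit (fun x => f (T k x) - f x) ((hfm.comp (hTm k)).sub hfm)
    simp only [hk, Complex.sub_re, Complex.sub_im]
    rw [Finset.sum_add_distrib, mul_add]
    exact add_le_add ha hb
  calc eLpNorm (fun x => f x - ∫ y, f y ∂μ) 2 μ ^ 2
      ≤ (2 * eLpNorm (fun x => f x - (⟨a, b⟩ : ℂ)) 2 μ) ^ 2 := by
        gcongr
        exact eLpNorm_sub_integral_le hf _
    _ = ENNReal.ofReal 4 * eLpNorm (fun x => f x - (⟨a, b⟩ : ℂ)) 2 μ ^ 2 := by
        rw [mul_pow]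
        congr 1
        rw [show (4 : ℝ) = 2 ^ 2 by norm_num, ENNReal.ofReal_pow zero_le_two]
        norm_num
    _ ≤ _ := by
        rw [ENNReal.ofReal_mul zero_le_four, mul_assoc]
        gcongr

end LevelSets

/-! ### From absolute to relative expansion. -/

section Growth

variable {X : Type*} [MeasurableSpace X] {G : Type*} [Group G] [MulAction G X]
  {R : Setoid X} {μ : Measure X} {c : G → X → ℝ}

/-- A point displaced by the union is displaced by all late members of the chain. This makes bounds
on displacement stable under increasing unions, as exhaustion demands. -/
theorem measure_moved_iUnion_le {T : X → X} {A : ℕ → Set X} (hA : Monotone A) {b : ℝ≥0∞}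
    (h : ∀ n, μ (moved T (A n)) ≤ b) : μ (moved T (⋃ n, A n)) ≤ b := by
  have hsub : moved T (⋃ n, A n) ⊆ ⋃ N, ⋂ n ≥ N, moved T (A n) := by
    intro x hx
    simp only [moved, Set.mem_ofPred_eq, Set.mem_iUnion, Set.mem_iInter] at hx ⊢
    by_cases h1 : ∃ n, x ∈ A n
    · obtain ⟨N, hN⟩ := h1
      have h2 : ∀ n, T x ∉ A n := fun n hn => hx ⟨fun _ => ⟨N, hN⟩, fun _ => ⟨n, hn⟩⟩
      exact ⟨N, fun n hn hiff => h2 n (hiff.2 (hA hn hN))⟩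
    · have h2 : ∃ n, T x ∈ A n := by
        by_contra h2
        exact hx ⟨fun h => absurd h h2, fun h => absurd h h1⟩
      obtain ⟨N, hN⟩ := h2
      exact ⟨N, fun n hn hiff => h1 ⟨n, hiff.1 (hA hn hN)⟩⟩
  have hmono : Monotone fun N => ⋂ n ≥ N, moved T (A n) := fun N M hNM =>
    Set.biInter_subset_biInter_left fun n hn => le_trans hNM hn
  refine (measure_mono hsub).trans ?_
  rw [hmono.measure_iUnion]
  exact iSup_le fun N => (measure_mono (Set.biInter_subset_of_mem le_rfl)).trans (h N)

/-- Only the part of `moved T A` outside `B` counts. By near independence this saves a factor `1 -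
μ(B)`, which the crude union bound would lose. -/
theorem moved_union_subset {Y : Type*} (T : Y → Y) (A B : Set Y) :
    moved T (A ∪ B) ⊆ moved T B ∪ moved T A \ B := by
  intro x hx
  simp only [moved, Set.mem_union, Set.mem_sdiff, Set.mem_ofPred_eq] at hx ⊢
  tauto

theorem symm_mem_boundedGroup {θ : X ≃ᵐ X} (h : θ ∈ boundedGroup R μ) :
    θ.symm ∈ boundedGroup R μ := by
  obtain ⟨hRθ, K, hK, h1, h2⟩ := h
  refine ⟨fun x => ?_, K, hK, h2, h1⟩
  have := hRθ (θ.symm x)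
  rw [θ.apply_symm_apply] at this
  exact R.symm this

theorem isBoundedAut_of_mem_boundedGroup [IsFiniteMeasure μ] {θ : X ≃ᵐ X}
    (h : θ ∈ boundedGroup R μ) : IsBoundedAut μ θ := by
  obtain ⟨-, K, hK, h1, h2⟩ := h
  exact isBoundedAut_of_distortionLE hK hK h1 h2

theorem mem_fullGroup_of_mem_boundedGroup [IsFiniteMeasure μ] {θ : X ≃ᵐ X}
    (h : θ ∈ boundedGroup R μ) : θ ∈ fullGroup R μ :=
  ⟨(isBoundedAut_of_mem_boundedGroup h).1, ae_of_all _ h.1⟩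

/-- A version of `IsGeneratingAction.exists_equidistribution` for finitely many sets. -/
theorem IsGeneratingAction.exists_equidistribution_finset [StandardBorelSpace X] [Countable G]
    [IsProbabilityMeasure μ] [MeasurableConstSMul G X] (hG : IsGeneratingAction R μ G)
    (hR : IsCountableNonsingular R μ) (herg : IsErgodic R μ) (hc : IsLogDeriv μ c) {η : ℝ≥0∞}
    {K : ℕ} (hη0 : 0 < η)
    (hη : ∀ Y, MeasurableSet Y → μ Yᶜ ≤ η → ∀ᵐ x ∂μ, x ∈ nb c Y K) {ι : Type*} (t : Finset ι)
    {D : ι → Set X} (hD : ∀ i, MeasurableSet (D i)) {ε : ℝ} (hε : 0 < ε) :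
    ∃ F : Finset (X ≃ᵐ X), (↑F ⊆ boundedGroup R μ) ∧ ∃ ε' : ℝ, 0 < ε' ∧
      ∀ B, MeasurableSet B → μ B ≠ 0 → (∀ θ ∈ F, μ.real (moved θ B) ≤ ε' * μ.real B) →
        ∀ i ∈ t, |μ.real (D i ∩ B) - μ.real (D i) * μ.real B| ≤ ε * μ.real B := by
  classical
  induction t using Finset.induction_on with
  | empty => exact ⟨∅, by simp, 1, one_pos, by simp⟩
  | insert j t _ ih =>
    obtain ⟨F, hF, e, he, h⟩ := ih
    obtain ⟨F', hF', e', he', h'⟩ := hG.exists_equidistribution hR herg hc hη0 hη (hD j) hε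
    refine ⟨F ∪ F', by simp [hF, hF'], min e e', lt_min he he', fun B hB hB0 hBF i hi => ?_⟩
    rcases Finset.mem_insert.1 hi with rfl | hi
    · refine h' B hB hB0 fun θ hθ => (hBF θ (Finset.mem_union_right _ hθ)).trans ?_
      gcongr
      exact min_le_right _ _
    · refine h B hB hB0 (fun θ hθ => (hBF θ (Finset.mem_union_left _ hθ)).trans ?_) i hi
      gcongr
      exact min_le_left _ _

/-- Some finite family of bounded automorphisms expands all sets of measure at most one half. -/
theorem IsGeneratingAction.exists_expansion [StandardBorelSpace X] [Countable G]
    [IsProbabilityMeasure μ] [MeasurableConstSMul G X] (hG : IsGeneratingAction R μ G)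
    (hR : IsCountableNonsingular R μ) (herg : IsErgodic R μ) (hSE : IsStronglyErgodic R μ)
    (hc : IsLogDeriv μ c) {η : ℝ≥0∞} {K : ℕ} (hη0 : 0 < η)
    (hη : ∀ Y, MeasurableSet Y → μ Yᶜ ≤ η → ∀ᵐ x ∂μ, x ∈ nb c Y K) :
    ∃ F : Finset (X ≃ᵐ X), (↑F ⊆ boundedGroup R μ) ∧ ∃ ε : ℝ, 0 < ε ∧
      ∀ B, MeasurableSet B → μ B ≤ 1 / 2 → μ B ≠ 0 →
        ∃ θ ∈ F, ε * μ.real B < μ.real (moved θ B) := by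
  classical
  have : MeasurableEq X := measurableEq_of_standardBorel
  by_contra! hcon
  obtain ⟨F₀, ε₀, hε₀, hS⟩ := hG.exists_finset_of_isStronglyErgodic hSE (δ := 1 / 16) (by simp)
  -- `t(1 - t) < 1/16` and `t ≤ 1/2` force `t < 1/8`. This later brings `A ∪ B` back from measure at
  -- most `1/4` to at most `1/8`.
  have hS' : ∀ B, MeasurableSet B → μ.real B ≤ 1 / 2 →
      (∀ g ∈ F₀, μ.real (moved (g • · : X → X) B) ≤ ε₀) → μ.real B ≤ 1 / 8 := by
    intro B hB hB2 hBF
    have h1 := hS B hB fun g hg => by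
      rw [← ENNReal.ofReal_coe_nnreal, ← ofReal_measureReal]
      exact ENNReal.ofReal_le_ofReal (hBF g hg)
    have h2 := (ENNReal.toReal_lt_toReal (by finiteness) (by finiteness)).2 h1
    rw [ENNReal.toReal_mul, ENNReal.toReal_sub_of_le prob_le_one ENNReal.one_ne_top,
      ← measureReal_def] at h2
    norm_num at h2
    nlinarith
  have hε₀' : (0 : ℝ) < ε₀ := hε₀
  obtain ⟨A, ⟨hA, hA8, hAF⟩, hmax⟩ := exists_ae_maximal μ
    (fun A => MeasurableSet A ∧ μ A ≤ 1 / 8 ∧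
      ∀ g ∈ F₀, μ (moved (g • · : X → X) A) ≤ ε₀ * μ A) (A₀ := ∅)
    ⟨.empty, by simp, by simp [moved]⟩ (fun A hmono h => by
      refine ⟨.iUnion fun n => (h n).1, ?_, fun g hg => measure_moved_iUnion_le hmono fun n =>
        ((h n).2.2 g hg).trans (by gcongr; exact Set.subset_iUnion A n)⟩
      rw [hmono.measure_iUnion]
      exact iSup_le fun n => (h n).2.1)
  have hA8' : μ.real A ≤ 1 / 8 := by
    have := ENNReal.toReal_mono (by finiteness) hA8
    norm_num at this
    simpa [measureReal_def] using this
  have hAF' : ∀ g ∈ F₀, μ.real (moved (g • · : X → X) A) ≤ ε₀ * μ.real A := fun g hg => by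
    have := ENNReal.toReal_mono (by finiteness) (hAF g hg)
    simpa [measureReal_def] using this
  -- The two bounds give `2ε ≤ ε₀(1 - ε)`, used for the displacement of `A ∪ B`, and `1/8 + ε < 1`,
  -- used for its strict growth.
  set ε : ℝ := min (ε₀ / 4) (1 / 4) with hεdef
  have hε : 0 < ε := by positivity
  have hε1 : ε ≤ ε₀ / 4 := min_le_left _ _
  have hε2 : ε ≤ 1 / 4 := min_le_right _ _
  obtain ⟨F₁, hF₁, e₁, he₁, hd₁⟩ := hG.exists_equidistribution hR herg hc hη0 hη hA hε
  have hDm : ∀ g : G, MeasurableSet (moved (g • · : X → X) A) := fun g =>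
    measurableSet_moved (measurable_const_smul g) hA
  obtain ⟨F₂, hF₂, e₂, he₂, hd₂⟩ :=
    hG.exists_equidistribution_finset hR herg hc hη0 hη F₀ hDm hε
  set e : ℝ := min ε (min e₁ e₂) with hedef
  have he : 0 < e := by positivity
  obtain ⟨B, hB, hB2, hB0, hBF⟩ := hcon
    (F₀.image (fun g => (MeasurableEquiv.smul g : X ≃ᵐ X)) ∪ (F₁ ∪ F₂)) (by
      intro θ hθ
      simp only [Finset.coe_union, Finset.coe_image, Set.mem_union, Set.mem_image] at hθ
      rcases hθ with ⟨g, -, rfl⟩ | h | h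
      · exact hG.smul_mem_boundedGroup g
      · exact hF₁ h
      · exact hF₂ h) e he
  have hBpos : 0 < μ.real B := ENNReal.toReal_pos hB0 (measure_ne_top _ _)
  have hB1 : μ.real B ≤ 1 := measureReal_le_one
  have hBF0 : ∀ g ∈ F₀, μ.real (moved (g • · : X → X) B) ≤ ε * μ.real B := fun g hg =>
    (hBF (MeasurableEquiv.smul g)
      (Finset.mem_union_left _ (Finset.mem_image_of_mem _ hg))).trans
      (by gcongr; exact min_le_left _ _)
  have hBA := hd₁ B hB hB0 fun θ hθ =>
    (hBF θ (Finset.mem_union_right _ (Finset.mem_union_left _ hθ))).trans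
      (by gcongr; exact (min_le_right _ _).trans (min_le_left _ _))
  have hBD := hd₂ B hB hB0 fun θ hθ =>
    (hBF θ (Finset.mem_union_right _ (Finset.mem_union_right _ hθ))).trans
      (by gcongr; exact (min_le_right _ _).trans (min_le_right _ _))
  have hB8 : μ.real B ≤ 1 / 8 := by
    refine hS' B hB ?_ fun g hg => (hBF0 g hg).trans (by nlinarith)
    have := ENNReal.toReal_mono (by finiteness) hB2
    norm_num at this
    simpa [measureReal_def] using this
  have hAB : μ.real (A ∪ B) = μ.real A + μ.real B - μ.real (A ∩ B) := by
    linarith [measureReal_union_add_inter (μ := μ) (s := A) hB]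
  -- The displacement is at most `ε μ(B)` from `B` plus `ε₀ μ(A)(1 - μ(B)) + ε μ(B)` from the part
  -- of `A`, while `μ(A ∪ B) ≥ μ(A)(1 - μ(B)) + (1 - ε) μ(B)`.
  have hABF : ∀ g ∈ F₀, μ.real (moved (g • · : X → X) (A ∪ B)) ≤ ε₀ * μ.real (A ∪ B) := by
    intro g hg
    have h1 := (measureReal_mono (μ := μ) (moved_union_subset (g • · : X → X) A B)).trans
      (measureReal_union_le _ _)
    have h2 := measureReal_inter_add_sdiff (μ := μ) (s := moved (g • · : X → X) A) hB
    have h3 := (abs_le.1 (hBD g hg)).1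
    have h4 := (abs_le.1 hBA).2
    have h5 := hBF0 g hg
    have h6 := hAF' g hg
    have h7 : μ.real (moved (g • · : X → X) A) * (1 - μ.real B) ≤
        ε₀ * μ.real A * (1 - μ.real B) := by
      gcongr
    have h8 : (ε₀ : ℝ) * (μ.real (A ∩ B) - μ.real A * μ.real B) ≤ ε₀ * (ε * μ.real B) := by
      gcongr
    have h9 : (2 * ε) * μ.real B ≤ ε₀ * (1 - ε) * μ.real B := by
      refine mul_le_mul_of_nonneg_right ?_ hBpos.le
      nlinarith
    rw [hAB]
    nlinarith
  have hAB1 : μ.real (A ∪ B) ≤ 1 := measureReal_le_one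
  have hAB8 : μ.real (A ∪ B) ≤ 1 / 8 := by
    refine hS' _ (hA.union hB) ?_ fun g hg => (hABF g hg).trans (by nlinarith)
    linarith [measureReal_nonneg (μ := μ) (s := A ∩ B)]
  -- Maximality gives `μ(B) ≤ μ(A ∩ B)`, whereas `μ(A ∩ B) ≤ (μ(A) + ε) μ(B) ≤ (3/8) μ(B)` and `B`
  -- is not null.
  have hlt := hmax (A ∪ B) ⟨hA.union hB, ?_, fun g hg => ?_⟩ Set.subset_union_left
  · have h1 := ENNReal.toReal_mono (by finiteness) hlt
    rw [← measureReal_def, ← measureReal_def, hAB] at h1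
    have h2 := (abs_le.1 hBA).2
    nlinarith
  · rw [← ofReal_measureReal]
    refine (ENNReal.ofReal_le_ofReal hAB8).trans ?_
    rw [ENNReal.ofReal_div_of_pos (by norm_num)]
    simp
  · rw [← ofReal_measureReal, ← ofReal_measureReal (s := A ∪ B), ← ENNReal.ofReal_coe_nnreal,
      ← ENNReal.ofReal_mul hε₀'.le]
    exact ENNReal.ofReal_le_ofReal (hABF g hg)

theorem IsGeneratingAction.exists_spectralGap [StandardBorelSpace X] [Countable G]
    [IsProbabilityMeasure μ] [MeasurableConstSMul G X] (hG : IsGeneratingAction R μ G)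
    (hR : IsCountableNonsingular R μ) (herg : IsErgodic R μ) (hSE : IsStronglyErgodic R μ)
    (hc : IsLogDeriv μ c) {η : ℝ≥0∞} {K : ℕ} (hη0 : 0 < η)
    (hη : ∀ Y, MeasurableSet Y → μ Yᶜ ≤ η → ∀ᵐ x ∂μ, x ∈ nb c Y K) :
    ∃ κ : ℝ≥0, 0 < κ ∧ ∃ (n : ℕ) (θ : Fin n → X ≃ᵐ X),
      (∀ k, θ k ∈ fullGroup R μ ∧ IsBoundedAut μ (θ k)) ∧
      ∀ f : X → ℂ, MemLp f 2 μ →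
        eLpNorm (fun x => f x - ∫ y, f y ∂μ) 2 μ ^ 2 ≤
          (κ : ℝ≥0∞) * ∑ k, eLpNorm (fun x => f ((θ k).symm x) - f x) 2 μ ^ 2 := by
  obtain ⟨F, hF, ε, hε, hexp⟩ := hG.exists_expansion hR herg hSE hc hη0 hη
  -- Inverses, since `θ(f) = f ∘ θ⁻¹`: the maps composed with `f` are then the expanding ones.
  let θ : Fin F.card → X ≃ᵐ X := fun k => (F.equivFin.symm k).1.symm
  have hθ : ∀ k, θ k ∈ boundedGroup R μ := fun k =>
    symm_mem_boundedGroup (hF (F.equivFin.symm k).2)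
  have hpos : 0 < 4 * gapConst (Fintype.card (Fin F.card)) ε := mul_pos four_pos (gapConst_pos hε)
  refine ⟨(4 * gapConst (Fintype.card (Fin F.card)) ε).toNNReal, Real.toNNReal_pos.2 hpos,
    F.card, θ, fun k => ⟨mem_fullGroup_of_mem_boundedGroup (hθ k),
      isBoundedAut_of_mem_boundedGroup (hθ k)⟩, fun f hf => ?_⟩
  refine spectralGap_of_expansion (T := fun k => (θ k).symm) hε
    (fun k => (isBoundedAut_of_mem_boundedGroup (hθ k)).1.2) (fun B hB hB2 => ?_) hf
  rcases eq_or_ne (μ B) 0 with h0 | h0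
  · simp [h0]
  obtain ⟨τ, hτ, hlt⟩ := hexp B hB hB2 h0
  have hk : (θ (F.equivFin ⟨τ, hτ⟩)).symm = τ := by simp [θ]
  refine le_trans ?_ (Finset.single_le_sum (f := fun k => μ (moved (θ k).symm B))
    (fun _ _ => zero_le) (Finset.mem_univ (F.equivFin ⟨τ, hτ⟩)))
  rw [hk, ← ofReal_measureReal, ← ofReal_measureReal (s := moved τ B), ← ENNReal.ofReal_mul hε.le]
  exact ENNReal.ofReal_le_ofReal hlt.le

/-- The two cases differ only in the cocycle and its proximity statement: the zero cocycle for
invariant `μ`, the Radon–Nikodym cocycle in type III. -/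
theorem IsStronglyErgodic.exists_spectralGap [StandardBorelSpace X] [IsProbabilityMeasure μ]
    (hSE : IsStronglyErgodic R μ) (hR : IsCountableNonsingular R μ) (herg : IsErgodic R μ)
    (htype : IsInvariant R μ ∨ IsTypeIII R μ) :
    ∃ κ : ℝ≥0, 0 < κ ∧ ∃ (n : ℕ) (θ : Fin n → X ≃ᵐ X),
      (∀ k, θ k ∈ fullGroup R μ ∧ IsBoundedAut μ (θ k)) ∧
      ∀ f : X → ℂ, MemLp f 2 μ →
        eLpNorm (fun x => f x - ∫ y, f y ∂μ) 2 μ ^ 2 ≤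
          (κ : ℝ≥0∞) * ∑ k, eLpNorm (fun x => f ((θ k).symm x) - f x) 2 μ ^ 2 := by
  obtain ⟨G, _, _, _, _, hG⟩ := exists_generating_action hR
  rcases htype with hinv | hIII
  · obtain ⟨η, K, hη0, hη⟩ := exists_uniform_nb_of_isInvariant hG herg
    exact hG.exists_spectralGap hR herg hSE (hG.isLogDeriv_zero hinv) hη0 hη
  · obtain ⟨c, hc⟩ := exists_isLogDeriv (G := G) μ fun g => hG.quasiMeasurePreserving g
    obtain ⟨η, K, hη0, hη⟩ := hIII.exists_uniform_nb hG hSE hc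
    exact hG.exists_spectralGap hR herg hSE hc hη0 hη

end Growth

/-! ### From the spectral gap to strong ergodicity. -/

section Converse

variable {X : Type*} [MeasurableSpace X] {R : Setoid X} {μ : Measure X}

theorem eLpNorm_indicator_comp_sub (T : X → X) (hT : Measurable T) {A : Set X}
    (hA : MeasurableSet A) :
    eLpNorm (fun x => A.indicator (fun _ => (1 : ℂ)) (T x) - A.indicator (fun _ => 1) x) 2 μ ^ 2 =
      μ ((T ⁻¹' A) ∆ A) := by
  rw [eLpNorm_two_sq, ← lintegral_indicator_one ((hT hA).symmDiff hA)]
  refine lintegral_congr fun x => ?_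
  by_cases h1 : T x ∈ A <;> by_cases h2 : x ∈ A <;> simp [Set.mem_symmDiff, h1, h2]

theorem eLpNorm_indicator_sub_integral [IsProbabilityMeasure μ] {A : Set X}
    (hA : MeasurableSet A) :
    eLpNorm (fun x => A.indicator (fun _ => (1 : ℂ)) x -
      ∫ y, A.indicator (fun _ => (1 : ℂ)) y ∂μ) 2 μ ^ 2 = μ A * (1 - μ A) := by
  have hint : ∫ y, A.indicator (fun _ => (1 : ℂ)) y ∂μ = (μ.real A : ℂ) := by
    rw [integral_indicator_const _ hA]
    simp
  have hp : μ.real A ≤ 1 := measureReal_le_one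
  have h0 : 0 ≤ μ.real A := measureReal_nonneg
  have hpt : ∀ x, ‖A.indicator (fun _ => (1 : ℂ)) x - (μ.real A : ℂ)‖ₑ ^ 2 =
      A.indicator (fun _ => ENNReal.ofReal ((1 - μ.real A) ^ 2)) x +
        Aᶜ.indicator (fun _ => ENNReal.ofReal (μ.real A ^ 2)) x := by
    intro x
    by_cases hx : x ∈ A
    · simp only [Set.indicator_of_mem hx, Set.indicator_of_notMem (Set.notMem_compl_iff.2 hx)]
      rw [add_zero, ← Complex.ofReal_one, ← Complex.ofReal_sub, ← ofReal_norm,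
        Complex.norm_real, Real.norm_of_nonneg (by linarith),
        ENNReal.ofReal_pow (by linarith)]
    · simp only [Set.indicator_of_notMem hx, Set.indicator_of_mem (Set.mem_compl hx)]
      rw [zero_add, zero_sub, enorm_neg, ← ofReal_norm, Complex.norm_real,
        Real.norm_of_nonneg h0, ENNReal.ofReal_pow h0]
  rw [eLpNorm_two_sq, hint, lintegral_congr hpt,
    lintegral_add_left (measurable_const.indicator hA), lintegral_indicator_const hA,
    lintegral_indicator_const hA.compl, prob_compl_eq_one_sub hA, ← ofReal_measureReal,
    ← ENNReal.ofReal_one, ← ENNReal.ofReal_sub _ h0, ← ENNReal.ofReal_mul (by positivity),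
    ← ENNReal.ofReal_mul (by positivity), ← ENNReal.ofReal_mul h0, ← ENNReal.ofReal_add
      (by positivity) (mul_nonneg (by positivity) (by linarith))]
  congr 1
  ring

theorem isStronglyErgodic_of_spectralGap [IsProbabilityMeasure μ] {κ : ℝ≥0} {ι : Type*} [Fintype ι]
    {θ : ι → X ≃ᵐ X} (hθ : ∀ k, θ k ∈ fullGroup R μ)
    (h : ∀ f : X → ℂ, MemLp f 2 μ →
      eLpNorm (fun x => f x - ∫ y, f y ∂μ) 2 μ ^ 2 ≤
        (κ : ℝ≥0∞) * ∑ k, eLpNorm (fun x => f ((θ k).symm x) - f x) 2 μ ^ 2) :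
    IsStronglyErgodic R μ := by
  intro A hA hlim
  have hbound : ∀ n, μ (A n) * (1 - μ (A n)) ≤ κ * ∑ k, μ (A n ∆ (θ k '' A n)) := by
    intro n
    have h1 := h ((A n).indicator fun _ => 1)
      (memLp_indicator_const 2 (hA n) 1 (Or.inr (measure_ne_top _ _)))
    rw [eLpNorm_indicator_sub_integral (hA n)] at h1
    refine h1.trans_eq ?_
    congr 1
    refine Finset.sum_congr rfl fun k _ => ?_
    rw [eLpNorm_indicator_comp_sub _ (θ k).symm.measurable (hA n), symmDiff_comm,
      (θ k).image_eq_preimage_symm]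
  refine tendsto_of_tendsto_of_tendsto_of_le_of_le tendsto_const_nhds ?_ (fun _ => zero_le) hbound
  have h2 : Tendsto (fun n => ∑ k, μ (A n ∆ (θ k '' A n))) atTop (𝓝 (∑ _k : ι, 0)) :=
    tendsto_finsetSum _ fun k _ => hlim _ (hθ k)
  have h3 := ENNReal.Tendsto.const_mul (a := (κ : ℝ≥0∞)) h2 (Or.inr ENNReal.coe_ne_top)
  simpa using h3

end Converse

end EqRel

theorem theoremA {X : Type*} [MeasurableSpace X] [StandardBorelSpace X]
    (μ : Measure X) [IsProbabilityMeasure μ] (R : Setoid X)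
    (hR : EqRel.IsCountableNonsingular R μ) (herg : EqRel.IsErgodic R μ)
    (htype : EqRel.IsInvariant R μ ∨ EqRel.IsTypeIII R μ) :
    EqRel.IsStronglyErgodic R μ ↔
      ∃ κ : ℝ≥0, 0 < κ ∧ ∃ (n : ℕ) (θ : Fin n → X ≃ᵐ X),
        (∀ k, θ k ∈ EqRel.fullGroup R μ ∧ EqRel.IsBoundedAut μ (θ k)) ∧
        ∀ f : X → ℂ, MemLp f 2 μ →
          eLpNorm (fun x => f x - ∫ y, f y ∂μ) 2 μ ^ 2 ≤
            (κ : ℝ≥0∞) * ∑ k, eLpNorm (fun x => f ((θ k).symm x) - f x) 2 μ ^ 2 := by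
  refine ⟨fun hSE => hSE.exists_spectralGap hR herg htype, ?_⟩
  rintro ⟨κ, -, n, θ, hθ, h⟩
  exact EqRel.isStronglyErgodic_of_spectralGap (fun k => (hθ k).1) h
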